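/- Let $k$ be a field of characteristic $0$, let $E$ be a finite-dimensional $k$-vector space with an action of $\Sigma_2$, let $\Gamma(E)$ be the free operad on $E$ placed in arity $2$ (and degree $0$), so that $\Gamma(E)(3)\cong (E\otimes E)^{\oplus 3}$, and let $P=\Gamma(E)/(R)$ be the quadratic operad with relations a $\Sigma_3$-submodule $R\subset\Gamma(E)(3)$. Let $P^!=\Gamma(E^\vee)/(R^\perp)$ be its quadratic dual, where $E^\vee=\mathrm{Lin}(E,k)\otimes\mathrm{sgn}_2$ and $R^\perp$ is the annihilator of $R$ in $\Gamma(E^\vee)(3)\cong\Gamma(E)(3)^{*}\otimes \mathrm{sgn}_3$. *Suspension.* For an operad $Q$ in vector spaces, $\Lambda Q$ is the graded operad with $\Lambda Q(n)=Q(n)\otimes\mathrm{sgn}_n$ placed in degree $n-1$ and with $p\circ_i^{\Lambda} q=(-1)^{(i-1)|q|}\,p\circ_i q$, where $|q|$ is the degree of $q$ in $\Lambda Q$. The tensor product of operads is $(P\otimes Q)(n)=P(n)\otimes Q(n)$. *Cochains.* For a $P$-algebra $A$, that is, a vector space with a homomorphism of operads $\alpha:P\to\mathrm{End}_A$, put,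 for $m\ge 0$, $$\widetilde C^m_P(A;A)=\mathrm{Lin}((\downarrow A)^{\otimes m+1},\downarrow A)\otimes P^!(m+1)\ \cong\ \Lambda(\mathrm{End}_A\otimes P^!)(m+1),\qquad C^m_P(A;A)=\widetilde C^m_P(A;A)^{\Sigma_{m+1}},$$ where $\downarrow A$ is $A$ placed in degree $-1$; let $\iota:C^m_P(A;A)\hookrightarrow\widetilde C^m_P(A;A)$ be the inclusion and $\mathrm{Aver}=\frac1{(m+1)!}\sum_{\sigma\in\Sigma_{m+1}}\sigma:\widetilde C^m_P(A;A)\to C^m_P(A;A)$ the averaging. $C^*_P(A;A)=\bigoplus_{m\ge0}C^m_P(A;A)$ is a graded vector space. *Natural operations.* Let $m_1,\dots,m_n,m\ge 0$. Let $T$ be a rooted tree with input legs labelled bijectively by $1,\dots,m+1$, with white vertices $w_1,\dots,w_n$, the vertex $w_i$ having $m_i+1$ linearly ordered input edges, and with finitely many black vertices, each of arity $r\ge2$ and decorated by an element of $P(r)$; let $\Phi:P^!(m_1+1)\otimes\cdots\otimes P^!(m_n+1)\to P^!(m+1)$ be linear. For every $P$-algebra $A$ and $f_i\in C_P^{m_i}(A;A)$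 with $\iota(f_i)=\sum_{\kappa}\phi_i^{\kappa}\otimes q^i_{\kappa}$, put $$U_{(T,\Phi)}(f_1,\dots,f_n)=\mathrm{Aver}\Big(\sum_{\kappa_1,\dots,\kappa_n}T(\phi_1^{\kappa_1},\dots,\phi_n^{\kappa_n})\otimes\Phi(q^1_{\kappa_1},\dots,q^n_{\kappa_n})\Big)\in C^m_P(A;A),$$ where $T(\phi_1,\dots,\phi_n)$ is the composition in $\mathrm{End}_A$ along $T$ of the $\phi_i$ placed at the $w_i$ and of the images under $\alpha$ of the decorations of the black vertices. A *natural operation* of arity $n$ and degree $d$ is a family, indexed by all $P$-algebras $A$, of $n$-linear maps of degree $d$ on $C^*_P(A;A)$ whose restriction to each $C^{m_1}_P(A;A)\otimes\cdots\otimes C^{m_n}_P(A;A)$ is given by a linear combination, not depending on $A$, of operations $U_{(T,\Phi)}$. Let $B_P$ be the graded operad generated by the natural operations inside the operad of all families of homogeneous multilinear maps on the graded vector spaces $C^*_P(A;A)$ (with the Koszul sign convention). **Theorem.** There is a morphism of graded (non-differential) operads $$cup:\Lambda(P\otimes P^!)\longrightarrow B_P,$$ injective in every arity and degree, whose values are natural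 operations, and which makes $\Lambda(P\otimes P^!)$ act on the graded vector space $C_P^*(A;A)$ of every $P$-algebra $A$ by $$cup(t)(f_1,\dots,f_n)=\mathrm{Aver}\big(\Lambda(\alpha\otimes\mathrm{id})(t)(\iota(f_1),\dots,\iota(f_n))\big)$$ for $t\in\Lambda(P\otimes P^!)(n)$ and $f_i\in C_P^{m_i}(A;A)$, where $\Lambda(\alpha\otimes\mathrm{id}):\Lambda(P\otimes P^!)\to\Lambda(\mathrm{End}_A\otimes P^!)$ and the right-hand side is the operadic composition in $\Lambda(\mathrm{End}_A\otimes P^!)$ of $\Lambda(\alpha\otimes\mathrm{id})(t)$ with the elements $\iota(f_i)\in\Lambda(\mathrm{End}_A\otimes P^!)(m_i+1)$. -/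

import Mathlib

universe u v w

noncomputable section

namespace NatOps

open scoped TensorProduct DirectSum

-- Positions of inputs in a partial composite.  Throughout, positions are numbered from 0.

/-- In `p ∘ᵢ q` (with `p` of arity `m`, `q` of arity `n`), the position of the `s`-th input of `q`. -/
def inner {m n l : ℕ} (h : l + 1 = m + n) (i : Fin m) (s : Fin n) : Fin l :=
  ⟨i + s, by omega⟩

/-- In `p ∘ᵢ q` (with `p` of arity `m`, `q` of arity `n`), the position of the `j`-th input of `p`,
`j ≠ i`. -/
def outer {m n l : ℕ} (h : l + 1 = m + n) (i j : Fin m) (hj : j ≠ i) : Fin l :=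
  if hlt : j < i then ⟨j, by omega⟩
  else ⟨j + n - 1, by have := Fin.val_ne_of_ne hj; omega⟩

theorem outer_val_lt {m n l : ℕ} (h : l + 1 = m + n) {i j : Fin m} (hlt : j < i) (hj : j ≠ i) :
    (outer h i j hj : ℕ) = j := by simp [outer, hlt]

theorem outer_val_gt {m n l : ℕ} (h : l + 1 = m + n) {i j : Fin m} (hlt : i < j) (hj : j ≠ i) :
    (outer h i j hj : ℕ) = j + n - 1 := by simp [outer, not_lt.2 hlt.le]

theorem outer_ne_inner {m n l : ℕ} (h : l + 1 = m + n) (i j : Fin m) (hj : j ≠ i) (s : Fin n) :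
    outer h i j hj ≠ inner h i s := by
  intro e
  have e' := congrArg Fin.val e
  rcases lt_or_gt_of_ne hj with hlt | hlt
  · rw [outer_val_lt h hlt] at e'; simp only [inner] at e'; omega
  · rw [outer_val_gt h hlt] at e'; simp only [inner] at e'; omega

theorem inner_inj {m n l : ℕ} (h : l + 1 = m + n) (i : Fin m) {s t : Fin n}
    (e : inner h i s = inner h i t) : s = t := by
  have e' := congrArg Fin.val e
  simp only [inner] at e'; omega

theorem outer_inj {m n l : ℕ} (h : l + 1 = m + n) (i : Fin m) {j k : Fin m} (hj : j ≠ i)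
    (hk : k ≠ i) (e : outer h i j hj = outer h i k hk) : j = k := by
  have e' := congrArg Fin.val e
  rcases lt_or_gt_of_ne hj with h1 | h1 <;> rcases lt_or_gt_of_ne hk with h2 | h2 <;>
  simp only [outer_val_lt h, outer_val_gt h, h1, h2] at e' <;> omega

theorem inner_or_outer {m n l : ℕ} (h : l + 1 = m + n) (i : Fin m) (t : Fin l) :
    (∃ s, t = inner h i s) ∨ ∃ j hj, t = outer h i j hj := by
  by_cases h1 : t.val < i.val
  · right
    refine ⟨⟨t, by omega⟩, by intro e; rw [← e] at h1; simp at h1, Fin.ext ?_⟩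
    rw [outer_val_lt h (show (⟨t, by omega⟩ : Fin m) < i from h1)]
  · by_cases h2 : t.val < i + n
    · left
      exact ⟨⟨t - i, by omega⟩, Fin.ext (by simp only [inner]; omega)⟩
    · right
      have h3 : i < (⟨t + 1 - n, by omega⟩ : Fin m) := by
        rw [Fin.lt_def]; simp only; omega
      refine ⟨⟨t + 1 - n, by omega⟩, h3.ne', Fin.ext ?_⟩
      rw [outer_val_gt h h3]; simp only; omega

/-- An operad in vector spaces over `k`: right actions of the symmetric groups, a unit and partial
compositions `p ∘ᵢ q`, subject to the usual axioms. -/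
structure Operad (k : Type u) [Field k] where
  obj : ℕ → Type v
  [addCommGroup : ∀ n, AddCommGroup (obj n)]
  [module : ∀ n, Module k (obj n)]
  act : ∀ {n : ℕ}, Equiv.Perm (Fin n) → obj n →ₗ[k] obj n
  one : obj 1
  circ : ∀ {m n l : ℕ}, l + 1 = m + n → Fin m → (obj m →ₗ[k] obj n →ₗ[k] obj l)
  act_one : ∀ {n : ℕ} (p : obj n), act 1 p = p
  act_mul : ∀ {n : ℕ} (σ τ : Equiv.Perm (Fin n)) (p : obj n), act (σ * τ) p = act τ (act σ p)
  one_circ : ∀ {n : ℕ} (h : n + 1 = 1 + n) (q : obj n), circ h 0 one q = q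
  circ_one : ∀ {m : ℕ} (h : m + 1 = m + 1) (i : Fin m) (p : obj m), circ h i p one = p
  circ_circ : ∀ {m n r l l' N : ℕ} (h₁ : l + 1 = m + n) (h₂ : N + 1 = l + r) (h₃ : l' + 1 = n + r)
    (h₄ : N + 1 = m + l') (i : Fin m) (j : Fin n) (p : obj m) (q : obj n) (s : obj r),
    circ h₂ (inner h₁ i j) (circ h₁ i p q) s = circ h₄ i p (circ h₃ j q s)
  circ_comm : ∀ {m n r l l' N : ℕ} (h₁ : l + 1 = m + n) (h₂ : N + 1 = l + r) (h₃ : l' + 1 = m + r)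
    (h₄ : N + 1 = l' + n) (i j : Fin m) (hij : i < j) (p : obj m) (q : obj n) (s : obj r),
    circ h₂ (outer h₁ i j hij.ne') (circ h₁ i p q) s =
      circ h₄ (outer h₃ j i hij.ne) (circ h₃ j p s) q
  circ_act : ∀ {m n l : ℕ} (h : l + 1 = m + n) (i : Fin m) (σ : Equiv.Perm (Fin m))
    (τ : Equiv.Perm (Fin n)) (ρ : Equiv.Perm (Fin l)),
    (∀ s, ρ (inner h i s) = inner h (σ i) (τ s)) →
    (∀ j (hj : j ≠ i), ρ (outer h i j hj) = outer h (σ i) (σ j) (fun e => hj (σ.injective e))) →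
    ∀ (p : obj m) (q : obj n), circ h i (act σ p) (act τ q) = act ρ (circ h (σ i) p q)

attribute [instance] Operad.addCommGroup Operad.module

/-- Homomorphisms of operads. -/
structure Operad.Hom {k : Type u} [Field k] (P : Operad.{u, v} k) (Q : Operad.{u, w} k) where
  app : ∀ n, P.obj n →ₗ[k] Q.obj n
  map_act : ∀ {n : ℕ} (σ : Equiv.Perm (Fin n)) (p : P.obj n), app n (P.act σ p) = Q.act σ (app n p)
  map_one : app 1 P.one = Q.one
  map_circ : ∀ {m n l : ℕ} (h : l + 1 = m + n) (i : Fin m) (p : P.obj m) (q : P.obj n),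
    app l (P.circ h i p q) = Q.circ h i (app m p) (app n q)

section Tensor

variable {k : Type u} [Field k]

/-- The (Hadamard) tensor product of operads, `(P ⊗ Q)(n) = P(n) ⊗ Q(n)`. -/
def Operad.tensor (P : Operad.{u, v} k) (Q : Operad.{u, w} k) : Operad.{u, max v w} k where
  obj n := P.obj n ⊗[k] Q.obj n
  act σ := TensorProduct.map (P.act σ) (Q.act σ)
  one := P.one ⊗ₜ Q.one
  circ h i := TensorProduct.map₂ (P.circ h i) (Q.circ h i)
  act_one x := by
    induction x using TensorProduct.induction_on with
    | zero => simp
    | tmul p q => simp [P.act_one, Q.act_one]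
    | add x y hx hy => rw [map_add, hx, hy]
  act_mul σ τ x := by
    induction x using TensorProduct.induction_on with
    | zero => simp
    | tmul p q => simp [P.act_mul, Q.act_mul]
    | add x y hx hy => simp only [map_add, hx, hy]
  one_circ h x := by
    induction x using TensorProduct.induction_on with
    | zero => simp
    | tmul p q => simp [P.one_circ, Q.one_circ]
    | add x y hx hy => simp only [map_add, hx, hy]
  circ_one h i x := by
    induction x using TensorProduct.induction_on with
    | zero => simp
    | tmul p q => simp [P.circ_one, Q.circ_one]
    | add x y hx hy => simp only [map_add, LinearMap.add_apply, hx, hy]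
  circ_circ h₁ h₂ h₃ h₄ i j x y z := by
    induction x using TensorProduct.induction_on with
    | zero => simp
    | add x x' hx hx' => simp only [map_add, LinearMap.add_apply, hx, hx']
    | tmul p p' =>
      induction y using TensorProduct.induction_on with
      | zero => simp
      | add x x' hx hx' => simp only [map_add, LinearMap.add_apply, hx, hx']
      | tmul q q' =>
        induction z using TensorProduct.induction_on with
        | zero => simp
        | add x x' hx hx' => simp only [map_add, hx, hx']
        | tmul s s' => simp [P.circ_circ h₁ h₂ h₃ h₄, Q.circ_circ h₁ h₂ h₃ h₄]
  circ_comm h₁ h₂ h₃ h₄ i j hij x y z := by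
    induction x using TensorProduct.induction_on with
    | zero => simp
    | add x x' hx hx' => simp only [map_add, LinearMap.add_apply, hx, hx']
    | tmul p p' =>
      induction y using TensorProduct.induction_on with
      | zero => simp
      | add x x' hx hx' => simp only [map_add, LinearMap.add_apply, hx, hx']
      | tmul q q' =>
        induction z using TensorProduct.induction_on with
        | zero => simp
        | add x x' hx hx' => simp only [map_add, LinearMap.add_apply, hx, hx']
        | tmul s s' =>
          simp [P.circ_comm h₁ h₂ h₃ h₄ i j hij, Q.circ_comm h₁ h₂ h₃ h₄ i j hij]
  circ_act h i σ τ ρ h₁ h₂ x y := by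
    induction x using TensorProduct.induction_on with
    | zero => simp
    | add x x' hx hx' => simp only [map_add, LinearMap.add_apply, hx, hx']
    | tmul p p' =>
      induction y using TensorProduct.induction_on with
      | zero => simp
      | add x x' hx hx' => simp only [map_add, hx, hx']
      | tmul q q' => simp [P.circ_act h i σ τ ρ h₁ h₂, Q.circ_act h i σ τ ρ h₁ h₂]

end Tensor

section EndOp

variable {A : Type v}

/-- The arguments of the outer map in a partial composite of multilinear maps. -/
def circArg {m n l : ℕ} (h : l + 1 = m + n) (i : Fin m) (g : (Fin n → A) → A) (x : Fin l → A) :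
    Fin m → A :=
  fun j => if hj : j = i then g (fun s => x (inner h i s)) else x (outer h i j hj)

theorem circArg_self {m n l : ℕ} (h : l + 1 = m + n) (i : Fin m) (g : (Fin n → A) → A)
    (x : Fin l → A) : circArg h i g x i = g (fun s => x (inner h i s)) := by simp [circArg]

theorem circArg_ne {m n l : ℕ} (h : l + 1 = m + n) (i j : Fin m) (hj : j ≠ i)
    (g : (Fin n → A) → A) (x : Fin l → A) : circArg h i g x j = x (outer h i j hj) := by
  simp [circArg, hj]

theorem circArg_update_inner {m n l : ℕ} (h : l + 1 = m + n) (i : Fin m) (g : (Fin n → A) → A)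
    (x : Fin l → A) (s : Fin n) (a : A) :
    circArg h i g (Function.update x (inner h i s) a) =
      Function.update (circArg h i g x) i
        (g (Function.update (fun s => x (inner h i s)) s a)) := by
  funext j
  by_cases hj : j = i
  · subst hj
    rw [circArg_self, Function.update_self]
    congr 1
    funext t
    by_cases ht : t = s
    · subst ht; simp
    · rw [Function.update_of_ne ht, Function.update_of_ne (fun e => ht (inner_inj h _ e))]
  · rw [circArg_ne h i j hj, Function.update_of_ne hj, circArg_ne h i j hj,
      Function.update_of_ne (outer_ne_inner h i j hj s)]

theorem circArg_update_outer {m n l : ℕ} (h : l + 1 = m + n) (i : Fin m) (g : (Fin n → A) → A)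
    (x : Fin l → A) (j : Fin m) (hj : j ≠ i) (a : A) :
    circArg h i g (Function.update x (outer h i j hj) a) =
      Function.update (circArg h i g x) j a := by
  funext t
  by_cases ht : t = i
  · subst ht
    rw [circArg_self, Function.update_of_ne hj.symm, circArg_self]
    congr 1
    funext s
    rw [Function.update_of_ne (outer_ne_inner h t j hj s).symm]
  · rw [circArg_ne h i t ht]
    by_cases htj : t = j
    · subst htj; simp
    · rw [Function.update_of_ne htj, circArg_ne h i t ht,
        Function.update_of_ne (fun e => htj (outer_inj h i ht hj e))]

theorem outer_inner {m n r l l' N : ℕ} (h₁ : l + 1 = m + n) (h₂ : N + 1 = l + r)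
    (h₃ : l' + 1 = n + r) (h₄ : N + 1 = m + l') (i : Fin m) (j t : Fin n) (ht : t ≠ j) :
    outer h₂ (inner h₁ i j) (inner h₁ i t) (fun e => ht (inner_inj h₁ i e)) =
      inner h₄ i (outer h₃ j t ht) := by
  apply Fin.ext
  rcases lt_or_gt_of_ne ht with h | h
  · rw [outer_val_lt h₂ (by rw [Fin.lt_def] at *; simp only [inner]; omega)]
    simp only [inner]; rw [outer_val_lt h₃ h]
  · rw [outer_val_gt h₂ (by rw [Fin.lt_def] at *; simp only [inner]; omega)]
    simp only [inner]; rw [outer_val_gt h₃ h]; rw [Fin.lt_def] at h; omega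

theorem inner_inner {m n r l l' N : ℕ} (h₁ : l + 1 = m + n) (h₂ : N + 1 = l + r)
    (h₃ : l' + 1 = n + r) (h₄ : N + 1 = m + l') (i : Fin m) (j : Fin n) (s : Fin r) :
    inner h₂ (inner h₁ i j) s = inner h₄ i (inner h₃ j s) := by
  apply Fin.ext; simp only [inner]; omega

theorem outer_outer {m n r l l' N : ℕ} (h₁ : l + 1 = m + n) (h₂ : N + 1 = l + r)
    (h₃ : l' + 1 = n + r) (h₄ : N + 1 = m + l') (i t : Fin m) (j : Fin n) (ht : t ≠ i) :
    outer h₂ (inner h₁ i j) (outer h₁ i t ht) (outer_ne_inner h₁ i t ht j) = outer h₄ i t ht := by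
  apply Fin.ext
  rcases lt_or_gt_of_ne ht with h | h
  · rw [outer_val_lt h₄ h, outer_val_lt h₂ (by
      rw [Fin.lt_def, outer_val_lt h₁ h]; rw [Fin.lt_def] at h; simp only [inner]; omega),
      outer_val_lt h₁ h]
  · rw [outer_val_gt h₄ h, outer_val_gt h₂ (by
      rw [Fin.lt_def, outer_val_gt h₁ h]; rw [Fin.lt_def] at h; simp only [inner]; omega),
      outer_val_gt h₁ h]
    rw [Fin.lt_def] at h; omega

theorem outer_ne_outer {m n l : ℕ} (h : l + 1 = m + n) (i : Fin m) {j k : Fin m} (hj : j ≠ i)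
    (hk : k ≠ i) (hjk : j ≠ k) : outer h i j hj ≠ outer h i k hk :=
  fun e => hjk (outer_inj h i hj hk e)

theorem inner_outer_comm {m n r l l' N : ℕ} (h₁ : l + 1 = m + n) (h₂ : N + 1 = l + r)
    (h₃ : l' + 1 = m + r) (h₄ : N + 1 = l' + n) (i j : Fin m) (hij : i < j) (s : Fin r) :
    inner h₂ (outer h₁ i j hij.ne') s =
      outer h₄ (outer h₃ j i hij.ne) (inner h₃ j s) (outer_ne_inner h₃ j i hij.ne s).symm := by
  apply Fin.ext
  rw [outer_val_gt h₄ (by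
    rw [Fin.lt_def, outer_val_lt h₃ hij]; rw [Fin.lt_def] at hij; simp only [inner]; omega)]
  simp only [inner]
  rw [outer_val_gt h₁ hij]; rw [Fin.lt_def] at hij; omega

theorem outer_inner_comm {m n r l l' N : ℕ} (h₁ : l + 1 = m + n) (h₂ : N + 1 = l + r)
    (h₃ : l' + 1 = m + r) (h₄ : N + 1 = l' + n) (i j : Fin m) (hij : i < j) (s : Fin n) :
    outer h₂ (outer h₁ i j hij.ne') (inner h₁ i s) (outer_ne_inner h₁ i j hij.ne' s).symm =
      inner h₄ (outer h₃ j i hij.ne) s := by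
  apply Fin.ext
  rw [outer_val_lt h₂ (by
    rw [Fin.lt_def, outer_val_gt h₁ hij]; rw [Fin.lt_def] at hij; simp only [inner]; omega)]
  simp only [inner]
  rw [outer_val_lt h₃ hij]

theorem outer_outer_comm {m n r l l' N : ℕ} (h₁ : l + 1 = m + n) (h₂ : N + 1 = l + r)
    (h₃ : l' + 1 = m + r) (h₄ : N + 1 = l' + n) (i j : Fin m) (hij : i < j) (t : Fin m)
    (hti : t ≠ i) (htj : t ≠ j) :
    outer h₂ (outer h₁ i j hij.ne') (outer h₁ i t hti) (outer_ne_outer h₁ i hti hij.ne' htj) =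
      outer h₄ (outer h₃ j i hij.ne) (outer h₃ j t htj) (outer_ne_outer h₃ j htj hij.ne hti) := by
  apply Fin.ext
  have a := outer_val_gt h₁ hij hij.ne'
  have b := outer_val_lt h₃ hij hij.ne
  rcases lt_or_gt_of_ne hti with h | h
  · have c := outer_val_lt h₁ h hti
    have d := outer_val_lt h₃ (h.trans hij) htj
    rw [Fin.lt_def] at h hij
    rw [outer_val_lt h₂ (by rw [Fin.lt_def]; omega), outer_val_lt h₄ (by rw [Fin.lt_def]; omega)]
    omega
  · have c := outer_val_gt h₁ h hti
    rcases lt_or_gt_of_ne htj with h' | h'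
    · have d := outer_val_lt h₃ h' htj
      rw [Fin.lt_def] at h h' hij
      rw [outer_val_lt h₂ (by rw [Fin.lt_def]; omega),
        outer_val_gt h₄ (by rw [Fin.lt_def]; omega)]
      omega
    · have d := outer_val_gt h₃ h' htj
      rw [Fin.lt_def] at h h' hij
      rw [outer_val_gt h₂ (by rw [Fin.lt_def]; omega),
        outer_val_gt h₄ (by rw [Fin.lt_def]; omega)]
      omega

theorem circArg_circArg {m n r l l' N : ℕ} (h₁ : l + 1 = m + n) (h₂ : N + 1 = l + r)
    (h₃ : l' + 1 = n + r) (h₄ : N + 1 = m + l') (i : Fin m) (j : Fin n)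
    (g : (Fin n → A) → A) (f : (Fin r → A) → A) (x : Fin N → A) :
    circArg h₁ i g (circArg h₂ (inner h₁ i j) f x) =
      circArg h₄ i (fun y => g (circArg h₃ j f y)) x := by
  funext t
  by_cases ht : t = i
  · subst ht
    rw [circArg_self, circArg_self]
    congr 1
    funext s
    by_cases hs : s = j
    · subst hs
      rw [circArg_self, circArg_self]
      simp only [inner_inner h₁ h₂ h₃ h₄]
    · rw [circArg_ne _ _ _ hs, circArg_ne _ _ _ (fun e => hs (inner_inj h₁ t e)),
        outer_inner h₁ h₂ h₃ h₄ t j s hs]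
  · rw [circArg_ne h₁ i t ht, circArg_ne h₄ i t ht,
      circArg_ne _ _ _ (outer_ne_inner h₁ i t ht j), outer_outer h₁ h₂ h₃ h₄ i t j ht]

theorem circArg_comm {m n r l l' N : ℕ} (h₁ : l + 1 = m + n) (h₂ : N + 1 = l + r)
    (h₃ : l' + 1 = m + r) (h₄ : N + 1 = l' + n) (i j : Fin m) (hij : i < j)
    (g : (Fin n → A) → A) (f : (Fin r → A) → A) (x : Fin N → A) :
    circArg h₁ i g (circArg h₂ (outer h₁ i j hij.ne') f x) =
      circArg h₃ j f (circArg h₄ (outer h₃ j i hij.ne) g x) := by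
  funext t
  by_cases ht : t = i
  · subst ht
    rw [circArg_self, circArg_ne _ _ _ hij.ne, circArg_self]
    congr 1
    funext s
    rw [circArg_ne _ _ _ (outer_ne_inner h₁ t j hij.ne' s).symm,
      outer_inner_comm h₁ h₂ h₃ h₄ t j hij s]
  · by_cases ht' : t = j
    · subst ht'
      rw [circArg_self, circArg_ne _ _ _ hij.ne', circArg_self]
      congr 1
      funext s
      rw [circArg_ne _ _ _ (outer_ne_inner h₃ t i hij.ne s).symm,
        inner_outer_comm h₁ h₂ h₃ h₄ i t hij s]
    · rw [circArg_ne _ _ _ ht, circArg_ne _ _ _ ht',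
        circArg_ne _ _ _ (outer_ne_outer h₁ i ht hij.ne' ht'),
        circArg_ne _ _ _ (outer_ne_outer h₃ j ht' hij.ne ht),
        outer_outer_comm h₁ h₂ h₃ h₄ i j hij t ht ht']

theorem circArg_perm {m n l : ℕ} (h : l + 1 = m + n) (i : Fin m) (σ : Equiv.Perm (Fin m))
    (τ : Equiv.Perm (Fin n)) (ρ : Equiv.Perm (Fin l))
    (h₁ : ∀ s, ρ (inner h i s) = inner h (σ i) (τ s))
    (h₂ : ∀ j (hj : j ≠ i),
      ρ (outer h i j hj) = outer h (σ i) (σ j) (fun e => hj (σ.injective e)))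
    (g : (Fin n → A) → A) (x : Fin l → A) :
    (fun j => circArg h i (fun y => g (fun s => y (τ.symm s))) x (σ.symm j)) =
      circArg h (σ i) g (fun t => x (ρ.symm t)) := by
  funext j
  obtain ⟨j, rfl⟩ := σ.surjective j
  rw [Equiv.symm_apply_apply]
  by_cases hj : j = i
  · subst hj
    rw [circArg_self, circArg_self]
    congr 1
    funext s
    obtain ⟨s, rfl⟩ := τ.surjective s
    rw [← h₁, Equiv.symm_apply_apply, Equiv.symm_apply_apply]
  · rw [circArg_ne _ _ _ hj, circArg_ne _ _ _ (fun e => hj (σ.injective e)), ← h₂ j hj,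
      Equiv.symm_apply_apply]

variable {k : Type u} [Field k] [AddCommGroup A] [Module k A]

/-- The partial composite `F ∘ᵢ G` of multilinear maps: insert `G` into the `i`-th input of `F`. -/
def mcirc {m n l : ℕ} (h : l + 1 = m + n) (i : Fin m) :
    MultilinearMap k (fun _ : Fin m => A) A →ₗ[k]
      MultilinearMap k (fun _ : Fin n => A) A →ₗ[k] MultilinearMap k (fun _ : Fin l => A) A :=
  LinearMap.mk₂ k
    (fun F G =>
      { toFun := fun x => F (circArg h i G x)
        map_update_add' := by
          intro hd x t a b
          rw [Subsingleton.elim hd (instDecidableEqFin l)]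
          rcases inner_or_outer h i t with ⟨s, rfl⟩ | ⟨j, hj, rfl⟩
          · simp only [circArg_update_inner, MultilinearMap.map_update_add]
          · simp only [circArg_update_outer, MultilinearMap.map_update_add]
        map_update_smul' := by
          intro hd x t c a
          rw [Subsingleton.elim hd (instDecidableEqFin l)]
          rcases inner_or_outer h i t with ⟨s, rfl⟩ | ⟨j, hj, rfl⟩
          · simp only [circArg_update_inner, MultilinearMap.map_update_smul]
          · simp only [circArg_update_outer, MultilinearMap.map_update_smul] })
    (fun F F' G => by ext x; rfl)
    (fun c F G => by ext x; rfl)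
    (fun F G G' => by
      ext x
      have e : ∀ g : (Fin n → A) → A, circArg h i g x = Function.update (circArg h i G x) i
          (g (fun s => x (inner h i s))) := by
        intro g; funext j
        by_cases hj : j = i
        · subst hj; simp [circArg_self]
        · simp [circArg_ne h i j hj, hj]
      simp only [MultilinearMap.coe_mk, add_apply]
      rw [e (G + G' : MultilinearMap k (fun _ : Fin n => A) A), e G', add_apply,
        MultilinearMap.map_update_add]
      rw [← e G])
    (fun c F G => by
      ext x
      have e : ∀ g : (Fin n → A) → A, circArg h i g x = Function.update (circArg h i G x) i
          (g (fun s => x (inner h i s))) := by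
        intro g; funext j
        by_cases hj : j = i
        · subst hj; simp [circArg_self]
        · simp [circArg_ne h i j hj, hj]
      simp only [MultilinearMap.coe_mk, smul_apply]
      rw [e (c • G : MultilinearMap k (fun _ : Fin n => A) A), smul_apply,
        MultilinearMap.map_update_smul, ← e G])

theorem mcirc_apply {m n l : ℕ} (h : l + 1 = m + n) (i : Fin m)
    (F : MultilinearMap k (fun _ : Fin m => A) A) (G : MultilinearMap k (fun _ : Fin n => A) A)
    (x : Fin l → A) : mcirc h i F G x = F (circArg h i G x) := rfl

end EndOp

/-- The endomorphism operad of a vector space `A`, with `End_A(n)` the space of `n`-linear maps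
`A ⊗ ⋯ ⊗ A → A`; a permutation acts by `(F σ)(x₁, …, xₙ) = F(x_{σ⁻¹ 1}, …, x_{σ⁻¹ n})`. -/
def endOp (k : Type u) [Field k] (A : Type v) [AddCommGroup A] [Module k A] :
    Operad.{u, v} k where
  obj n := MultilinearMap k (fun _ : Fin n => A) A
  act σ := (MultilinearMap.domDomCongrLinearEquiv k k A A σ.symm).toLinearMap
  one := MultilinearMap.ofSubsingleton k A A (0 : Fin 1) LinearMap.id
  circ h i := mcirc h i
  act_one p := by ext x; rfl
  act_mul σ τ p := by ext x; rfl
  one_circ h q := by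
    ext x
    rw [mcirc_apply]
    change circArg h 0 q x 0 = _
    rw [circArg_self]
    congr 1
    funext s
    congr 1
    apply Fin.ext; simp [inner]
  circ_one h i p := by
    ext x
    rw [mcirc_apply]
    congr 1
    funext j
    by_cases hj : j = i
    · subst hj
      rw [circArg_self]
      change x _ = x _
      congr 1
    · rw [circArg_ne _ _ _ hj]
      congr 1
      apply Fin.ext
      rcases lt_or_gt_of_ne hj with e | e
      · rw [outer_val_lt h e]
      · rw [outer_val_gt h e]; omega
  circ_circ h₁ h₂ h₃ h₄ i j p q s := by
    ext x
    simp only [mcirc_apply]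
    rw [circArg_circArg h₁ h₂ h₃ h₄]
    rfl
  circ_comm h₁ h₂ h₃ h₄ i j hij p q s := by
    ext x
    simp only [mcirc_apply]
    rw [circArg_comm h₁ h₂ h₃ h₄ i j hij]
  circ_act h i σ τ ρ h₁ h₂ p q := by
    ext x
    change p (fun j => circArg h i (fun y => q (fun s => y (τ.symm s))) x (σ.symm j)) =
      p (circArg h (σ i) q (fun t => x (ρ.symm t)))
    rw [circArg_perm h i σ τ ρ h₁ h₂]

section Quotient

variable {k : Type u} [Field k]

/-- An ideal of an operad: a family of subspaces stable under the symmetric groups and under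
composition, on either side, with arbitrary elements. -/
structure Operad.Ideal (P : Operad.{u, v} k) where
  carrier : ∀ n, Submodule k (P.obj n)
  act_mem : ∀ {n : ℕ} (σ : Equiv.Perm (Fin n)) {p : P.obj n}, p ∈ carrier n → P.act σ p ∈ carrier n
  circ_mem_left : ∀ {m n l : ℕ} (h : l + 1 = m + n) (i : Fin m) {p : P.obj m} (q : P.obj n),
    p ∈ carrier m → P.circ h i p q ∈ carrier l
  circ_mem_right : ∀ {m n l : ℕ} (h : l + 1 = m + n) (i : Fin m) (p : P.obj m) {q : P.obj n},
    q ∈ carrier n → P.circ h i p q ∈ carrier l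

/-- The ideal generated by a family of sets. -/
def Operad.idealSpan (P : Operad.{u, v} k) (S : ∀ n, Set (P.obj n)) : P.Ideal where
  carrier n := ⨅ I : {I : P.Ideal // ∀ n, S n ⊆ I.carrier n}, I.1.carrier n
  act_mem σ p hp := by
    simp only [Submodule.mem_iInf] at hp ⊢
    exact fun I => I.1.act_mem σ (hp I)
  circ_mem_left h i p q hp := by
    simp only [Submodule.mem_iInf] at hp ⊢
    exact fun I => I.1.circ_mem_left h i q (hp I)
  circ_mem_right h i p q hq := by
    simp only [Submodule.mem_iInf] at hq ⊢
    exact fun I => I.1.circ_mem_right h i p (hq I)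

/-- A bilinear map descends to quotients. -/
def mapQ₂ {M N L : Type v} [AddCommGroup M] [AddCommGroup N] [AddCommGroup L] [Module k M]
    [Module k N] [Module k L] (I : Submodule k M) (J : Submodule k N) (K : Submodule k L)
    (f : M →ₗ[k] N →ₗ[k] L) (h₁ : ∀ x ∈ I, ∀ y, f x y ∈ K) (h₂ : ∀ x, ∀ y ∈ J, f x y ∈ K) :
    (M ⧸ I) →ₗ[k] (N ⧸ J) →ₗ[k] (L ⧸ K) :=
  I.liftQ
    { toFun := fun x => J.mapQ K (f x) (fun y hy => h₂ x y hy)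
      map_add' := fun x x' => by
        apply Submodule.linearMap_qext; ext y; simp
      map_smul' := fun c x => by
        apply Submodule.linearMap_qext; ext y; simp }
    (fun x hx => by
      rw [LinearMap.mem_ker]
      apply Submodule.linearMap_qext; ext y
      simpa using h₁ x hx y)

@[simp]
theorem mapQ₂_mk {M N L : Type v} [AddCommGroup M] [AddCommGroup N] [AddCommGroup L] [Module k M]
    [Module k N] [Module k L] (I : Submodule k M) (J : Submodule k N) (K : Submodule k L)
    (f : M →ₗ[k] N →ₗ[k] L) (h₁ : ∀ x ∈ I, ∀ y, f x y ∈ K) (h₂ : ∀ x, ∀ y ∈ J, f x y ∈ K)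
    (x : M) (y : N) :
    mapQ₂ I J K f h₁ h₂ (Submodule.Quotient.mk x) (Submodule.Quotient.mk y) =
      Submodule.Quotient.mk (f x y) := rfl

/-- The quotient of an operad by an ideal. -/
def Operad.quotient (P : Operad.{u, v} k) (I : P.Ideal) : Operad.{u, v} k where
  obj n := P.obj n ⧸ I.carrier n
  act σ := (I.carrier _).mapQ (I.carrier _) (P.act σ) (fun _ hp => I.act_mem σ hp)
  one := Submodule.Quotient.mk P.one
  circ h i := mapQ₂ _ _ _ (P.circ h i) (fun _ hp q => I.circ_mem_left h i q hp)
    (fun p _ hq => I.circ_mem_right h i p hq)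
  act_one p := by
    obtain ⟨p, rfl⟩ := Submodule.Quotient.mk_surjective _ p
    simp [P.act_one]
  act_mul σ τ p := by
    obtain ⟨p, rfl⟩ := Submodule.Quotient.mk_surjective _ p
    simp [P.act_mul]
  one_circ h q := by
    obtain ⟨q, rfl⟩ := Submodule.Quotient.mk_surjective _ q
    simp [P.one_circ]
  circ_one h i p := by
    obtain ⟨p, rfl⟩ := Submodule.Quotient.mk_surjective _ p
    simp [P.circ_one]
  circ_circ h₁ h₂ h₃ h₄ i j p q s := by
    obtain ⟨p, rfl⟩ := Submodule.Quotient.mk_surjective _ p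
    obtain ⟨q, rfl⟩ := Submodule.Quotient.mk_surjective _ q
    obtain ⟨s, rfl⟩ := Submodule.Quotient.mk_surjective _ s
    simp [P.circ_circ h₁ h₂ h₃ h₄]
  circ_comm h₁ h₂ h₃ h₄ i j hij p q s := by
    obtain ⟨p, rfl⟩ := Submodule.Quotient.mk_surjective _ p
    obtain ⟨q, rfl⟩ := Submodule.Quotient.mk_surjective _ q
    obtain ⟨s, rfl⟩ := Submodule.Quotient.mk_surjective _ s
    simp [P.circ_comm h₁ h₂ h₃ h₄ i j hij]
  circ_act h i σ τ ρ h₁ h₂ p q := by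
    obtain ⟨p, rfl⟩ := Submodule.Quotient.mk_surjective _ p
    obtain ⟨q, rfl⟩ := Submodule.Quotient.mk_surjective _ q
    simp [P.circ_act h i σ τ ρ h₁ h₂]

end Quotient

section Free

/-- Formal operadic monomials in symbols of arity two labelled by `E`. -/
inductive Mon (E : Type v) : ℕ → Type v
  | gen : E → Mon E 2
  | one : Mon E 1
  | act {n : ℕ} : Equiv.Perm (Fin n) → Mon E n → Mon E n
  | circ {m n l : ℕ} : l + 1 = m + n → Fin m → Mon E m → Mon E n → Mon E l

/-- The operad axioms, as identifications between formal monomials. -/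
inductive MonRel {E : Type v} : ∀ {n : ℕ}, Mon E n → Mon E n → Prop
  | act_one {n : ℕ} (x : Mon E n) : MonRel (.act 1 x) x
  | act_mul {n : ℕ} (σ τ : Equiv.Perm (Fin n)) (x : Mon E n) :
      MonRel (.act (σ * τ) x) (.act τ (.act σ x))
  | one_circ {n : ℕ} (h : n + 1 = 1 + n) (y : Mon E n) : MonRel (.circ h 0 .one y) y
  | circ_one {m : ℕ} (h : m + 1 = m + 1) (i : Fin m) (x : Mon E m) : MonRel (.circ h i x .one) x
  | circ_circ {m n r l l' N : ℕ} (h₁ : l + 1 = m + n) (h₂ : N + 1 = l + r) (h₃ : l' + 1 = n + r)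
      (h₄ : N + 1 = m + l') (i : Fin m) (j : Fin n) (x : Mon E m) (y : Mon E n) (z : Mon E r) :
      MonRel (.circ h₂ (inner h₁ i j) (.circ h₁ i x y) z) (.circ h₄ i x (.circ h₃ j y z))
  | circ_comm {m n r l l' N : ℕ} (h₁ : l + 1 = m + n) (h₂ : N + 1 = l + r) (h₃ : l' + 1 = m + r)
      (h₄ : N + 1 = l' + n) (i j : Fin m) (hij : i < j) (x : Mon E m) (y : Mon E n) (z : Mon E r) :
      MonRel (.circ h₂ (outer h₁ i j hij.ne') (.circ h₁ i x y) z)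
        (.circ h₄ (outer h₃ j i hij.ne) (.circ h₃ j x z) y)
  | circ_act {m n l : ℕ} (h : l + 1 = m + n) (i : Fin m) (σ : Equiv.Perm (Fin m))
      (τ : Equiv.Perm (Fin n)) (ρ : Equiv.Perm (Fin l))
      (h₁ : ∀ s, ρ (inner h i s) = inner h (σ i) (τ s))
      (h₂ : ∀ j (hj : j ≠ i),
        ρ (outer h i j hj) = outer h (σ i) (σ j) (fun e => hj (σ.injective e)))
      (x : Mon E m) (y : Mon E n) :
      MonRel (.circ h i (.act σ x) (.act τ y)) (.act ρ (.circ h (σ i) x y))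

variable (k : Type u) [Field k] {E : Type v}

/-- Formal linear combinations of monomials. -/
abbrev PreFree (E : Type v) (n : ℕ) : Type (max u v) := Mon E n →₀ k

/-- Linear extension of the action of permutations. -/
def preAct {n : ℕ} (σ : Equiv.Perm (Fin n)) : PreFree k E n →ₗ[k] PreFree k E n :=
  Finsupp.lmapDomain k k (Mon.act σ)

/-- Bilinear extension of partial composition. -/
def preCirc {m n l : ℕ} (h : l + 1 = m + n) (i : Fin m) :
    PreFree k E m →ₗ[k] PreFree k E n →ₗ[k] PreFree k E l :=
  Finsupp.lift _ k _ (fun x => Finsupp.lmapDomain k k (Mon.circ h i x))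

theorem preCirc_single {m n l : ℕ} (h : l + 1 = m + n) (i : Fin m) (x : Mon E m) (y : Mon E n)
    (a b : k) : preCirc k h i (Finsupp.single x a) (Finsupp.single y b) =
      Finsupp.single (Mon.circ h i x y) (a * b) := by
  simp [preCirc, Finsupp.lift_apply, Finsupp.mapDomain_single]

theorem preAct_single {n : ℕ} (σ : Equiv.Perm (Fin n)) (x : Mon E n) (a : k) :
    preAct k σ (Finsupp.single x a) = Finsupp.single (Mon.act σ x) a := by
  simp [preAct, Finsupp.mapDomain_single]

variable [AddCommGroup E] [Module k E]

/-- The relations of the free operad on the `Σ₂`-module `(E, s)`: the operad axioms, linearity of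
`E → Γ(E)(2)` and its compatibility with the transposition. -/
inductive FreeRel (s : E →ₗ[k] E) : ∀ n, PreFree k E n → Prop
  | mon {n : ℕ} {x y : Mon E n} (h : MonRel x y) :
      FreeRel s n (Finsupp.single x 1 - Finsupp.single y 1)
  | add (e f : E) : FreeRel s 2 (Finsupp.single (.gen (e + f)) 1 -
      (Finsupp.single (.gen e) 1 + Finsupp.single (.gen f) 1))
  | smul (c : k) (e : E) : FreeRel s 2 (Finsupp.single (.gen (c • e)) 1 -
      c • Finsupp.single (.gen e) 1)
  | swap (e : E) : FreeRel s 2 (Finsupp.single (.gen (s e)) 1 -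
      Finsupp.single (.act (Equiv.swap 0 1) (.gen e)) 1)

/-- Families of subspaces containing the relations and stable under action and composition. -/
structure FreeIdeal (s : E →ₗ[k] E) where
  carrier : ∀ n, Submodule k (PreFree k E n)
  rel_mem : ∀ {n : ℕ} {x : PreFree k E n}, FreeRel k s n x → x ∈ carrier n
  act_mem : ∀ {n : ℕ} (σ : Equiv.Perm (Fin n)) {p : PreFree k E n},
    p ∈ carrier n → preAct k σ p ∈ carrier n
  circ_mem_left : ∀ {m n l : ℕ} (h : l + 1 = m + n) (i : Fin m) {p : PreFree k E m}
    (q : PreFree k E n), p ∈ carrier m → preCirc k h i p q ∈ carrier l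
  circ_mem_right : ∀ {m n l : ℕ} (h : l + 1 = m + n) (i : Fin m) (p : PreFree k E m)
    {q : PreFree k E n}, q ∈ carrier n → preCirc k h i p q ∈ carrier l

/-- The smallest such family. -/
def freeIdeal (s : E →ₗ[k] E) : FreeIdeal k s where
  carrier n := ⨅ I : FreeIdeal k s, I.carrier n
  rel_mem hx := by
    simp only [Submodule.mem_iInf]
    exact fun I => I.rel_mem hx
  act_mem σ p hp := by
    simp only [Submodule.mem_iInf] at hp ⊢
    exact fun I => I.act_mem σ (hp I)
  circ_mem_left h i p q hp := by
    simp only [Submodule.mem_iInf] at hp ⊢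
    exact fun I => I.circ_mem_left h i q (hp I)
  circ_mem_right h i p q hq := by
    simp only [Submodule.mem_iInf] at hq ⊢
    exact fun I => I.circ_mem_right h i p (hq I)

theorem freeIdeal_mk_eq {s : E →ₗ[k] E} {n : ℕ} {x y : Mon E n} (h : MonRel x y) (a : k) :
    (Submodule.Quotient.mk (Finsupp.single x a) : PreFree k E n ⧸ (freeIdeal k s).carrier n) =
      Submodule.Quotient.mk (Finsupp.single y a) := by
  rw [Submodule.Quotient.eq]
  have := ((freeIdeal k s).carrier n).smul_mem a ((freeIdeal k s).rel_mem (.mon h))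
  simpa [smul_sub] using this

/-- The free operad `Γ(E)` on a `Σ₂`-module `(E, s)` placed in arity two; `s` is the action of the
transposition. -/
def freeOperad (s : E →ₗ[k] E) : Operad.{u, max u v} k where
  obj n := PreFree k E n ⧸ (freeIdeal k s).carrier n
  act σ := Submodule.mapQ ((freeIdeal k s).carrier _) ((freeIdeal k s).carrier _) (preAct k σ)
    (fun _ hp => (freeIdeal k s).act_mem σ hp)
  one := Submodule.Quotient.mk (Finsupp.single .one 1)
  circ h i := mapQ₂ _ _ _ (preCirc k h i) (fun _ hp q => (freeIdeal k s).circ_mem_left h i q hp)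
    (fun p _ hq => (freeIdeal k s).circ_mem_right h i p hq)
  act_one p := by
    obtain ⟨p, rfl⟩ := Submodule.Quotient.mk_surjective _ p
    induction p using Finsupp.induction_linear with
    | zero => simp
    | add p p' hp hp' => simp only [Submodule.Quotient.mk_add, map_add, hp, hp']
    | single x a =>
      rw [Submodule.mapQ_apply, preAct_single]
      exact freeIdeal_mk_eq k (.act_one x) a
  act_mul σ τ p := by
    obtain ⟨p, rfl⟩ := Submodule.Quotient.mk_surjective _ p
    induction p using Finsupp.induction_linear with
    | zero => simp
    | add p p' hp hp' => simp only [Submodule.Quotient.mk_add, map_add, hp, hp']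
    | single x a =>
      simp only [Submodule.mapQ_apply, preAct_single]
      exact freeIdeal_mk_eq k (.act_mul σ τ x) a
  one_circ h q := by
    obtain ⟨q, rfl⟩ := Submodule.Quotient.mk_surjective _ q
    induction q using Finsupp.induction_linear with
    | zero => simp
    | add p p' hp hp' => simp only [Submodule.Quotient.mk_add, map_add, hp, hp']
    | single x a =>
      rw [mapQ₂_mk, preCirc_single, one_mul]
      exact freeIdeal_mk_eq k (.one_circ h x) a
  circ_one h i p := by
    obtain ⟨p, rfl⟩ := Submodule.Quotient.mk_surjective _ p
    induction p using Finsupp.induction_linear with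
    | zero => simp
    | add p p' hp hp' =>
      simp only [Submodule.Quotient.mk_add, map_add, LinearMap.add_apply, hp, hp']
    | single x a =>
      rw [mapQ₂_mk, preCirc_single, mul_one]
      exact freeIdeal_mk_eq k (.circ_one h i x) a
  circ_circ h₁ h₂ h₃ h₄ i j p q r := by
    obtain ⟨p, rfl⟩ := Submodule.Quotient.mk_surjective _ p
    obtain ⟨q, rfl⟩ := Submodule.Quotient.mk_surjective _ q
    obtain ⟨r, rfl⟩ := Submodule.Quotient.mk_surjective _ r
    induction p using Finsupp.induction_linear with
    | zero => simp
    | add p p' hp hp' =>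
      simp only [Submodule.Quotient.mk_add, map_add, LinearMap.add_apply, hp, hp']
    | single x a =>
    induction q using Finsupp.induction_linear with
    | zero => simp
    | add p p' hp hp' =>
      simp only [Submodule.Quotient.mk_add, map_add, LinearMap.add_apply, hp, hp']
    | single y b =>
    induction r using Finsupp.induction_linear with
    | zero => simp
    | add p p' hp hp' => simp only [Submodule.Quotient.mk_add, map_add, hp, hp']
    | single z c =>
      simp only [mapQ₂_mk, preCirc_single, mul_assoc]
      exact freeIdeal_mk_eq k (.circ_circ h₁ h₂ h₃ h₄ i j x y z) _
  circ_comm h₁ h₂ h₃ h₄ i j hij p q r := by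
    obtain ⟨p, rfl⟩ := Submodule.Quotient.mk_surjective _ p
    obtain ⟨q, rfl⟩ := Submodule.Quotient.mk_surjective _ q
    obtain ⟨r, rfl⟩ := Submodule.Quotient.mk_surjective _ r
    induction p using Finsupp.induction_linear with
    | zero => simp
    | add p p' hp hp' =>
      simp only [Submodule.Quotient.mk_add, map_add, LinearMap.add_apply, hp, hp']
    | single x a =>
    induction q using Finsupp.induction_linear with
    | zero => simp
    | add p p' hp hp' =>
      simp only [Submodule.Quotient.mk_add, map_add, LinearMap.add_apply, hp, hp']
    | single y b =>
    induction r using Finsupp.induction_linear with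
    | zero => simp
    | add p p' hp hp' =>
      simp only [Submodule.Quotient.mk_add, map_add, LinearMap.add_apply, hp, hp']
    | single z c =>
      simp only [mapQ₂_mk, preCirc_single, mul_right_comm a c b]
      exact freeIdeal_mk_eq k (.circ_comm h₁ h₂ h₃ h₄ i j hij x y z) _
  circ_act h i σ τ ρ h₁ h₂ p q := by
    obtain ⟨p, rfl⟩ := Submodule.Quotient.mk_surjective _ p
    obtain ⟨q, rfl⟩ := Submodule.Quotient.mk_surjective _ q
    induction p using Finsupp.induction_linear with
    | zero => simp
    | add p p' hp hp' =>
      simp only [Submodule.Quotient.mk_add, map_add, LinearMap.add_apply, hp, hp']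
    | single x a =>
    induction q using Finsupp.induction_linear with
    | zero => simp
    | add p p' hp hp' =>
      simp only [Submodule.Quotient.mk_add, map_add, hp, hp']
    | single y b =>
      simp only [Submodule.mapQ_apply, preAct_single, mapQ₂_mk, preCirc_single]
      exact freeIdeal_mk_eq k (.circ_act h i σ τ ρ h₁ h₂ x y) _

/-- The inclusion of generators `E → Γ(E)(2)`. -/
def freeGen (s : E →ₗ[k] E) : E →ₗ[k] (freeOperad k s).obj 2 where
  toFun e := Submodule.Quotient.mk (Finsupp.single (.gen e) 1)
  map_add' e f := (Submodule.Quotient.eq ((freeIdeal k s).carrier 2)).2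
    ((freeIdeal k s).rel_mem (.add e f))
  map_smul' c e := (Submodule.Quotient.eq ((freeIdeal k s).carrier 2)).2
    ((freeIdeal k s).rel_mem (.smul c e))

/-- `μ ⊗ ν ↦ μ ∘₁ ν`, from `E ⊗ E` to `Γ(E)(3)`. -/
def freeComp (s : E →ₗ[k] E) : E ⊗[k] E →ₗ[k] (freeOperad k s).obj 3 :=
  TensorProduct.lift
    (((freeOperad k s).circ (show 3 + 1 = 2 + 2 by norm_num) 0).compl₁₂ (freeGen k s)
      (freeGen k s))

/-- The canonical identification of `(E ⊗ E)³` with `Γ(E)(3)`.  The element `μ ⊗ ν` of the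
`j`-th summand corresponds to the operation `(x₀, x₁, x₂) ↦ μ(ν(x_{j+1}, x_{j+2}), x_j)`, with
indices modulo 3. -/
def freeThree (s : E →ₗ[k] E) : (Fin 3 → E ⊗[k] E) →ₗ[k] (freeOperad k s).obj 3 where
  toFun r := ∑ j : Fin 3, (freeOperad k s).act (Equiv.addRight (j + 1)).symm (freeComp k s (r j))
  map_add' r r' := by simp [Finset.sum_add_distrib]
  map_smul' c r := by simp [Finset.smul_sum]

/-- The action of relabelling the variables of `Γ(E)(3) = (E ⊗ E)³` by `π`: the variable `x_j`
becomes `x_{π j}`, so that the `j`-th summand goes to the `π j`-th one, with the two arguments of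
the inner operation interchanged if `π` does not preserve the cyclic order. -/
def relabel (s : E →ₗ[k] E) (π : Equiv.Perm (Fin 3)) :
    (Fin 3 → E ⊗[k] E) →ₗ[k] (Fin 3 → E ⊗[k] E) where
  toFun r := fun j => (if Equiv.Perm.sign π = 1 then LinearMap.id
    else TensorProduct.map LinearMap.id s) (r (π.symm j))
  map_add' r r' := by funext j; simp
  map_smul' c r := by funext j; simp

end Free

section Quadratic

/-- Quadratic data: a finite-dimensional `Σ₂`-module `E` of binary generators (`s` is the action of
the transposition) and a `Σ₃`-submodule `R` of `Γ(E)(3) = (E ⊗ E)³`. -/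
structure QuadraticData (k : Type u) [Field k] where
  E : Type u
  [addCommGroup : AddCommGroup E]
  [module : Module k E]
  [finite : FiniteDimensional k E]
  s : E →ₗ[k] E
  s_s : ∀ e, s (s e) = e
  R : Submodule k (Fin 3 → E ⊗[k] E)
  relabel_mem : ∀ (π : Equiv.Perm (Fin 3)), ∀ r ∈ R, relabel k s π r ∈ R

attribute [instance] QuadraticData.addCommGroup QuadraticData.module QuadraticData.finite

variable {k : Type u} [Field k]

/-- The quadratic operad `P = Γ(E)/(R)`. -/
def QuadraticData.operad (D : QuadraticData.{u} k) : Operad.{u, u} k :=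
  (freeOperad k D.s).quotient ((freeOperad k D.s).idealSpan
    (fun n => {x | ∃ h : 3 = n, ∃ r ∈ D.R, x = h ▸ freeThree k D.s r}))

/-- The pairing between `Γ(E^∨)(3)` and `Γ(E)(3)`, where `E^∨` is the linear dual of `E` twisted by
the sign representation. -/
def pairing (E : Type u) [AddCommGroup E] [Module k E] :
    (Fin 3 → Module.Dual k E ⊗[k] Module.Dual k E) →ₗ[k] Module.Dual k (Fin 3 → E ⊗[k] E) :=
  ∑ j : Fin 3, (LinearMap.lcomp k k (LinearMap.proj j)) ∘ₗ
    (TensorProduct.dualDistrib k E E) ∘ₗ (LinearMap.proj j)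

theorem pairing_apply (E : Type u) [AddCommGroup E] [Module k E]
    (r' : Fin 3 → Module.Dual k E ⊗[k] Module.Dual k E) (r : Fin 3 → E ⊗[k] E) :
    pairing E r' r = ∑ j, TensorProduct.dualDistrib k E E (r' j) (r j) := by
  simp [pairing]

theorem dualDistrib_map_id (E : Type u) [AddCommGroup E] [Module k E] (s : E →ₗ[k] E)
    (x : Module.Dual k E ⊗[k] Module.Dual k E) (y : E ⊗[k] E) :
    TensorProduct.dualDistrib k E E (TensorProduct.map LinearMap.id (-s.dualMap) x) y =
      - TensorProduct.dualDistrib k E E x (TensorProduct.map LinearMap.id s y) := by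
  induction x using TensorProduct.induction_on with
  | zero => simp
  | add x x' hx hx' => simp only [map_add, LinearMap.add_apply, hx, hx', neg_add]
  | tmul f g =>
    induction y using TensorProduct.induction_on with
    | zero => simp
    | add x x' hx hx' => simp only [map_add, hx, hx', neg_add]
    | tmul a b => simp [LinearMap.dualMap_apply]

/-- The quadratic dual: generators `E^∨ = E^# ⊗ sgn`, relations the annihilator of `R`. -/
def QuadraticData.dual (D : QuadraticData.{u} k) : QuadraticData.{u} k where
  E := Module.Dual k D.E
  s := -D.s.dualMap
  s_s f := by ext e; simp [LinearMap.dualMap_apply, D.s_s]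
  R :=
    { carrier := {r' | ∀ r ∈ D.R, pairing D.E r' r = 0}
      add_mem' := fun h h' r hr => by simp [h r hr, h' r hr]
      zero_mem' := fun r _ => by simp
      smul_mem' := fun c r' h r hr => by simp [h r hr] }
  relabel_mem π r' hr' r hr := by
    have h := hr' _ (D.relabel_mem π⁻¹ r hr)
    rw [pairing_apply] at h ⊢
    rw [← Equiv.sum_comp π]
    simp only [relabel, LinearMap.coe_mk, AddHom.coe_mk, Equiv.symm_apply_apply,
      Equiv.Perm.sign_inv] at h ⊢
    by_cases hπ : Equiv.Perm.sign π = 1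
    · simp only [hπ, if_true, LinearMap.id_apply] at h ⊢
      exact h
    · simp only [hπ, if_false] at h ⊢
      simp only [dualDistrib_map_id, Finset.sum_neg_distrib, neg_eq_zero]
      exact h

end Quadratic

section Signs

/-- The sign `(-1)^x`. -/
def sgn (k : Type u) [Field k] (x : ZMod 2) : k := if x = 0 then 1 else -1

theorem sgn_zero (k : Type u) [Field k] : sgn k 0 = 1 := by simp [sgn]

theorem sgn_one (k : Type u) [Field k] : sgn k 1 = -1 := by simp [sgn]

theorem sgn_add (k : Type u) [Field k] (x y : ZMod 2) : sgn k (x + y) = sgn k x * sgn k y := by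
  have h : ∀ z : ZMod 2, z = 0 ∨ z = 1 := by decide
  have h2 : (1 : ZMod 2) + 1 = 0 := by decide
  rcases h x with rfl | rfl <;> rcases h y with rfl | rfl <;> simp [sgn_zero, sgn_one, h2]

theorem sgn_sum (k : Type u) [Field k] {ι : Type*} (s : Finset ι) (f : ι → ZMod 2) :
    sgn k (∑ i ∈ s, f i) = ∏ i ∈ s, sgn k (f i) := by
  classical
  induction s using Finset.induction_on with
  | empty => simp [sgn_zero]
  | insert a s ha ih => rw [Finset.sum_insert ha, Finset.prod_insert ha, sgn_add, ih]

/-- The exponent of the Koszul sign of the permutation `σ` of elements of degrees `p` (modulo 2). -/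
def koszul {n : ℕ} (σ : Equiv.Perm (Fin n)) (p : Fin n → ZMod 2) : ZMod 2 :=
  ∑ i, ∑ j, if i < j ∧ σ j < σ i then p i * p j else 0

theorem koszul_one {n : ℕ} (p : Fin n → ZMod 2) : koszul 1 p = 0 := by
  unfold koszul
  refine Finset.sum_eq_zero fun i _ => Finset.sum_eq_zero fun j _ => if_neg ?_
  rintro ⟨h, h'⟩
  exact lt_asymm h h'

theorem sum_split {n : ℕ} (f : Fin n → Fin n → ZMod 2) (hf : ∀ i, f i i = 0) :
    ∑ i, ∑ j, f i j = ∑ i, ∑ j, if i < j then f i j + f j i else 0 := by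
  have h1 : ∀ i j : Fin n, f i j = (if i < j then f i j else 0) + (if j < i then f i j else 0) := by
    intro i j
    rcases lt_trichotomy i j with h | h | h
    · simp [h, h.le]
    · subst h; simp [hf]
    · simp [h, not_lt.2 h.le]
  have h2 : ∑ i, ∑ j, (if j < i then f i j else 0) = ∑ i, ∑ j, (if i < j then f j i else 0) :=
    Finset.sum_comm
  calc ∑ i, ∑ j, f i j = ∑ i, ∑ j, ((if i < j then f i j else 0) + (if j < i then f i j else 0)) :=
        Finset.sum_congr rfl fun i _ => Finset.sum_congr rfl fun j _ => h1 i j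
    _ = ∑ i, ∑ j, (if i < j then f i j else 0) + ∑ i, ∑ j, (if i < j then f j i else 0) := by
        simp only [Finset.sum_add_distrib]; rw [h2]
    _ = _ := by
        simp only [← Finset.sum_add_distrib]
        refine Finset.sum_congr rfl fun i _ => Finset.sum_congr rfl fun j _ => ?_
        split_ifs <;> simp

theorem koszul_mul {n : ℕ} (σ τ : Equiv.Perm (Fin n)) (p : Fin n → ZMod 2) :
    koszul (σ * τ) p = koszul τ p + koszul σ (fun i => p (τ.symm i)) := by
  have h : koszul σ (fun i => p (τ.symm i)) =
      ∑ i, ∑ j, if τ i < τ j ∧ σ (τ j) < σ (τ i) then p i * p j else 0 := by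
    unfold koszul
    rw [← Equiv.sum_comp τ]
    refine Finset.sum_congr rfl fun i _ => ?_
    rw [← Equiv.sum_comp τ]
    simp
  rw [h, sum_split _ (by intro i; simp)]
  unfold koszul
  simp only [← Finset.sum_add_distrib]
  refine Finset.sum_congr rfl fun i _ => Finset.sum_congr rfl fun j _ => ?_
  by_cases hij : i < j
  · have h1 : τ i ≠ τ j := fun e => hij.ne (τ.injective e)
    have h2 : σ (τ i) ≠ σ (τ j) := fun e => h1 (σ.injective e)
    have h3 : p i * p j + p j * p i = 0 := by rw [mul_comm (p j)]; exact CharTwo.add_self_eq_zero _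
    rcases lt_or_gt_of_ne h1 with a | a <;> rcases lt_or_gt_of_ne h2 with b | b <;>
      simp [hij, a, b, not_lt.2 a.le, not_lt.2 b.le, h3]
  · simp [hij]

theorem sgn_koszul_one (k : Type u) [Field k] {n : ℕ} (σ : Equiv.Perm (Fin n)) :
    sgn k (koszul σ 1) = ((Equiv.Perm.sign σ : ℤˣ) : ℤ) := by
  rw [Equiv.Perm.sign_eq_prod_prod_Ioi]
  unfold koszul
  simp only [sgn_sum]
  push_cast
  refine Finset.prod_congr rfl fun i _ => ?_
  rw [← Finset.prod_subset (Finset.subset_univ (Finset.Ioi i))]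
  · refine Finset.prod_congr rfl fun j hj => ?_
    have hij := Finset.mem_Ioi.1 hj
    have h1 : σ i ≠ σ j := fun e => hij.ne (σ.injective e)
    rcases lt_or_gt_of_ne h1 with a | a <;> simp [hij, a, not_lt.2 a.le, sgn_zero, sgn_one]
  · intro j _ hj
    have : ¬ i < j := fun h => hj (Finset.mem_Ioi.2 h)
    simp [this, sgn_zero]

theorem sum_circ {M : Type*} [AddCommMonoid M] {m n l : ℕ} (h : l + 1 = m + n) (i : Fin m)
    (f : Fin l → M) :
    ∑ t, f t = ∑ s, f (inner h i s) + ∑ j : {j // j ≠ i}, f (outer h i j.1 j.2) := by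
  let φ : Fin n ⊕ {j // j ≠ i} → Fin l := Sum.elim (inner h i) (fun j => outer h i j.1 j.2)
  have hφ : Function.Bijective φ := by
    constructor
    · rintro (s | j) (s' | j') e
      · exact congrArg _ (inner_inj h i e)
      · exact absurd e.symm (outer_ne_inner h i j'.1 j'.2 s)
      · exact absurd e (outer_ne_inner h i j.1 j.2 s')
      · exact congrArg _ (Subtype.ext (outer_inj h i j.2 j'.2 e))
    · intro t
      rcases inner_or_outer h i t with ⟨s, rfl⟩ | ⟨j, hj, rfl⟩
      · exact ⟨Sum.inl s, rfl⟩
      · exact ⟨Sum.inr ⟨j, hj⟩, rfl⟩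
  rw [← (Equiv.ofBijective φ hφ).sum_comp, Fintype.sum_sum_type]
  rfl

theorem sum_ne {M : Type*} [AddCommMonoid M] {m : ℕ} (i : Fin m) (f : Fin m → M) :
    ∑ t, f t = f i + ∑ j : {j // j ≠ i}, f j.1 :=
  Fintype.sum_eq_add_sum_subtype_ne f i

/-- The sum of the first `a` degrees. -/
def pre {l : ℕ} (a : ℕ) (p : Fin l → ZMod 2) : ZMod 2 :=
  ∑ t : Fin l, if (t : ℕ) < a then p t else 0

theorem outer_lt_iff {m n l : ℕ} (h : l + 1 = m + n) (i j : Fin m) (hj : j ≠ i) :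
    (outer h i j hj : ℕ) < i ↔ j < i := by
  rcases lt_or_gt_of_ne hj with e | e
  · rw [outer_val_lt h e]; simp [e]
  · rw [outer_val_gt h e]; rw [Fin.lt_def] at *; omega

theorem outer_lt_outer {m n l : ℕ} (h : l + 1 = m + n) (i j t : Fin m) (hj : j ≠ i) (ht : t ≠ i) :
    outer h i j hj < outer h i t ht ↔ j < t := by
  simp only [Fin.lt_def]
  rcases lt_or_gt_of_ne hj with e | e <;> rcases lt_or_gt_of_ne ht with e' | e' <;>
  simp only [outer_val_lt h, outer_val_gt h, e, e'] <;> simp only [Fin.lt_def] at e e' <;> omega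

theorem outer_lt_inner {m n l : ℕ} (h : l + 1 = m + n) (i j : Fin m) (hj : j ≠ i) (s : Fin n) :
    outer h i j hj < inner h i s ↔ j < i := by
  have hs := s.isLt
  simp only [Fin.lt_def, inner]
  rcases lt_or_gt_of_ne hj with e | e
  · rw [outer_val_lt h e]; simp only [Fin.lt_def] at e; omega
  · rw [outer_val_gt h e]; simp only [Fin.lt_def] at e; omega

theorem inner_lt_outer {m n l : ℕ} (h : l + 1 = m + n) (i j : Fin m) (hj : j ≠ i) (s : Fin n) :
    inner h i s < outer h i j hj ↔ i < j := by
  have hs := s.isLt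
  simp only [Fin.lt_def, inner]
  rcases lt_or_gt_of_ne hj with e | e
  · rw [outer_val_lt h e]; simp only [Fin.lt_def] at e; omega
  · rw [outer_val_gt h e]; simp only [Fin.lt_def] at e; omega

theorem pre_eq {m n l : ℕ} (h : l + 1 = m + n) (i : Fin m) (p : Fin l → ZMod 2) :
    pre i p = ∑ j : {j // j ≠ i}, if j.1 < i then p (outer h i j.1 j.2) else 0 := by
  unfold pre
  rw [sum_circ h i]
  have : ∑ s, (if (inner h i s : ℕ) < i then p (inner h i s) else 0) = 0 :=
    Finset.sum_eq_zero fun s _ => if_neg (by simp [inner])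
  rw [this, zero_add]
  simp only [outer_lt_iff]

theorem pre_circArg_le {m n l : ℕ} (h : l + 1 = m + n) (i : Fin m) (a : ℕ) (ha : a ≤ i)
    (g : (Fin n → ZMod 2) → ZMod 2) (p : Fin l → ZMod 2) : pre a (circArg h i g p) = pre a p := by
  unfold pre
  rw [sum_circ h i, sum_ne i]
  have e1 : ∑ s, (if (inner h i s : ℕ) < a then p (inner h i s) else 0) = 0 :=
    Finset.sum_eq_zero fun s _ => if_neg (by simp only [inner]; omega)
  rw [e1, if_neg (by omega)]
  refine congrArg _ (Finset.sum_congr rfl fun j _ => ?_)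
  rw [circArg_ne h i j.1 j.2]
  refine if_congr ?_ rfl rfl
  rcases lt_or_gt_of_ne j.2 with e | e
  · rw [outer_val_lt h e]
  · rw [outer_val_gt h e]; rw [Fin.lt_def] at e; omega

theorem pre_circArg_gt {m n l : ℕ} (h : l + 1 = m + n) (i : Fin m) (a : ℕ) (ha : (i : ℕ) < a)
    (e : ZMod 2) (p : Fin l → ZMod 2) :
    pre a (circArg h i (fun y => ∑ s, y s + e) p) = pre (a + n - 1) p + e := by
  unfold pre
  rw [sum_circ h i, sum_ne i, circArg_self, if_pos ha]
  have e1 : ∑ s, (if (inner h i s : ℕ) < a + n - 1 then p (inner h i s) else 0) =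
      ∑ s, p (inner h i s) :=
    Finset.sum_congr rfl fun s _ => if_pos (by simp only [inner]; omega)
  have e2 : ∑ j : {j // j ≠ i}, (if (j.1 : ℕ) < a then
        circArg h i (fun y => ∑ s, y s + e) p j.1 else 0) =
      ∑ j : {j // j ≠ i}, (if (outer h i j.1 j.2 : ℕ) < a + n - 1 then
        p (outer h i j.1 j.2) else 0) := by
    refine Finset.sum_congr rfl fun j _ => ?_
    rw [circArg_ne h i j.1 j.2]
    refine if_congr ?_ rfl rfl
    rcases lt_or_gt_of_ne j.2 with e | e
    · rw [outer_val_lt h e]; rw [Fin.lt_def] at e; omega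
    · rw [outer_val_gt h e]; rw [Fin.lt_def] at e; omega
  rw [e1, e2]
  ring

theorem pre_add {m n l : ℕ} (h : l + 1 = m + n) (i : Fin m) (j : ℕ) (hj : j ≤ n)
    (p : Fin l → ZMod 2) :
    pre (i + j) p = pre i p + pre j (fun s : Fin n => p (inner h i s)) := by
  rw [pre_eq h i]
  unfold pre
  rw [sum_circ h i, add_comm]
  congr 1
  · refine Finset.sum_congr rfl fun t _ => if_congr ?_ rfl rfl
    rcases lt_or_gt_of_ne t.2 with e | e
    · rw [outer_val_lt h e]; rw [Fin.lt_def] at *; omega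
    · rw [outer_val_gt h e]; rw [Fin.lt_def] at *; omega
  · refine Finset.sum_congr rfl fun t _ => if_congr ?_ rfl rfl
    simp [inner]

theorem koszul_circ {m n l : ℕ} (h : l + 1 = m + n) (i : Fin m) (σ : Equiv.Perm (Fin m))
    (τ : Equiv.Perm (Fin n)) (ρ : Equiv.Perm (Fin l))
    (h₁ : ∀ s, ρ (inner h i s) = inner h (σ i) (τ s))
    (h₂ : ∀ j (hj : j ≠ i),
      ρ (outer h i j hj) = outer h (σ i) (σ j) (fun e => hj (σ.injective e)))
    (e : ZMod 2) (p : Fin l → ZMod 2) :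
    koszul ρ p + e * pre (σ i) (fun t => p (ρ.symm t)) =
      e * pre i p + koszul σ (circArg h i (fun y => ∑ s, y s + e) p) +
        koszul τ (fun s => p (inner h i s)) := by
  have hpre : pre (σ i) (fun t => p (ρ.symm t)) =
      ∑ j : {j // j ≠ i}, if σ j.1 < σ i then p (outer h i j.1 j.2) else 0 := by
    unfold pre
    rw [← Equiv.sum_comp ρ, sum_circ h i]
    have e1 : ∑ s, (if (ρ (inner h i s) : ℕ) < σ i then p (ρ.symm (ρ (inner h i s))) else 0) = 0 :=
      Finset.sum_eq_zero fun s _ => if_neg (by rw [h₁]; simp [inner])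
    rw [e1, zero_add]
    refine Finset.sum_congr rfl fun j _ => ?_
    refine if_congr ?_ (by simp) rfl
    rw [h₂ j.1 j.2]
    exact outer_lt_iff h _ _ _
  rw [hpre, pre_eq h i]
  unfold koszul
  rw [sum_circ h i]
  simp only [sum_circ h i, sum_ne i, circArg_self, lt_irrefl, false_and, if_false, zero_add]
  have hc : ∀ (j : {j // j ≠ i}), circArg h i (fun y => ∑ s, y s + e) p j.1 =
      p (outer h i j.1 j.2) := fun j => circArg_ne h i j.1 j.2 _ p
  have hin : ∀ s t, inner h i s < inner h i t ↔ s < t := by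
    intro s t; rw [Fin.lt_def, Fin.lt_def]; simp [inner]
  have hin' : ∀ s t, inner h (σ i) s < inner h (σ i) t ↔ s < t := by
    intro s t; rw [Fin.lt_def, Fin.lt_def]; simp [inner]
  have ho : ∀ (j : {j // j ≠ i}), ρ (outer h i j.1 j.2) =
    outer h (σ i) (σ j.1) (fun e => j.2 (σ.injective e)) := fun j => h₂ j.1 j.2
  simp only [hc, h₁, ho, hin, hin', outer_lt_outer, outer_lt_inner, inner_lt_outer]
  simp only [Finset.sum_add_distrib, Finset.mul_sum]
  have hS : ∀ (P : {j // j ≠ i} → Prop) [DecidablePred P],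
      (∑ j : {j // j ≠ i}, ∑ s : Fin n, if P j then p (outer h i j.1 j.2) * p (inner h i s) else 0) =
      ∑ j : {j // j ≠ i}, if P j then p (outer h i j.1 j.2) * ∑ s, p (inner h i s) else 0 := by
    intro P _
    refine Finset.sum_congr rfl fun j _ => ?_
    split_ifs
    · rw [Finset.mul_sum]
    · simp
  have hS' : ∀ (P : {j // j ≠ i} → Prop) [DecidablePred P],
      (∑ s : Fin n, ∑ j : {j // j ≠ i}, if P j then p (inner h i s) * p (outer h i j.1 j.2) else 0) =
      ∑ j : {j // j ≠ i}, if P j then p (outer h i j.1 j.2) * ∑ s, p (inner h i s) else 0 := by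
    intro P _
    rw [← hS P, Finset.sum_comm]
    simp only [mul_comm]
  rw [hS, hS']
  generalize ∑ s, p (inner h i s) = S
  have key : (∑ j : {j // j ≠ i}, if j.1 < i ∧ σ i < σ j.1 then p (outer h i j.1 j.2) * S else 0) +
      (∑ j : {j // j ≠ i}, if i < j.1 ∧ σ j.1 < σ i then p (outer h i j.1 j.2) * S else 0) +
      (∑ j : {j // j ≠ i}, e * if σ j.1 < σ i then p (outer h i j.1 j.2) else 0) =
      (∑ j : {j // j ≠ i}, e * if j.1 < i then p (outer h i j.1 j.2) else 0) +
      (∑ j : {j // j ≠ i}, if i < j.1 ∧ σ j.1 < σ i then (S + e) * p (outer h i j.1 j.2) else 0) +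
      (∑ j : {j // j ≠ i}, if j.1 < i ∧ σ i < σ j.1 then p (outer h i j.1 j.2) * (S + e)
        else 0) := by
    simp only [← Finset.sum_add_distrib]
    refine Finset.sum_congr rfl fun j _ => ?_
    have hj : σ j.1 ≠ σ i := fun e => j.2 (σ.injective e)
    have h2 : ∀ x : ZMod 2, x + x = 0 := CharTwo.add_self_eq_zero
    rcases lt_or_gt_of_ne j.2 with a | a <;> rcases lt_or_gt_of_ne hj with b | b <;>
      simp only [a, b, not_lt.2 a.le, not_lt.2 b.le, and_self, and_false, false_and, if_true,
        if_false, mul_zero, zero_add, add_zero]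
    · linear_combination -(h2 (e * p (outer h i j.1 j.2)))
    · ring
  linear_combination key

end Signs

section Graded

/-- An operad in graded vector spaces; `obj n d` is the degree `d` part of the arity `n`
component.  The Koszul sign enters only the axiom `circ_comm`. -/
structure GrOperad (k : Type u) [Field k] where
  obj : ℕ → ℤ → Type v
  [addCommGroup : ∀ n d, AddCommGroup (obj n d)]
  [module : ∀ n d, Module k (obj n d)]
  act : ∀ {n : ℕ} {d : ℤ}, Equiv.Perm (Fin n) → obj n d →ₗ[k] obj n d
  one : obj 1 0
  circ : ∀ {m n l : ℕ} {d e g : ℤ}, l + 1 = m + n → g = d + e → Fin m →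
    (obj m d →ₗ[k] obj n e →ₗ[k] obj l g)
  act_one : ∀ {n : ℕ} {d : ℤ} (p : obj n d), act 1 p = p
  act_mul : ∀ {n : ℕ} {d : ℤ} (σ τ : Equiv.Perm (Fin n)) (p : obj n d),
    act (σ * τ) p = act τ (act σ p)
  one_circ : ∀ {n : ℕ} {e : ℤ} (h : n + 1 = 1 + n) (hd : e = 0 + e) (q : obj n e),
    circ h hd 0 one q = q
  circ_one : ∀ {m : ℕ} {d : ℤ} (h : m + 1 = m + 1) (hd : d = d + 0) (i : Fin m) (p : obj m d),
    circ h hd i p one = p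
  circ_circ : ∀ {m n r l l' N : ℕ} {d e f g g' G : ℤ} (h₁ : l + 1 = m + n) (h₂ : N + 1 = l + r)
    (h₃ : l' + 1 = n + r) (h₄ : N + 1 = m + l') (hd₁ : g = d + e) (hd₂ : G = g + f)
    (hd₃ : g' = e + f) (hd₄ : G = d + g') (i : Fin m) (j : Fin n) (p : obj m d) (q : obj n e)
    (s : obj r f),
    circ h₂ hd₂ (inner h₁ i j) (circ h₁ hd₁ i p q) s = circ h₄ hd₄ i p (circ h₃ hd₃ j q s)
  circ_comm : ∀ {m n r l l' N : ℕ} {d e f g g' G : ℤ} (h₁ : l + 1 = m + n) (h₂ : N + 1 = l + r)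
    (h₃ : l' + 1 = m + r) (h₄ : N + 1 = l' + n) (hd₁ : g = d + e) (hd₂ : G = g + f)
    (hd₃ : g' = d + f) (hd₄ : G = g' + e) (i j : Fin m) (hij : i < j) (p : obj m d) (q : obj n e)
    (s : obj r f),
    circ h₂ hd₂ (outer h₁ i j hij.ne') (circ h₁ hd₁ i p q) s =
      sgn k (e * f) • circ h₄ hd₄ (outer h₃ j i hij.ne) (circ h₃ hd₃ j p s) q
  circ_act : ∀ {m n l : ℕ} {d e g : ℤ} (h : l + 1 = m + n) (hd : g = d + e) (i : Fin m)
    (σ : Equiv.Perm (Fin m)) (τ : Equiv.Perm (Fin n)) (ρ : Equiv.Perm (Fin l)),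
    (∀ s, ρ (inner h i s) = inner h (σ i) (τ s)) →
    (∀ j (hj : j ≠ i), ρ (outer h i j hj) = outer h (σ i) (σ j) (fun e => hj (σ.injective e))) →
    ∀ (p : obj m d) (q : obj n e),
      circ h hd i (act σ p) (act τ q) = act ρ (circ h hd (σ i) p q)

attribute [instance] GrOperad.addCommGroup GrOperad.module

/-- Homomorphisms of graded operads (of degree zero). -/
structure GrOperad.Hom {k : Type u} [Field k] (P : GrOperad.{u, v} k) (Q : GrOperad.{u, w} k) where
  app : ∀ n d, P.obj n d →ₗ[k] Q.obj n d
  map_act : ∀ {n : ℕ} {d : ℤ} (σ : Equiv.Perm (Fin n)) (p : P.obj n d),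
    app n d (P.act σ p) = Q.act σ (app n d p)
  map_one : app 1 0 P.one = Q.one
  map_circ : ∀ {m n l : ℕ} {d e g : ℤ} (h : l + 1 = m + n) (hd : g = d + e) (i : Fin m)
    (p : P.obj m d) (q : P.obj n e),
    app l g (P.circ h hd i p q) = Q.circ h hd i (app m d p) (app n e q)

variable {k : Type u} [Field k]

/-- The product of a family of graded operads. -/
def GrOperad.pi {ι : Type w} (O : ι → GrOperad.{u, v} k) : GrOperad.{u, max w v} k where
  obj n d := ∀ a, (O a).obj n d
  act σ := LinearMap.pi fun a => (O a).act σ ∘ₗ LinearMap.proj a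
  one := fun a => (O a).one
  circ h hd i := LinearMap.mk₂ k (fun p q a => (O a).circ h hd i (p a) (q a))
    (fun _ _ _ => by funext a; simp) (fun _ _ _ => by funext a; simp)
    (fun _ _ _ => by funext a; simp) (fun _ _ _ => by funext a; simp)
  act_one p := by funext a; exact (O a).act_one _
  act_mul σ τ p := by funext a; exact (O a).act_mul _ _ _
  one_circ h hd q := by funext a; exact (O a).one_circ _ _ _
  circ_one h hd i p := by funext a; exact (O a).circ_one _ _ _ _
  circ_circ h₁ h₂ h₃ h₄ d₁ d₂ d₃ d₄ i j p q s := by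
    funext a; exact (O a).circ_circ h₁ h₂ h₃ h₄ d₁ d₂ d₃ d₄ i j _ _ _
  circ_comm h₁ h₂ h₃ h₄ d₁ d₂ d₃ d₄ i j hij p q s := by
    funext a; exact (O a).circ_comm h₁ h₂ h₃ h₄ d₁ d₂ d₃ d₄ i j hij _ _ _
  circ_act h hd i σ τ ρ h₁ h₂ p q := by funext a; exact (O a).circ_act h hd i σ τ ρ h₁ h₂ _ _

/-- A graded suboperad. -/
structure GrOperad.Sub (O : GrOperad.{u, v} k) where
  carrier : ∀ n d, Submodule k (O.obj n d)
  act_mem : ∀ {n : ℕ} {d : ℤ} (σ : Equiv.Perm (Fin n)) {p : O.obj n d},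
    p ∈ carrier n d → O.act σ p ∈ carrier n d
  one_mem : O.one ∈ carrier 1 0
  circ_mem : ∀ {m n l : ℕ} {d e g : ℤ} (h : l + 1 = m + n) (hd : g = d + e) (i : Fin m)
    {p : O.obj m d} {q : O.obj n e}, p ∈ carrier m d → q ∈ carrier n e →
    O.circ h hd i p q ∈ carrier l g

/-- The smallest suboperad containing a given family of subspaces. -/
def GrOperad.subSpan (O : GrOperad.{u, v} k) (S : ∀ n d, Submodule k (O.obj n d)) : O.Sub where
  carrier n d := ⨅ I : {I : O.Sub // ∀ n d, S n d ≤ I.carrier n d}, I.1.carrier n d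
  act_mem σ p hp := by
    simp only [Submodule.mem_iInf] at hp ⊢
    exact fun I => I.1.act_mem σ (hp I)
  one_mem := by
    simp only [Submodule.mem_iInf]
    exact fun I => I.1.one_mem
  circ_mem h hd i p q hp hq := by
    simp only [Submodule.mem_iInf] at hp hq ⊢
    exact fun I => I.1.circ_mem h hd i (hp I) (hq I)

/-- A suboperad is a graded operad. -/
def GrOperad.Sub.toGrOperad {O : GrOperad.{u, v} k} (S : O.Sub) : GrOperad.{u, v} k where
  obj n d := S.carrier n d
  act σ := (O.act σ).restrict (fun _ hp => S.act_mem σ hp)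
  one := ⟨O.one, S.one_mem⟩
  circ h hd i := LinearMap.mk₂ k (fun p q => ⟨O.circ h hd i p.1 q.1, S.circ_mem h hd i p.2 q.2⟩)
    (fun _ _ _ => Subtype.ext (by simp)) (fun _ _ _ => Subtype.ext (by simp))
    (fun _ _ _ => Subtype.ext (by simp)) (fun _ _ _ => Subtype.ext (by simp))
  act_one p := Subtype.ext (O.act_one _)
  act_mul σ τ p := Subtype.ext (O.act_mul _ _ _)
  one_circ h hd q := Subtype.ext (O.one_circ _ _ _)
  circ_one h hd i p := Subtype.ext (O.circ_one _ _ _ _)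
  circ_circ h₁ h₂ h₃ h₄ d₁ d₂ d₃ d₄ i j p q s :=
    Subtype.ext (O.circ_circ h₁ h₂ h₃ h₄ d₁ d₂ d₃ d₄ i j _ _ _)
  circ_comm h₁ h₂ h₃ h₄ d₁ d₂ d₃ d₄ i j hij p q s :=
    Subtype.ext (O.circ_comm h₁ h₂ h₃ h₄ d₁ d₂ d₃ d₄ i j hij _ _ _)
  circ_act h hd i σ τ ρ h₁ h₂ p q := Subtype.ext (O.circ_act h hd i σ τ ρ h₁ h₂ _ _)

end Graded

section Suspension

variable {k : Type u} [Field k]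

/-- The degree `d` part of `↑^{n-1} P(n)`. -/
def Operad.suspPiece (P : Operad.{u, v} k) (n : ℕ) (d : ℤ) : Submodule k (P.obj n) :=
  if d + 1 = n then ⊤ else ⊥

theorem Operad.mem_suspPiece (P : Operad.{u, v} k) {n : ℕ} {d : ℤ} {x : P.obj n} :
    x ∈ P.suspPiece n d ↔ d + 1 = n ∨ x = 0 := by
  unfold Operad.suspPiece
  split_ifs with h <;> simp [h]

theorem cast_two {n : ℕ} {d : ℤ} (h : d + 1 = n) : (d : ZMod 2) = n + 1 := by
  have h' := congrArg (Int.cast : ℤ → ZMod 2) h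
  push_cast at h'
  have : (1 : ZMod 2) + 1 = 0 := by decide
  linear_combination h' - this

/-- The suspended partial composition, as an unsigned one times a sign. -/
def Operad.suspCirc (P : Operad.{u, v} k) {m n l : ℕ} (e : ℤ) (h : l + 1 = m + n) (i : Fin m) :
    P.obj m →ₗ[k] P.obj n →ₗ[k] P.obj l :=
  sgn k ((i : ℕ) * e) • P.circ h i

theorem pre_one {l : ℕ} (a : ℕ) (ha : a ≤ l) : pre a (1 : Fin l → ZMod 2) = a := by
  unfold pre
  simp only [Pi.one_apply, Finset.sum_boole]
  congr 1
  have : (Finset.univ.filter fun t : Fin l => (t : ℕ) < a) =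
      Finset.univ.map (Fin.castLEEmb ha) := by
    ext t
    simp only [Finset.mem_filter, Finset.mem_univ, true_and, Finset.mem_map]
    constructor
    · intro h; exact ⟨⟨t, h⟩, rfl⟩
    · rintro ⟨s, rfl⟩; simp
  rw [this]; simp

/-- The operadic suspension `Λ P`, with `(Λ P)(n) = ↑^{n-1} P(n) ⊗ sgn_n`.  The signs are those for
which `Λ End_A` is the endomorphism operad of the desuspension of `A`: with `i` numbered from `0`,
`p ∘ᵢ q` carries the sign `(-1)^{i |q|}`. -/
def Operad.susp (P : Operad.{u, v} k) : GrOperad.{u, v} k where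
  obj n d := P.suspPiece n d
  act {n d} σ := ((((Equiv.Perm.sign σ : ℤˣ) : ℤ) : k) • P.act σ).restrict (fun p hp => by
    rw [Operad.mem_suspPiece] at hp ⊢
    rcases hp with hp | rfl
    · exact Or.inl hp
    · simp)
  one := ⟨P.one, P.mem_suspPiece.2 (Or.inl (by norm_num))⟩
  circ {m n l d e g} h hd i := LinearMap.mk₂ k (fun p q => ⟨P.suspCirc e h i p.1 q.1, by
      rcases P.mem_suspPiece.1 p.2 with hp | hp
      · rcases P.mem_suspPiece.1 q.2 with hq | hq
        · exact P.mem_suspPiece.2 (Or.inl (by omega))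
        · rw [hq, map_zero]; exact zero_mem _
      · rw [hp, map_zero]; exact zero_mem _⟩)
    (fun _ _ _ => Subtype.ext (by simp)) (fun _ _ _ => Subtype.ext (by simp))
    (fun _ _ _ => Subtype.ext (by simp)) (fun _ _ _ => Subtype.ext (by simp))
  act_one p := Subtype.ext (by simp [P.act_one])
  act_mul σ τ p := Subtype.ext (by
    simp only [LinearMap.coe_restrict_apply, LinearMap.smul_apply, P.act_mul,
      Equiv.Perm.sign_mul, map_smul, smul_smul, Units.val_mul, Int.cast_mul])
  one_circ h hd q := Subtype.ext (by simp [Operad.suspCirc, P.one_circ, sgn_zero])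
  circ_one h hd i p := Subtype.ext (by simp [Operad.suspCirc, P.circ_one, sgn_zero])
  circ_circ {m n r l l' N d e f g g' G} h₁ h₂ h₃ h₄ d₁ d₂ d₃ d₄ i j p q s := Subtype.ext (by
    simp only [LinearMap.mk₂_apply, Operad.suspCirc, LinearMap.smul_apply, map_smul, smul_smul,
      P.circ_circ h₁ h₂ h₃ h₄, ← sgn_add]
    congr 2
    subst d₃
    simp only [inner]
    push_cast
    ring)
  circ_comm {m n r l l' N d e f g g' G} h₁ h₂ h₃ h₄ d₁ d₂ d₃ d₄ i j hij p q s := Subtype.ext (by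
    rcases P.mem_suspPiece.1 q.2 with hq | hq
    · simp only [LinearMap.mk₂_apply, Operad.suspCirc, LinearMap.smul_apply, map_smul, smul_smul,
        P.circ_comm h₁ h₂ h₃ h₄ i j hij, ← sgn_add, Submodule.coe_smul]
      congr 2
      rw [outer_val_lt h₃ hij]
      have e1 : (((outer h₁ i j hij.ne' : Fin l) : ℕ) : ZMod 2) = j + e := by
        rw [outer_val_gt h₁ hij, cast_two hq]
        have : (j : ℕ) + n - 1 + 1 = j + n := by have := Fin.lt_def.1 hij; omega
        have := congrArg (Nat.cast : ℕ → ZMod 2) this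
        push_cast at this
        have h2 : (1 : ZMod 2) + 1 = 0 := by decide
        linear_combination this - h2
      rw [e1]
      ring
    · rw [show q = 0 from Subtype.ext hq]; simp)
  circ_act {m n l d e g} h hd i σ τ ρ h₁ h₂ p q := Subtype.ext (by
    rcases P.mem_suspPiece.1 q.2 with hq | hq
    · simp only [LinearMap.mk₂_apply, Operad.suspCirc, LinearMap.smul_apply, map_smul, smul_smul,
        LinearMap.coe_restrict_apply, P.circ_act h i σ τ ρ h₁ h₂, ← sgn_koszul_one k, ← sgn_add]
      congr 2
      have K := koszul_circ h i σ τ ρ h₁ h₂ e 1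
      have hc : circArg h i (fun y : Fin n → ZMod 2 => ∑ s, y s + (e : ZMod 2)) 1 = 1 := by
        funext j
        by_cases hj : j = i
        · subst hj
          rw [circArg_self, cast_two hq]
          simp only [Pi.one_apply, Finset.sum_const, Finset.card_univ, Fintype.card_fin,
            nsmul_eq_mul, mul_one]
          linear_combination CharTwo.add_self_eq_zero (n : ZMod 2)
        · rw [circArg_ne _ _ _ hj]; rfl
      have hm : ∀ i : Fin m, (i : ℕ) ≤ l := fun i => by have := i.isLt; omega
      have e1 : pre (σ i) (fun t : Fin l => (1 : Fin l → ZMod 2) (ρ.symm t)) = ((σ i : ℕ) : ZMod 2) :=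
        pre_one _ (hm _)
      have e2 : koszul τ (fun s => (1 : Fin l → ZMod 2) (inner h i s)) = koszul τ 1 := rfl
      rw [hc, e1, e2, pre_one _ (hm _)] at K
      linear_combination -K
    · rw [show q = 0 from Subtype.ext hq]; simp)

end Suspension

section GradedEnd

variable {k : Type u} [Field k] {V : ℕ → Type v} [∀ m, AddCommGroup (V m)] [∀ m, Module k (V m)]

/-- The operator multiplying elements of degree `m` by `(-1)^{c m}`. -/
def eps (c : ZMod 2) : (⨁ m, V m) →ₗ[k] (⨁ m, V m) :=
  DirectSum.lmap fun m => sgn k (c * m) • LinearMap.id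

/-- The projection to the part of degrees congruent to `b` modulo 2. -/
def par (b : ZMod 2) : (⨁ m, V m) →ₗ[k] (⨁ m, V m) :=
  DirectSum.lmap fun m => if (m : ZMod 2) = b then LinearMap.id else 0

/-- Being concentrated in degrees congruent to `b` modulo 2. -/
def HasPar (b : ZMod 2) (x : ⨁ m, V m) : Prop := ∀ m : ℕ, (m : ZMod 2) ≠ b → x m = 0

theorem hasPar_lof (m : ℕ) (v : V m) : HasPar (m : ZMod 2) (DirectSum.lof k ℕ V m v) := by
  intro m' h
  rw [DirectSum.lof_eq_of, DirectSum.of_eq_of_ne]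
  rintro rfl; exact h rfl

theorem par_of_eq {b : ZMod 2} {x : ⨁ m, V m} (hx : HasPar b x) : par (k := k) b x = x := by
  refine DFinsupp.ext fun m => ?_
  change (par b x) m = x m
  rw [par, DirectSum.lmap_apply]
  split_ifs with h
  · rfl
  · rw [hx m h]; rfl

theorem par_of_ne {b c : ZMod 2} (hbc : b ≠ c) {x : ⨁ m, V m} (hx : HasPar b x) :
    par (k := k) c x = 0 := by
  refine DFinsupp.ext fun m => ?_
  change (par c x) m = 0
  rw [par, DirectSum.lmap_apply]
  split_ifs with h
  · exact hx m (by rw [h]; exact hbc.symm)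
  · rfl

theorem eps_of {c b : ZMod 2} {x : ⨁ m, V m} (hx : HasPar b x) :
    eps (k := k) c x = sgn k (c * b) • x := by
  refine DFinsupp.ext fun m => ?_
  change (eps (k := k) c x) m = sgn k (c * b) • x m
  rw [eps, DirectSum.lmap_apply]
  by_cases h : (m : ZMod 2) = b
  · rw [h]; rfl
  · rw [hx m h]; simp

variable (k V) in
/-- The multilinear maps on `⨁ V` which are homogeneous of degree `d`. -/
def homog (n : ℕ) (d : ℤ) :
    Submodule k (MultilinearMap k (fun _ : Fin n => ⨁ m, V m) (⨁ m, V m)) where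
  carrier := {F | ∀ (p : Fin n → ℕ) (v : ∀ i, V (p i)) (M : ℕ), (M : ℤ) ≠ ∑ i, (p i : ℤ) + d →
    F (fun i => DirectSum.lof k ℕ V (p i) (v i)) M = 0}
  add_mem' := fun hF hG p v M hM => by
    rw [add_apply, DirectSum.add_apply, hF p v M hM, hG p v M hM, add_zero]
  zero_mem' := fun p v M _ => rfl
  smul_mem' := fun c F hF p v M hM => by
    rw [smul_apply, DirectSum.smul_apply, hF p v M hM, smul_zero]

/-- Multilinear maps which agree on elements of definite parity are equal. -/
theorem ext_par {n : ℕ} {F G : MultilinearMap k (fun _ : Fin n => ⨁ m, V m) (⨁ m, V m)}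
    (h : ∀ (p : Fin n → ZMod 2) (x : Fin n → ⨁ m, V m), (∀ i, HasPar (p i) (x i)) → F x = G x) :
    F = G := by
  refine MultilinearMap.directSum_ext fun p => ?_
  ext1 v
  exact h (fun i => p i) _ fun i => hasPar_lof _ _

/-- A homogeneous multilinear map shifts parity by its degree. -/
theorem hasPar_apply {n : ℕ} {d : ℤ}
    {F : MultilinearMap k (fun _ : Fin n => ⨁ m, V m) (⨁ m, V m)} (hF : F ∈ homog k V n d)
    (p : Fin n → ZMod 2) (x : Fin n → ⨁ m, V m) (hx : ∀ i, HasPar (p i) (x i)) :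
    HasPar (∑ i, p i + d) (F x) := by
  intro M hM
  have key : ((DirectSum.component k ℕ V M).compMultilinearMap F).compLinearMap
      (fun i => par (k := k) (p i)) = 0 := by
    refine MultilinearMap.directSum_ext fun q => ?_
    ext1 v
    simp only [MultilinearMap.compLinearMap_apply, LinearMap.compMultilinearMap_apply]
    by_cases hq : ∀ i, (q i : ZMod 2) = p i
    · have : ∀ i, par (k := k) (p i) (DirectSum.lof k ℕ V (q i) (v i)) =
          DirectSum.lof k ℕ V (q i) (v i) := fun i => par_of_eq (by
        rw [← hq i]; exact hasPar_lof _ _)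
      simp only [this]
      refine hF q v M fun e => hM ?_
      have e' := congrArg (Int.cast : ℤ → ZMod 2) e
      push_cast at e'
      rw [e']
      congr 1
      exact Finset.sum_congr rfl fun i _ => hq i
    · push Not at hq
      obtain ⟨i, hi⟩ := hq
      rw [MultilinearMap.map_coord_zero F i (par_of_ne hi (hasPar_lof _ _))]
      rfl
  have h2 := congrArg (fun G => G x) key
  simp only [MultilinearMap.compLinearMap_apply, LinearMap.compMultilinearMap_apply] at h2
  simp only [fun i => par_of_eq (k := k) (hx i)] at h2
  exact h2

/-- The action of a permutation with Koszul signs: on elements `x_i` of definite parity,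
`(F σ)(x) = ± F(x ∘ σ⁻¹)`. -/
def gact {n : ℕ} (σ : Equiv.Perm (Fin n)) :
    MultilinearMap k (fun _ : Fin n => ⨁ m, V m) (⨁ m, V m) →ₗ[k]
      MultilinearMap k (fun _ : Fin n => ⨁ m, V m) (⨁ m, V m) :=
  ∑ π : Fin n → ZMod 2, sgn k (koszul σ π) •
    (MultilinearMap.compLinearMapₗ (fun i => par (π i))) ∘ₗ
      (MultilinearMap.domDomCongrLinearEquiv k k (⨁ m, V m) (⨁ m, V m) σ.symm).toLinearMap

theorem gact_apply {n : ℕ} (σ : Equiv.Perm (Fin n))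
    (F : MultilinearMap k (fun _ : Fin n => ⨁ m, V m) (⨁ m, V m))
    (p : Fin n → ZMod 2) (x : Fin n → ⨁ m, V m) (hx : ∀ i, HasPar (p i) (x i)) :
    gact σ F x = sgn k (koszul σ p) • F (fun i => x (σ.symm i)) := by
  have h0 : gact σ F x = ∑ π : Fin n → ZMod 2, sgn k (koszul σ π) •
      F (fun i => par (k := k) (π (σ.symm i)) (x (σ.symm i))) := by
    simp only [gact, LinearMap.sum_apply, sum_apply]
    rfl
  rw [h0, Finset.sum_eq_single p]
  · simp only [fun i => par_of_eq (k := k) (hx i)]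
  · intro π _ hπ
    obtain ⟨i, hi⟩ := Function.ne_iff.1 hπ
    rw [MultilinearMap.map_coord_zero F (σ i), smul_zero]
    rw [Equiv.symm_apply_apply]
    exact par_of_ne hi.symm (hx i)
  · intro h; exact absurd (Finset.mem_univ _) h

/-- Partial composition with Koszul signs: the inserted map, of degree `e`, passes the preceding
arguments, so that `(F ∘ᵢ G)(x) = (-1)^{e (|x₁| + ⋯ + |x_{i-1}|)} F(x₁, …, G(x_i, …), …)`. -/
def gcirc {m n l : ℕ} (e : ZMod 2) (h : l + 1 = m + n) (i : Fin m) :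
    MultilinearMap k (fun _ : Fin m => ⨁ m, V m) (⨁ m, V m) →ₗ[k]
      MultilinearMap k (fun _ : Fin n => ⨁ m, V m) (⨁ m, V m) →ₗ[k]
        MultilinearMap k (fun _ : Fin l => ⨁ m, V m) (⨁ m, V m) :=
  (mcirc h i) ∘ₗ
    (MultilinearMap.compLinearMapₗ (fun j : Fin m => if j < i then eps e else LinearMap.id))

theorem gcirc_apply {m n l : ℕ} (e : ZMod 2) (h : l + 1 = m + n) (i : Fin m)
    (F : MultilinearMap k (fun _ : Fin m => ⨁ m, V m) (⨁ m, V m))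
    (G : MultilinearMap k (fun _ : Fin n => ⨁ m, V m) (⨁ m, V m))
    (p : Fin l → ZMod 2) (x : Fin l → ⨁ m, V m) (hx : ∀ i, HasPar (p i) (x i)) :
    gcirc e h i F G x = sgn k (e * pre i p) • F (circArg h i G x) := by
  have h0 : gcirc e h i F G x = F (fun j =>
    (if j < i then eps (k := k) e else LinearMap.id) (circArg h i G x j)) := rfl
  have h1 : ∀ j, (if j < i then eps (k := k) e else LinearMap.id) (circArg h i G x j) =
      (if hj : j < i then sgn k (e * p (outer h i j hj.ne)) else 1) • circArg h i G x j := by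
    intro j
    by_cases hj : j < i
    · rw [if_pos hj, dif_pos hj, circArg_ne h i j hj.ne, eps_of (hx _)]
    · rw [if_neg hj, dif_neg hj, one_smul]; rfl
  rw [h0]
  simp only [h1]
  rw [MultilinearMap.map_smul_univ]
  congr 1
  rw [pre_eq h i, Finset.mul_sum, sgn_sum, Fintype.prod_eq_mul_prod_subtype_ne _ i,
    dif_neg (lt_irrefl i), one_mul]
  refine Finset.prod_congr rfl fun j _ => ?_
  by_cases hj : j.1 < i
  · rw [dif_pos hj, if_pos hj]
  · rw [dif_neg hj, if_neg hj, mul_zero, sgn_zero]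

theorem hasPar_circArg {m n l : ℕ} (h : l + 1 = m + n) (i : Fin m) {e : ℤ}
    {G : MultilinearMap k (fun _ : Fin n => ⨁ m, V m) (⨁ m, V m)} (hG : G ∈ homog k V n e)
    (p : Fin l → ZMod 2) (x : Fin l → ⨁ m, V m) (hx : ∀ i, HasPar (p i) (x i)) (j : Fin m) :
    HasPar (circArg h i (fun y => ∑ s, y s + (e : ZMod 2)) p j) (circArg h i G x j) := by
  by_cases hj : j = i
  · subst hj
    rw [circArg_self, circArg_self]
    exact hasPar_apply hG _ _ fun s => hx _
  · rw [circArg_ne _ _ _ hj, circArg_ne _ _ _ hj]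
    exact hx _

theorem map_circArg_smul {m n l : ℕ} (h : l + 1 = m + n) (i : Fin m)
    (F : MultilinearMap k (fun _ : Fin m => ⨁ m, V m) (⨁ m, V m))
    (g g' : (Fin n → ⨁ m, V m) → ⨁ m, V m) (x : Fin l → ⨁ m, V m) (c : k)
    (hg : g (fun s => x (inner h i s)) = c • g' (fun s => x (inner h i s))) :
    F (circArg h i g x) = c • F (circArg h i g' x) := by
  have e : circArg h i g x =
      Function.update (circArg h i g' x) i (c • g' (fun s => x (inner h i s))) := by
    funext j
    by_cases hj : j = i
    · subst hj; rw [circArg_self, Function.update_self, hg]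
    · rw [Function.update_of_ne hj, circArg_ne _ _ _ hj, circArg_ne _ _ _ hj]
  rw [e, MultilinearMap.map_update_smul, ← circArg_self h i g' x, Function.update_eq_self]

theorem homog_gact {n : ℕ} {d : ℤ} (σ : Equiv.Perm (Fin n))
    {F : MultilinearMap k (fun _ : Fin n => ⨁ m, V m) (⨁ m, V m)} (hF : F ∈ homog k V n d) :
    gact σ F ∈ homog k V n d := by
  intro p v M hM
  rw [gact_apply σ F (fun i => (p i : ZMod 2)) _ (fun i => hasPar_lof _ _), DirectSum.smul_apply,
    hF (fun i => p (σ.symm i)) (fun i => v (σ.symm i)) M, smul_zero]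
  rwa [Equiv.sum_comp σ.symm (fun i => (p i : ℤ))]

theorem exists_lof {n : ℕ} {d : ℤ}
    {F : MultilinearMap k (fun _ : Fin n => ⨁ m, V m) (⨁ m, V m)} (hF : F ∈ homog k V n d)
    (p : Fin n → ℕ) (v : ∀ i, V (p i)) :
    F (fun i => DirectSum.lof k ℕ V (p i) (v i)) = 0 ∨ ∃ (M : ℕ) (w : V M),
      (M : ℤ) = ∑ i, (p i : ℤ) + d ∧
      F (fun i => DirectSum.lof k ℕ V (p i) (v i)) = DirectSum.lof k ℕ V M w := by
  by_cases h : ∃ M : ℕ, (M : ℤ) = ∑ i, (p i : ℤ) + d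
  · obtain ⟨M, hM⟩ := h
    refine Or.inr ⟨M, F (fun i => DirectSum.lof k ℕ V (p i) (v i)) M, hM, ?_⟩
    refine DFinsupp.ext fun M' => ?_
    change _ = (DirectSum.lof k ℕ V M _) M'
    by_cases hMM : M' = M
    · subst hMM; rw [DirectSum.lof_apply]
    · rw [DirectSum.lof_eq_of, DirectSum.of_eq_of_ne _ _ _ hMM]
      exact hF p v M' fun e => hMM (by omega)
  · push Not at h
    exact Or.inl (DFinsupp.ext fun M => hF p v M (h M))

theorem homog_gcirc {m n l : ℕ} {d e g : ℤ} (h : l + 1 = m + n) (hd : g = d + e) (i : Fin m)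
    {F : MultilinearMap k (fun _ : Fin m => ⨁ m, V m) (⨁ m, V m)} (hF : F ∈ homog k V m d)
    {G : MultilinearMap k (fun _ : Fin n => ⨁ m, V m) (⨁ m, V m)} (hG : G ∈ homog k V n e) :
    gcirc e h i F G ∈ homog k V l g := by
  intro p v M hM
  rw [gcirc_apply (e : ZMod 2) h i F G (fun i => (p i : ZMod 2)) _ (fun i => hasPar_lof _ _),
    DirectSum.smul_apply]
  suffices hs : F (circArg h i G fun i => DirectSum.lof k ℕ V (p i) (v i)) M = 0 by
    rw [hs, smul_zero]
  rcases exists_lof hG (fun s => p (inner h i s)) (fun s => v (inner h i s)) with h0 | ⟨M', w, hM', h0⟩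
  · rw [MultilinearMap.map_coord_zero F i (by rw [circArg_self]; exact h0)]
    rfl
  · have e1 : (circArg h i G fun i => DirectSum.lof k ℕ V (p i) (v i)) =
        fun j => DirectSum.lof k ℕ V (if hj : j = i then M' else p (outer h i j hj))
          (if hj : j = i then cast (by rw [dif_pos hj]) w
            else cast (by rw [dif_neg hj]) (v (outer h i j hj))) := by
      funext j
      by_cases hj : j = i
      · subst hj
        rw [circArg_self]
        refine h0.trans ?_
        have : ∀ (N : ℕ) (w' : V N) (hN : M' = N), HEq w w' → DirectSum.lof k ℕ V M' w =
          DirectSum.lof k ℕ V N w' := by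
          rintro N w' rfl hw; rw [eq_of_heq hw]
        refine this _ _ (by simp) ?_
        simp
      · rw [circArg_ne _ _ _ hj]
        have : ∀ (N' N : ℕ) (w : V N') (w' : V N) (hN : N' = N), HEq w w' →
          DirectSum.lof k ℕ V N' w = DirectSum.lof k ℕ V N w' := by
          rintro N' N w w' rfl hw; rw [eq_of_heq hw]
        refine this _ _ _ _ (by simp [hj]) ?_
        simp [hj]
    rw [e1]
    refine hF _ _ M fun e2 => hM ?_
    rw [e2, sum_ne i, dif_pos rfl, hM', sum_circ h i, hd]
    have : ∑ j : {j // j ≠ i}, ((if hj : j.1 = i then M' else p (outer h i j.1 hj) : ℕ) : ℤ) =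
        ∑ j : {j // j ≠ i}, (p (outer h i j.1 j.2) : ℤ) :=
      Finset.sum_congr rfl fun j _ => by rw [dif_neg j.2]
    rw [this]
    ring

variable (k V) in
/-- The graded endomorphism operad of the graded vector space `⨁ V`: in arity `n` and degree `d`
it consists of the `n`-linear maps which are homogeneous of degree `d`, with the usual Koszul
signs. -/
def gradedEnd : GrOperad.{u, v} k where
  obj n d := homog k V n d
  act σ := (gact σ).restrict (fun _ hF => homog_gact σ hF)
  one := ⟨MultilinearMap.ofSubsingleton k _ _ (0 : Fin 1) LinearMap.id, by
    intro p v M hM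
    change (DirectSum.lof k ℕ V (p 0) (v 0)) M = 0
    rw [DirectSum.lof_eq_of, DirectSum.of_eq_of_ne]
    rintro rfl
    simp at hM⟩
  circ {m n l d e g} h hd i :=
    LinearMap.mk₂ k (fun F G => ⟨gcirc e h i F.1 G.1, homog_gcirc h hd i F.2 G.2⟩)
    (fun _ _ _ => Subtype.ext (by simp)) (fun _ _ _ => Subtype.ext (by simp))
    (fun _ _ _ => Subtype.ext (by simp)) (fun _ _ _ => Subtype.ext (by simp))
  act_one F := Subtype.ext (ext_par fun p x hx => by
    rw [LinearMap.coe_restrict_apply, gact_apply _ _ p x hx, koszul_one, sgn_zero, one_smul]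
    rfl)
  act_mul σ τ F := Subtype.ext (ext_par fun p x hx => by
    simp only [LinearMap.coe_restrict_apply]
    rw [gact_apply _ _ p x hx, gact_apply _ _ p x hx,
      gact_apply _ _ (fun i => p (τ.symm i)) _ (fun i => hx _), smul_smul, ← sgn_add, koszul_mul]
    rfl)
  one_circ h hd G := Subtype.ext (ext_par fun p x hx => by
    simp only [LinearMap.mk₂_apply]
    rw [gcirc_apply _ _ _ _ _ p x hx]
    have h0 : pre ((0 : Fin 1) : ℕ) p = 0 := by simp [pre]
    rw [h0, mul_zero, sgn_zero, one_smul]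
    change circArg h 0 G.1 x 0 = _
    rw [circArg_self]
    congr 1
    funext s
    congr 1
    apply Fin.ext; simp [inner])
  circ_one h hd i F := Subtype.ext (ext_par fun p x hx => by
    simp only [LinearMap.mk₂_apply]
    rw [gcirc_apply _ _ _ _ _ p x hx, Int.cast_zero, zero_mul, sgn_zero, one_smul]
    exact congrArg (fun G : MultilinearMap k _ _ => G x) ((endOp k (⨁ m, V m)).circ_one h i F.1))
  circ_circ {m n r l l' N d e f g g' G} h₁ h₂ h₃ h₄ d₁ d₂ d₃ d₄ i j P Q S :=
    Subtype.ext (ext_par fun p x hx => by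
      simp only [LinearMap.mk₂_apply]
      rw [gcirc_apply _ _ _ _ _ p x hx, gcirc_apply _ _ _ _ _ p x hx,
        gcirc_apply _ _ _ _ _ _ _ (hasPar_circArg h₂ (inner h₁ i j) S.2 p x hx),
        circArg_circArg h₁ h₂ h₃ h₄,
        map_circArg_smul h₄ i P.1 _ (fun y => Q.1 (circArg h₃ j S.1 y)) x _
          (gcirc_apply _ _ _ _ _ (fun s => p (inner h₄ i s)) _ (fun s => hx _)),
        smul_smul, smul_smul, ← sgn_add, ← sgn_add]
      congr 2
      rw [pre_circArg_le h₂ (inner h₁ i j) i (by simp [inner])]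
      have e1 : pre ((inner h₁ i j : Fin l) : ℕ) p = pre i p +
          pre j (fun s => p (inner h₄ i s)) := by
        have := pre_add h₄ i (j : ℕ) (by have := j.isLt; omega) p
        exact this
      rw [e1, d₃]
      push_cast
      ring)
  circ_comm {m n r l l' N d e f g g' G} h₁ h₂ h₃ h₄ d₁ d₂ d₃ d₄ i j hij P Q S :=
    Subtype.ext (ext_par fun p x hx => by
      simp only [LinearMap.mk₂_apply, Submodule.coe_smul, smul_apply]
      rw [gcirc_apply _ _ _ _ _ p x hx, gcirc_apply _ _ _ _ _ p x hx,
        gcirc_apply _ _ _ _ _ _ _ (hasPar_circArg h₂ _ S.2 p x hx),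
        gcirc_apply _ _ _ _ _ _ _ (hasPar_circArg h₄ _ Q.2 p x hx),
        circArg_comm h₁ h₂ h₃ h₄ i j hij, smul_smul, smul_smul, smul_smul, ← sgn_add, ← sgn_add,
        ← sgn_add]
      congr 2
      have hij' := Fin.lt_def.1 hij
      have o1 := outer_val_gt h₁ hij hij.ne'
      have o2 := outer_val_lt h₃ hij hij.ne
      rw [pre_circArg_le h₂ _ i (by rw [o1]; omega),
        pre_circArg_gt h₄ _ j (by rw [o2]; exact hij'), o1, o2]
      linear_combination (-1 : ZMod 2) * CharTwo.add_self_eq_zero ((e : ZMod 2) * f))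
  circ_act {m n l d e g} h hd i σ τ ρ h₁ h₂ P Q := Subtype.ext (ext_par fun p x hx => by
    have hQ : gact τ Q.1 ∈ homog k V n e := homog_gact τ Q.2
    simp only [LinearMap.mk₂_apply, LinearMap.coe_restrict_apply]
    rw [gcirc_apply _ _ _ _ _ p x hx, gact_apply _ _ _ _ (hasPar_circArg h i hQ p x hx),
      gact_apply _ _ _ _ hx, gcirc_apply _ _ _ _ _ (fun t => p (ρ.symm t)) _ (fun t => hx _),
      ← circArg_perm h i σ τ ρ h₁ h₂, smul_smul, smul_smul, ← sgn_add, ← sgn_add]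
    have e2 := map_circArg_smul h i
      (MultilinearMap.domDomCongr σ.symm P.1) (gact τ Q.1) (fun y => Q.1 (fun s => y (τ.symm s)))
      x _ (gact_apply τ Q.1 (fun s => p (inner h i s)) _ (fun s => hx _))
    have e3 : P.1 (fun j => circArg h i (gact τ Q.1) x (σ.symm j)) =
      MultilinearMap.domDomCongr σ.symm P.1 (circArg h i (gact τ Q.1) x) := rfl
    rw [e3, e2, smul_smul, ← sgn_add]
    rw [← koszul_circ h i σ τ ρ h₁ h₂ e p]
    rfl)

end GradedEnd

section Composition

variable {k : Type u} [Field k]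

/-- Iterated partial composition: insert `f 0, f 1, …` from left to right, in this order, into the
inputs `s, s + 1, …, s + r - 1` of `t`. -/
def GrOperad.gammaAux (O : GrOperad.{u, v} k) : ∀ (r : ℕ) {N s L : ℕ} {d g : ℤ} (_ : O.obj N d)
    (_ : N = s + r) (a : Fin r → ℕ) (e : Fin r → ℤ) (_ : ∀ i, O.obj (a i) (e i))
    (_ : L = s + ∑ i, a i) (_ : g = d + ∑ i, e i), O.obj L g
  | 0, N, s, L, d, g, t, hN, a, e, f, hL, hg =>
    cast (by rw [hN, hL, hg]; simp) t
  | r + 1, N, s, L, d, g, t, hN, a, e, f, hL, hg =>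
    O.gammaAux r (N := s + a 0 + r) (s := s + a 0)
      (O.circ (by omega) rfl (⟨s, by omega⟩ : Fin N) t (f 0)) rfl
      (fun i => a i.succ) (fun i => e i.succ) (fun i => f i.succ)
      (by rw [hL, Fin.sum_univ_succ]; omega) (by rw [hg, Fin.sum_univ_succ]; ring)

/-- The full composition `γ(t; f₁, …, fₙ)` of a graded operad. -/
def GrOperad.gamma (O : GrOperad.{u, v} k) {n L : ℕ} {d g : ℤ} (t : O.obj n d) {a : Fin n → ℕ}
    {e : Fin n → ℤ} (f : ∀ i, O.obj (a i) (e i)) (hL : L = ∑ i, a i) (hg : g = d + ∑ i, e i) :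
    O.obj L g :=
  O.gammaAux n t (s := 0) (by omega) a e f (by omega) hg

/-- The identity homomorphism. -/
def Operad.Hom.id (P : Operad.{u, v} k) : P.Hom P where
  app _ := LinearMap.id
  map_act _ _ := rfl
  map_one := rfl
  map_circ _ _ _ _ := rfl

theorem Operad.Hom.tensor_act {P P' Q Q' : Operad.{u, v} k} (α : P.Hom P') (β : Q.Hom Q') {n : ℕ}
    (σ : Equiv.Perm (Fin n)) (x : P.obj n ⊗[k] Q.obj n) :
    TensorProduct.map (α.app n) (β.app n) (TensorProduct.map (P.act σ) (Q.act σ) x) =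
      TensorProduct.map (P'.act σ) (Q'.act σ) (TensorProduct.map (α.app n) (β.app n) x) := by
  induction x using TensorProduct.induction_on with
  | zero => simp
  | tmul p q => simp [α.map_act, β.map_act]
  | add x y hx hy => simp only [map_add, hx, hy]

theorem Operad.Hom.tensor_circ {P P' Q Q' : Operad.{u, v} k} (α : P.Hom P') (β : Q.Hom Q')
    {m n l : ℕ} (h : l + 1 = m + n) (i : Fin m) (x : P.obj m ⊗[k] Q.obj m)
    (y : P.obj n ⊗[k] Q.obj n) :
    TensorProduct.map (α.app l) (β.app l) (TensorProduct.map₂ (P.circ h i) (Q.circ h i) x y) =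
      TensorProduct.map₂ (P'.circ h i) (Q'.circ h i) (TensorProduct.map (α.app m) (β.app m) x)
        (TensorProduct.map (α.app n) (β.app n) y) := by
  induction x using TensorProduct.induction_on with
  | zero => simp
  | add x x' hx hx' => simp only [map_add, LinearMap.add_apply, hx, hx']
  | tmul p q =>
    induction y using TensorProduct.induction_on with
    | zero => simp
    | add x x' hx hx' => simp only [map_add, hx, hx']
    | tmul p' q' => simp [α.map_circ, β.map_circ]

/-- The tensor product of two homomorphisms. -/
def Operad.Hom.tensor {P P' Q Q' : Operad.{u, v} k} (α : P.Hom P') (β : Q.Hom Q') :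
    (P.tensor Q).Hom (P'.tensor Q') where
  app n := TensorProduct.map (α.app n) (β.app n)
  map_act σ x := Operad.Hom.tensor_act α β σ x
  map_one := by
    change α.app 1 P.one ⊗ₜ[k] β.app 1 Q.one = P'.one ⊗ₜ[k] Q'.one
    rw [α.map_one, β.map_one]
  map_circ h i x y := Operad.Hom.tensor_circ α β h i x y

/-- The suspension of a homomorphism. -/
def Operad.Hom.susp {P Q : Operad.{u, v} k} (α : P.Hom Q) : P.susp.Hom Q.susp where
  app n d := (α.app n).restrict (fun p hp => by
    rw [Operad.mem_suspPiece] at hp ⊢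
    rcases hp with hp | rfl
    · exact Or.inl hp
    · simp)
  map_act {n _} σ p := Subtype.ext <| by
    change α.app n ((((Equiv.Perm.sign σ : ℤˣ) : ℤ) : k) • P.act σ p.1) =
      (((Equiv.Perm.sign σ : ℤˣ) : ℤ) : k) • Q.act σ (α.app n p.1)
    rw [map_smul, α.map_act]
  map_one := Subtype.ext α.map_one
  map_circ {m n l d e g} h hd i p q := Subtype.ext <| by
    change α.app l (sgn k ((i : ℕ) * e) • P.circ h i p.1 q.1) =
      sgn k ((i : ℕ) * e) • Q.circ h i (α.app m p.1) (α.app n q.1)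
    rw [map_smul, α.map_circ]

end Composition

section Cochains

variable {k : Type u} [Field k]

/-- Algebras over an operad `P`: a vector space `A` with a homomorphism `α : P → End_A`. -/
structure Operad.Alg (P : Operad.{u, u} k) where
  carrier : Type u
  [addCommGroup : AddCommGroup carrier]
  [module : Module k carrier]
  α : P.Hom (endOp k carrier)

attribute [instance] Operad.Alg.addCommGroup Operad.Alg.module

/-- The operation on `A` given by an element of `P`. -/
def Operad.Alg.op {P : Operad.{u, u} k} (A : P.Alg) {r : ℕ} (p : P.obj r) :
    MultilinearMap k (fun _ : Fin r => A.carrier) A.carrier := A.α.app r p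

namespace QuadraticData

variable (D : QuadraticData.{u} k)

/-- `Lin(A^{⊗ n}, A)`. -/
abbrev Lin (A : D.operad.Alg) (n : ℕ) : Type u :=
  MultilinearMap k (fun _ : Fin n => A.carrier) A.carrier

/-- The operad `End_A ⊗ P^!`. -/
abbrev endTensor (A : D.operad.Alg) : Operad.{u, u} k := (endOp k A.carrier).tensor D.dual.operad

/-- The space `Lin((↓A)^{⊗ (m+1)}, ↓A) ⊗ P^!(m+1)` of degree `m`, identified with the degree `m`
part of `Λ(End_A ⊗ P^!)(m+1)`. -/
abbrev TildeC (A : D.operad.Alg) (m : ℕ) : Type u := (D.endTensor A).obj (m + 1)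

/-- The element `φ ⊗ q`. -/
def tmk (A : D.operad.Alg) {m : ℕ} (φ : D.Lin A (m + 1)) (q : D.dual.operad.obj (m + 1)) :
    D.TildeC A m := φ ⊗ₜ[k] q

/-- The element of `Λ(End_A ⊗ P^!)(m+1)` given by an element of `TildeC A m`. -/
def tildeUp (A : D.operad.Alg) {m : ℕ} (x : D.TildeC A m) :
    (D.endTensor A).susp.obj (m + 1) m :=
  ⟨x, (D.endTensor A).mem_suspPiece.2 (Or.inl (by push_cast; ring))⟩

/-- The action of permutations on `Lin((↓A)^{⊗ (m+1)}, ↓A) ⊗ P^!(m+1)`, that is, the one on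
`Lin(A^{⊗ (m+1)}, A) ⊗ P^!(m+1)` twisted by the sign. -/
def sact (A : D.operad.Alg) {m : ℕ} (σ : Equiv.Perm (Fin (m + 1))) :
    D.TildeC A m →ₗ[k] D.TildeC A m :=
  (((Equiv.Perm.sign σ : ℤˣ) : ℤ) : k) • (D.endTensor A).act σ

/-- The operadic cochains `C^m_P(A; A) = [Lin((↓A)^{⊗ (m+1)}, ↓A) ⊗ P^!(m+1)]^{Σ_{m+1}}`. -/
def C (A : D.operad.Alg) (m : ℕ) : Submodule k (D.TildeC A m) where
  carrier := {x | ∀ σ, D.sact A σ x = x}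
  add_mem' hx hy σ := by rw [map_add, hx σ, hy σ]
  zero_mem' σ := map_zero _
  smul_mem' c x hx σ := by rw [map_smul, hx σ]

theorem sact_mul (A : D.operad.Alg) {m : ℕ} (σ τ : Equiv.Perm (Fin (m + 1))) (x : D.TildeC A m) :
    D.sact A (σ * τ) x = D.sact A τ (D.sact A σ x) := by
  simp only [sact, LinearMap.smul_apply, map_smul, smul_smul, (D.endTensor A).act_mul,
    Equiv.Perm.sign_mul, Units.val_mul, Int.cast_mul]

/-- The averaging map from `TildeC A m` to `C A m`. -/
def aver (A : D.operad.Alg) {m : ℕ} : D.TildeC A m →ₗ[k] D.C A m :=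
  LinearMap.codRestrict (D.C A m)
    ((Fintype.card (Equiv.Perm (Fin (m + 1))) : k)⁻¹ • ∑ σ : Equiv.Perm (Fin (m + 1)), D.sact A σ)
    (fun x τ => by
      simp only [LinearMap.smul_apply, LinearMap.sum_apply, map_smul, map_sum, ← D.sact_mul]
      rw [← Equiv.sum_comp (Equiv.mulRight τ) (fun σ => D.sact A σ x)]
      rfl)

end QuadraticData

end Cochains

section Natural

variable {k : Type u} [Field k]

/-- Rooted trees with input legs labelled by `L`, with white vertices labelled by `Fin n`, the
`i`-th one having `a i` linearly ordered input edges, and with at least binary black vertices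
decorated by elements of `P`. -/
inductive DTree (P : Operad.{u, u} k) {n : ℕ} (a : Fin n → ℕ) (L : Type) : Type u
  | leg : L → DTree P a L
  | white (i : Fin n) : (Fin (a i) → DTree P a L) → DTree P a L
  | black {r : ℕ} : 2 ≤ r → P.obj r → (Fin r → DTree P a L) → DTree P a L

namespace DTree

variable {P : Operad.{u, u} k} {n : ℕ} {a : Fin n → ℕ} {L : Type}

/-- The number of legs labelled by `x`. -/
def legCount [DecidableEq L] (x : L) : DTree P a L → ℕ
  | leg y => if y = x then 1 else 0
  | white _ c => ∑ s, (c s).legCount x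
  | black _ _ c => ∑ s, (c s).legCount x

/-- The number of white vertices labelled by `j`. -/
def whiteCount (j : Fin n) : DTree P a L → ℕ
  | leg _ => 0
  | white i c => (if i = j then 1 else 0) + ∑ s, (c s).whiteCount j
  | black _ _ c => ∑ s, (c s).whiteCount j

/-- Every label of a leg and of a white vertex is used exactly once. -/
def Proper [DecidableEq L] (T : DTree P a L) : Prop :=
  (∀ x, T.legCount x = 1) ∧ ∀ j, T.whiteCount j = 1

/-- The composition in `End_A` along the tree, with `φ i` inserted at the `i`-th white vertex and
the elements of `P` at the black vertices acting on `A`, evaluated on `x`. -/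
def eval (A : P.Alg) (φ : ∀ i, MultilinearMap k (fun _ : Fin (a i) => A.carrier) A.carrier)
    (x : L → A.carrier) : DTree P a L → A.carrier
  | leg y => x y
  | white i c => φ i (fun s => (c s).eval A φ x)
  | black _ p c => A.op p (fun s => (c s).eval A φ x)

end DTree

namespace QuadraticData

variable (D : QuadraticData.{u} k)

/-- A family, indexed by all `P`-algebras `A`, of multilinear maps
`C^{m₁}(A; A) ⊗ ⋯ ⊗ C^{mₙ}(A; A) → C^M(A; A)`. -/
abbrev OpFamily {n : ℕ} (m : Fin n → ℕ) (M : ℕ) : Type (u + 1) :=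
  ∀ A : D.operad.Alg, MultilinearMap k (fun i => D.C A (m i)) (D.C A M)

/-- The family `U` is the natural operation `U_{(T, Φ)}` determined by a tree `T` and a multilinear
map `Φ`.  The multilinear map `U'` is uniquely determined by its values on tensors `φ i ⊗ q i`, at
which it is `T(φ₁, …, φₙ) ⊗ Φ(q₁, …, qₙ)`. -/
def IsOp {n : ℕ} {m : Fin n → ℕ} {M : ℕ} (T : DTree D.operad (fun i => m i + 1) (Fin (M + 1)))
    (Φ : MultilinearMap k (fun i => D.dual.operad.obj (m i + 1)) (D.dual.operad.obj (M + 1)))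
    (U : D.OpFamily m M) : Prop :=
  ∀ A : D.operad.Alg, ∃ U' : MultilinearMap k (fun i => D.TildeC A (m i)) (D.TildeC A M),
    (∀ (φ : ∀ i, D.Lin A (m i + 1)) (q : ∀ i, D.dual.operad.obj (m i + 1)),
      ∃ ψ : D.Lin A (M + 1), (∀ x, ψ x = T.eval A φ x) ∧
        U' (fun i => D.tmk A (φ i) (q i)) = D.tmk A ψ (Φ q)) ∧
    ∀ f : ∀ i, D.C A (m i), U A f = D.aver A (U' (fun i => (f i : D.TildeC A (m i))))

/-- Linear combinations of natural operations of fixed multidegree. -/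
def opSpan {n : ℕ} (m : Fin n → ℕ) (M : ℕ) : Submodule k (D.OpFamily m M) :=
  Submodule.span k {U | ∃ (T : DTree D.operad (fun i => m i + 1) (Fin (M + 1)))
    (Φ : MultilinearMap k (fun i => D.dual.operad.obj (m i + 1)) (D.dual.operad.obj (M + 1))),
    T.Proper ∧ D.IsOp T Φ U}

/-- The graded operad of all families, indexed by the `P`-algebras `A`, of homogeneous multilinear
operations on the graded vector space `C^*_P(A; A)`. -/
def familyOperad : GrOperad.{u, u + 1} k :=
  GrOperad.pi fun A : D.operad.Alg => gradedEnd k fun m => D.C A m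

/-- The value at `A` of a family of operations. -/
def familyOperad.val {D : QuadraticData.{u} k} {n : ℕ} {d : ℤ} (F : D.familyOperad.obj n d)
    (A : D.operad.Alg) :
    MultilinearMap k (fun _ : Fin n => ⨁ m, D.C A m) (⨁ m, D.C A m) :=
  (F A : homog k (fun m => D.C A m) n d).1

/-- The families of `n`-linear operations of degree `d` each multihomogeneous component of which is
a linear combination of natural operations. -/
def naturalSpan (n : ℕ) (d : ℤ) : Submodule k (D.familyOperad.obj n d) where
  carrier := {F | ∀ (m : Fin n → ℕ) (M : ℕ), (M : ℤ) = ∑ i, (m i : ℤ) + d →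
    ∃ U ∈ D.opSpan m M, ∀ (A : D.operad.Alg) (f : ∀ i, D.C A (m i)),
      familyOperad.val F A (fun i => DirectSum.lof k ℕ (fun m => D.C A m) (m i) (f i)) =
        DirectSum.lof k ℕ (fun m => D.C A m) M (U A f)}
  add_mem' := by
    intro F G hF hG m M hM
    obtain ⟨U, hU, hU'⟩ := hF m M hM
    obtain ⟨W, hW, hW'⟩ := hG m M hM
    refine ⟨U + W, add_mem hU hW, fun A f => ?_⟩
    have : familyOperad.val (F + G) A = familyOperad.val F A + familyOperad.val G A := rfl
    rw [this, add_apply, hU', hW', Pi.add_apply, add_apply, map_add]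
  zero_mem' := fun m M _ => ⟨0, zero_mem _, fun A f => by
    have : familyOperad.val (0 : D.familyOperad.obj n d) A = 0 := rfl
    rw [this, Pi.zero_apply, zero_apply, zero_apply, map_zero]⟩
  smul_mem' := by
    intro c F hF m M hM
    obtain ⟨U, hU, hU'⟩ := hF m M hM
    refine ⟨c • U, Submodule.smul_mem _ c hU, fun A f => ?_⟩
    have : familyOperad.val (c • F) A = c • familyOperad.val F A := rfl
    rw [this, smul_apply, hU', Pi.smul_apply, smul_apply, map_smul]

/-- The graded operad `B_P` of natural operations on `C^*_P(A; A)`, as a suboperad of the operad of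
all families of multilinear operations. -/
def natOperad : GrOperad.{u, u + 1} k := (D.familyOperad.subSpan D.naturalSpan).toGrOperad

/-- The inclusion of `B_P` into the operad of all families of operations. -/
def natIncl : D.natOperad.Hom D.familyOperad where
  app n d := ((D.familyOperad.subSpan D.naturalSpan).carrier n d).subtype
  map_act _ _ := rfl
  map_one := rfl
  map_circ _ _ _ _ _ := rfl

/-- The tautological action of `B_P` on the graded vector space `C^*_P(A; A)`. -/
def natAction (A : D.operad.Alg) : D.natOperad.Hom (gradedEnd k fun m => D.C A m) where
  app n d := (LinearMap.proj A) ∘ₗ (D.natIncl.app n d)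
  map_act _ _ := rfl
  map_one := rfl
  map_circ _ _ _ _ _ := rfl

/-- The suspended operad `Λ(P ⊗ P^!)`. -/
abbrev cupOperad : GrOperad.{u, u} k := (D.operad.tensor D.dual.operad).susp

/-- For `t ∈ Λ(P ⊗ P^!)(n)` and cochains `f₁, …, fₙ`, the element `Λ(α ⊗ id)(t)(ι f₁, …, ι fₙ)`,
the composition being that of `Λ(End_A ⊗ P^!)`. -/
def cupTilde (A : D.operad.Alg) {n : ℕ} {d : ℤ} (t : D.cupOperad.obj n d) {m : Fin n → ℕ}
    (f : ∀ i, D.C A (m i)) {M : ℕ} (hM : M + 1 = ∑ i, (m i + 1)) : D.TildeC A M :=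
  ((D.endTensor A).susp.gamma ((A.α.tensor (Operad.Hom.id D.dual.operad)).susp.app n d t)
    (fun i => D.tildeUp A (f i : D.TildeC A (m i))) hM
    (rfl : _ = d + ∑ i, ((m i : ℕ) : ℤ)) : (D.endTensor A).suspPiece (M + 1) _).1

end QuadraticData

end Natural

end NatOps

end

/-! For every graded operad `O`, the coinvariants of the spaces `O(n)` under the symmetric groups,
summed over `n`, form an `O`-algebra, the free one on a single generator of degree 0: `t` sends the
classes of `y₁, …, yₙ` to the class of `γ(t; y₁, …, yₙ)`. This is well defined because composition
is equivariant, and its Koszul signs are those of `O`. In characteristic zero averaging identifies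
coinvariants with invariants. For `O = Λ(End_A ⊗ P^!)` the resulting graded space is `C^*_P(A; A)`:
arity `m + 1` lives in degree `m`, and arity 0 vanishes because `P^!(0) = 0`. Pulling this algebra
structure back along `Λ(α ⊗ id)` gives `cup`.

The algebra structure is constructed once, for an abstract realization of the orbits
(`OrbitSpaces`). The laws are checked in a calculus of successive insertions, `ins`: a permutation
acting on the outer element moves the positions (`ins_act`), an inserted element matters only modulo
the symmetric group (`ins_cell_congr`), reordering insertions costs a Koszul sign (`ins_perm`), and
composites associate (`ins_circ`). They give `OrbitSpaces.op_act` and `OrbitSpaces.op_circ`.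

Values of `cup` are natural operations: `p ⊗ q` in arity at least 2 is `U_{(T, Φ)}`, where `T` is a
black root decorated by `p` carrying `n` white corollas, and `Φ` is a sign times the composition
`γ(q; -)` of `P^!` (`cupMul_tmk`, `isOp_of_eval`). In arity 1 a black vertex is not allowed, but
`P(1)` is spanned by the unit, so a single white corolla suffices.

For injectivity, `cup(t)` is applied to cochains `φᵢ ⊗ 1` of degree 0 and the result is evaluated at
vectors `x₀, …, x_r` with `φᵢ(x_j) = δ_{ij} xᵢ`. Every nontrivial permutation in the average then
contributes zero, and what remains is `t / (r+1)!` with its `P`-factor evaluated at the `xᵢ`. It is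
recovered when some `P`-algebra has vectors for which `p ↦ p(x₀, …, x_r)` has a linear left inverse
(`exists_faithful`). Such an algebra comes from the same orbit construction applied to `End_B ⊗ P`
with `B = k^{r+1}`, on which `P` acts through `p ↦ mult ⊗ p`. -/

noncomputable section

namespace NatOps

open scoped TensorProduct DirectSum

/-! ### Multilinearity of the full composition `γ`. -/

section GammaLinear

variable {k : Type u} [Field k] (O : GrOperad.{u, v} k)

theorem GrOperad.gammaAux_succ {r N s L : ℕ} {d g : ℤ} (t : O.obj N d) (hN : N = s + (r + 1))
    (a : Fin (r + 1) → ℕ) (e : Fin (r + 1) → ℤ) (f : ∀ i, O.obj (a i) (e i))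
    (hL : L = s + ∑ i, a i) (hg : g = d + ∑ i, e i) :
    O.gammaAux (r + 1) t hN a e f hL hg =
      O.gammaAux r (N := s + a 0 + r) (s := s + a 0)
        (O.circ (by omega) rfl (⟨s, by omega⟩ : Fin N) t (f 0)) rfl
        (fun i => a i.succ) (fun i => e i.succ) (fun i => f i.succ)
        (by rw [hL, Fin.sum_univ_succ]; omega) (by rw [hg, Fin.sum_univ_succ]; ring) := rfl

theorem GrOperad.gammaAux_zero {N s L : ℕ} {d g : ℤ} (t : O.obj N d) (hN : N = s + 0)
    (a : Fin 0 → ℕ) (e : Fin 0 → ℤ) (f : ∀ i, O.obj (a i) (e i))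
    (hL : L = s + ∑ i, a i) (hg : g = d + ∑ i, e i) :
    HEq (O.gammaAux 0 t hN a e f hL hg) t := cast_heq _ _

theorem GrOperad.gammaAux_add (r : ℕ) {N s L : ℕ} {d g : ℤ} (t t' : O.obj N d) (hN : N = s + r)
    (a : Fin r → ℕ) (e : Fin r → ℤ) (f : ∀ i, O.obj (a i) (e i))
    (hL : L = s + ∑ i, a i) (hg : g = d + ∑ i, e i) :
    O.gammaAux r (t + t') hN a e f hL hg =
      O.gammaAux r t hN a e f hL hg + O.gammaAux r t' hN a e f hL hg := by
  induction r generalizing N s d with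
  | zero =>
    obtain rfl : L = N := by simp [hL, hN]
    -- Once the arities and degrees are identified, the cast in the base case of `gammaAux` is the
    -- identity.
    obtain rfl : g = d := by simp [hg]
    rfl
  | succ r ih =>
    simp only [gammaAux_succ, map_add, LinearMap.add_apply]
    exact ih _ _ _ _ _ _ _ _

theorem GrOperad.gammaAux_smul (r : ℕ) {N s L : ℕ} {d g : ℤ} (c : k) (t : O.obj N d)
    (hN : N = s + r) (a : Fin r → ℕ) (e : Fin r → ℤ) (f : ∀ i, O.obj (a i) (e i))
    (hL : L = s + ∑ i, a i) (hg : g = d + ∑ i, e i) :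
    O.gammaAux r (c • t) hN a e f hL hg = c • O.gammaAux r t hN a e f hL hg := by
  induction r generalizing N s d with
  | zero =>
    obtain rfl : L = N := by simp [hL, hN]
    obtain rfl : g = d := by simp [hg]
    rfl
  | succ r ih =>
    simp only [gammaAux_succ, map_smul, LinearMap.smul_apply]
    exact ih _ _ _ _ _ _ _

theorem GrOperad.gammaAux_update_add (r : ℕ) {N s L : ℕ} {d g : ℤ} (t : O.obj N d) (hN : N = s + r)
    (a : Fin r → ℕ) (e : Fin r → ℤ) (f : ∀ i, O.obj (a i) (e i))
    (hL : L = s + ∑ i, a i) (hg : g = d + ∑ i, e i) (i : Fin r) (x y : O.obj (a i) (e i)) :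
    O.gammaAux r t hN a e (Function.update f i (x + y)) hL hg =
      O.gammaAux r t hN a e (Function.update f i x) hL hg +
        O.gammaAux r t hN a e (Function.update f i y) hL hg := by
  induction r generalizing N s d with
  | zero => exact i.elim0
  | succ r ih =>
    simp only [gammaAux_succ]
    have hz : ∀ z : O.obj (a 0) (e 0), (fun j : Fin r => Function.update f 0 z j.succ) =
      fun j : Fin r => f j.succ := fun z => Fin.tail_update_zero f z
    have hs : ∀ (i : Fin r) (z : O.obj (a i.succ) (e i.succ)),
      (fun j : Fin r => Function.update f i.succ z j.succ) =
        Function.update (fun j : Fin r => f j.succ) i z := fun i z => Fin.tail_update_succ f i z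
    induction i using Fin.cases with
    | zero => simp only [hz, Function.update_self, map_add, gammaAux_add]
    | succ i =>
      simp only [hs, Function.update_of_ne (Fin.succ_ne_zero i).symm]
      exact ih _ _ _ _ _ _ _ _ _ _

theorem GrOperad.gammaAux_update_smul (r : ℕ) {N s L : ℕ} {d g : ℤ} (t : O.obj N d)
    (hN : N = s + r) (a : Fin r → ℕ) (e : Fin r → ℤ) (f : ∀ i, O.obj (a i) (e i))
    (hL : L = s + ∑ i, a i) (hg : g = d + ∑ i, e i) (i : Fin r) (c : k) (x : O.obj (a i) (e i)) :
    O.gammaAux r t hN a e (Function.update f i (c • x)) hL hg =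
      c • O.gammaAux r t hN a e (Function.update f i x) hL hg := by
  induction r generalizing N s d with
  | zero => exact i.elim0
  | succ r ih =>
    simp only [gammaAux_succ]
    have hz : ∀ z : O.obj (a 0) (e 0), (fun j : Fin r => Function.update f 0 z j.succ) =
      fun j : Fin r => f j.succ := fun z => Fin.tail_update_zero f z
    have hs : ∀ (i : Fin r) (z : O.obj (a i.succ) (e i.succ)),
      (fun j : Fin r => Function.update f i.succ z j.succ) =
        Function.update (fun j : Fin r => f j.succ) i z := fun i z => Fin.tail_update_succ f i z
    induction i using Fin.cases with
    | zero => simp only [hz, Function.update_self, map_smul, gammaAux_smul]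
    | succ i =>
      simp only [hs, Function.update_of_ne (Fin.succ_ne_zero i).symm]
      exact ih _ _ _ _ _ _ _ _ _

/-- The composition `γ(t; f₁, …, fₙ)` as a multilinear map of `f₁, …, fₙ`, linear in `t`. -/
def GrOperad.gammaMul {n L : ℕ} {d g : ℤ} {a : Fin n → ℕ} {e : Fin n → ℤ} (hL : L = ∑ i, a i)
    (hg : g = d + ∑ i, e i) :
    O.obj n d →ₗ[k] MultilinearMap k (fun i => O.obj (a i) (e i)) (O.obj L g) where
  toFun t :=
    { toFun := fun f => O.gamma t f hL hg
      map_update_add' := fun {hd} f i x y => by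
        rw [Subsingleton.elim hd (instDecidableEqFin n)]
        exact O.gammaAux_update_add n t _ a e f _ hg i x y
      map_update_smul' := fun {hd} f i c x => by
        rw [Subsingleton.elim hd (instDecidableEqFin n)]
        exact O.gammaAux_update_smul n t _ a e f _ hg i c x }
  map_add' t t' := MultilinearMap.ext fun f => O.gammaAux_add n t t' _ a e f _ hg
  map_smul' c t := MultilinearMap.ext fun f => O.gammaAux_smul n c t _ a e f _ hg

end GammaLinear

/-! ### Successive insertion of elements into the inputs of an operad element. -/

section Insertion

/-- The position of the `j`-th input of `p` in `p ∘ᵢ q`, for `q` of arity `a`. -/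
def shiftPos (i a j : ℕ) : ℕ := if j < i then j else j + a - 1

theorem outer_val {m n l : ℕ} (h : l + 1 = m + n) (i j : Fin m) (hj : j ≠ i) :
    (outer h i j hj : ℕ) = shiftPos i n j := by
  unfold shiftPos
  rcases lt_or_gt_of_ne hj with e | e
  · rw [outer_val_lt h e, if_pos (Fin.lt_def.1 e)]
  · rw [outer_val_gt h e, if_neg (not_lt.2 (Fin.lt_def.1 e).le)]

variable {k : Type u} [Field k]

/-- An element of a graded operad to be inserted into the input number `pos`. -/
structure Cell (O : GrOperad.{u, v} k) where
  pos : ℕ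
  ar : ℕ
  deg : ℤ
  el : O.obj ar deg

variable {O : GrOperad.{u, v} k}

/-- Renumbering the position of a cell. -/
def Cell.mapPos (φ : ℕ → ℕ) (c : Cell O) : Cell O := { c with pos := φ c.pos }

/-- Renumbering the positions of the cells after the insertion of `c`. -/
def Cell.shift (c : Cell O) : Cell O → Cell O := Cell.mapPos (shiftPos c.pos c.ar)

variable {T : Type w} [AddCommGroup T] [Module k T] (Θ : ∀ N d, O.obj N d →ₗ[k] T)

/-- Insert the cells of a list, one after another, and apply `Θ` to the result. -/
def ins {N : ℕ} {d : ℤ} (x : O.obj N d) : List (Cell O) → T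
  | [] => Θ N d x
  | c :: cs => if h : c.pos < N then
      ins (O.circ (l := N + c.ar - 1) (g := d + c.deg) (by omega) rfl ⟨c.pos, h⟩ x c.el)
        -- Positions refer to the inputs of the current element, so the remaining cells are
        -- renumbered after each insertion.
        (cs.map c.shift)
    -- A junk value, never reached when the list is `Valid`.
    else 0
termination_by cs => cs.length

theorem ins_nil {N : ℕ} {d : ℤ} (x : O.obj N d) : ins Θ x [] = Θ N d x := by rw [ins]

/-- Arity and degree of the composite are free here, up to propositional equality. Since `ins` takes
values in the fixed space `T`, composites whose arities agree only propositionally can be compared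
without casts; this is the purpose of `Θ`. -/
theorem ins_cons {N l : ℕ} {d g : ℤ} (x : O.obj N d) (c : Cell O) (cs : List (Cell O))
    (hl : l + 1 = N + c.ar) (hg : g = d + c.deg) (i : Fin N) (hi : (i : ℕ) = c.pos) :
    ins Θ x (c :: cs) = ins Θ (O.circ hl hg i x c.el) (cs.map c.shift) := by
  have h : c.pos < N := hi ▸ i.isLt
  obtain rfl : l = N + c.ar - 1 := by omega
  subst hg
  obtain rfl : i = ⟨c.pos, h⟩ := Fin.ext hi
  rw [ins, dif_pos h]

theorem ins_add {N : ℕ} {d : ℤ} (x y : O.obj N d) (cs : List (Cell O)) :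
    ins Θ (x + y) cs = ins Θ x cs + ins Θ y cs := by
  -- The recursive call is on a renumbered tail, so the induction is on the length of the list.
  induction hn : cs.length generalizing N d cs with
  | zero => obtain rfl := List.length_eq_zero_iff.1 hn; simp [ins_nil]
  | succ n ih =>
    obtain ⟨c, cs, rfl⟩ := List.exists_cons_of_length_eq_add_one hn
    simp only [ins]
    split_ifs with h
    · rw [map_add, LinearMap.add_apply]
      exact ih _ _ _ (by simpa using hn)
    · simp

theorem ins_smul {N : ℕ} {d : ℤ} (a : k) (x : O.obj N d) (cs : List (Cell O)) :
    ins Θ (a • x) cs = a • ins Θ x cs := by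
  induction hn : cs.length generalizing N d cs with
  | zero => obtain rfl := List.length_eq_zero_iff.1 hn; simp [ins_nil]
  | succ n ih =>
    obtain ⟨c, cs, rfl⟩ := List.exists_cons_of_length_eq_add_one hn
    simp only [ins]
    split_ifs with h
    · rw [map_smul, LinearMap.smul_apply]
      exact ih _ _ (by simpa using hn)
    · simp

/-- The cells of a list sit at distinct inputs of an element of arity `N`. -/
def Valid (N : ℕ) (cs : List (Cell O)) : Prop :=
  (cs.map Cell.pos).Nodup ∧ ∀ c ∈ cs, c.pos < N

theorem shiftPos_inj {i a j j' : ℕ} (hj : j ≠ i) (hj' : j' ≠ i) (h : shiftPos i a j = shiftPos i a j') :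
    j = j' := by
  unfold shiftPos at h; split_ifs at h <;> omega

/-- The renumbering `shiftPos` is injective away from the position just filled, which the other
cells avoid. -/
theorem Valid.shift {N l : ℕ} {c : Cell O} {cs : List (Cell O)} (h : Valid N (c :: cs))
    (hl : l + 1 = N + c.ar) : Valid l (cs.map c.shift) := by
  obtain ⟨h1, h2⟩ := h
  rw [List.map_cons, List.nodup_cons] at h1
  have hne : ∀ c' ∈ cs, c'.pos ≠ c.pos := fun c' hc' e =>
    h1.1 (e ▸ List.mem_map_of_mem hc')
  constructor
  · rw [List.map_map]
    have : Cell.pos ∘ c.shift = shiftPos c.pos c.ar ∘ (Cell.pos : Cell O → ℕ) := rfl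
    rw [this, ← List.map_map]
    refine List.Nodup.map_on ?_ h1.2
    intro x hx y hy e
    obtain ⟨c1, hc1, rfl⟩ := List.mem_map.1 hx
    obtain ⟨c2, hc2, rfl⟩ := List.mem_map.1 hy
    exact shiftPos_inj (hne _ hc1) (hne _ hc2) e
  · intro c' hc'
    obtain ⟨c1, hc1, rfl⟩ := List.mem_map.1 hc'
    have a1 := hne _ hc1
    have a2 := h2 c1 (List.mem_cons_of_mem _ hc1)
    have a3 := h2 c List.mem_cons_self
    change shiftPos c.pos c.ar c1.pos < l
    unfold shiftPos; split_ifs <;> omega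

end Insertion

/-! ### Equivariance, commutation and associativity of insertions. -/

section InsertionLaws

/-- The inputs of `p ∘ᵢ q` are those of `q` and those of `p` other than the `i`-th. -/
def circEquiv {m n l : ℕ} (h : l + 1 = m + n) (i : Fin m) : Fin n ⊕ {j : Fin m // j ≠ i} ≃ Fin l :=
  Equiv.ofBijective (Sum.elim (inner h i) (fun j => outer h i j.1 j.2)) <| by
    constructor
    · rintro (s | j) (s' | j') e
      · exact congrArg _ (inner_inj h i e)
      · exact absurd e.symm (outer_ne_inner h i j'.1 j'.2 s)
      · exact absurd e (outer_ne_inner h i j.1 j.2 s')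
      · exact congrArg _ (Subtype.ext (outer_inj h i j.2 j'.2 e))
    · intro t
      rcases inner_or_outer h i t with ⟨s, rfl⟩ | ⟨j, hj, rfl⟩
      · exact ⟨Sum.inl s, rfl⟩
      · exact ⟨Sum.inr ⟨j, hj⟩, rfl⟩

/-- Supplies the block permutation that the axiom `circ_act` takes as data: `τ` on the inner inputs
and `σ` on the outer ones, transported through `circEquiv`. -/
theorem exists_perm_circ {m n l : ℕ} (h : l + 1 = m + n) (i : Fin m) (σ : Equiv.Perm (Fin m))
    (τ : Equiv.Perm (Fin n)) : ∃ ρ : Equiv.Perm (Fin l),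
      (∀ s, ρ (inner h i s) = inner h (σ i) (τ s)) ∧
      ∀ j (hj : j ≠ i),
        ρ (outer h i j hj) = outer h (σ i) (σ j) (fun e => hj (σ.injective e)) := by
  refine ⟨(circEquiv h i).symm.trans ((Equiv.sumCongr τ
    (σ.subtypeEquiv
      (p := fun j => j ≠ i) (q := fun j => j ≠ σ i) (fun j => (σ.injective.ne_iff).symm))).trans (circEquiv h (σ i))),
    fun s => ?_, fun j hj => ?_⟩
  · have : inner h i s = circEquiv h i (Sum.inl s) := rfl
    rw [this]
    simp only [Equiv.trans_apply, Equiv.symm_apply_apply]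
    rfl
  · have : outer h i j hj = circEquiv h i (Sum.inr ⟨j, hj⟩) := rfl
    rw [this]
    simp only [Equiv.trans_apply, Equiv.symm_apply_apply]
    rfl

theorem shiftPos_of_le {i j : ℕ} (a : ℕ) (h : i ≤ j) : shiftPos i a j = j + a - 1 :=
  if_neg (not_lt.2 h)

/-- The action of a permutation on positions. -/
def permPos {N : ℕ} (σ : Equiv.Perm (Fin N)) (j : ℕ) : ℕ := if h : j < N then σ ⟨j, h⟩ else j

theorem permPos_val {N : ℕ} (σ : Equiv.Perm (Fin N)) (j : Fin N) : permPos σ j = σ j := by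
  simp [permPos]

theorem permPos_one {N : ℕ} (j : ℕ) : permPos (1 : Equiv.Perm (Fin N)) j = j := by
  simp [permPos]

theorem permPos_shiftPos {m n l : ℕ} (h : l + 1 = m + n) (i : Fin m) (σ : Equiv.Perm (Fin m))
    (ρ : Equiv.Perm (Fin l))
    (hρ : ∀ j (hj : j ≠ i),
        ρ (outer h i j hj) = outer h (σ i) (σ j) (fun e => hj (σ.injective e)))
    {p : ℕ} (hp : p < m) (hpi : p ≠ i) :
    permPos ρ (shiftPos i n p) = shiftPos (σ i) n (permPos σ p) := by
  have hj : (⟨p, hp⟩ : Fin m) ≠ i := fun e => hpi (congrArg Fin.val e)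
  have := hρ ⟨p, hp⟩ hj
  have h1 := outer_val h i ⟨p, hp⟩ hj
  have h2 := outer_val h (σ i) (σ ⟨p, hp⟩) (fun e => hj (σ.injective e))
  have h3 : permPos σ p = σ ⟨p, hp⟩ := permPos_val σ ⟨p, hp⟩
  rw [h3, ← h2, ← this, ← permPos_val]
  exact congrArg _ h1.symm

variable {k : Type u} [Field k] {O : GrOperad.{u, v} k}
variable {T : Type w} [AddCommGroup T] [Module k T] (Θ : ∀ N d, O.obj N d →ₗ[k] T)

theorem Cell.mapPos_congr {φ ψ : ℕ → ℕ} {c : Cell O} (h : φ c.pos = ψ c.pos) :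
    c.mapPos φ = c.mapPos ψ := by simp only [Cell.mapPos, h]

theorem Cell.mapPos_mapPos (φ ψ : ℕ → ℕ) (c : Cell O) :
    (c.mapPos φ).mapPos ψ = c.mapPos (fun j => ψ (φ j)) := rfl

theorem Valid.ne {N : ℕ} {c : Cell O} {cs : List (Cell O)} (h : Valid N (c :: cs)) :
    ∀ c' ∈ cs, c'.pos ≠ c.pos := fun c' hc' e => by
  have h1 := h.1
  rw [List.map_cons, List.nodup_cons] at h1
  exact h1.1 (e ▸ List.mem_map_of_mem hc')

theorem ins_mk_cons {N l a p : ℕ} {d g e : ℤ} (x : O.obj N d) (y : O.obj a e) (cs : List (Cell O))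
    (hl : l + 1 = N + a) (hg : g = d + e) (i : Fin N) (hi : (i : ℕ) = p) :
    ins Θ x (⟨p, a, e, y⟩ :: cs) =
      ins Θ (O.circ hl hg i x y) (cs.map (Cell.mapPos (shiftPos p a))) :=
  ins_cons Θ x ⟨p, a, e, y⟩ cs hl hg i hi

/-- Each insertion turns `σ` into a block permutation `ρ` acting on the composite; after the last
insertion the invariance of `Θ` absorbs it. Only the positions of the cells have changed. -/
theorem ins_act (hΘ : ∀ N d (σ : Equiv.Perm (Fin N)) (x : O.obj N d), Θ N d (O.act σ x) = Θ N d x)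
    {N : ℕ} {d : ℤ} (σ : Equiv.Perm (Fin N)) (x : O.obj N d) (cs : List (Cell O))
    (hv : Valid N cs) :
    ins Θ (O.act σ x) cs = ins Θ x (cs.map (Cell.mapPos (permPos σ))) := by
  induction hn : cs.length generalizing N d cs with
  | zero => obtain rfl := List.length_eq_zero_iff.1 hn; simp [ins_nil, hΘ]
  | succ n ih =>
    obtain ⟨c, cs, rfl⟩ := List.exists_cons_of_length_eq_add_one hn
    have hc : c.pos < N := hv.2 c List.mem_cons_self
    have hl : (N + c.ar - 1) + 1 = N + c.ar := by omega
    -- The inner permutation is trivial because the inserted element is left alone.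
    obtain ⟨ρ, h1, h2⟩ := exists_perm_circ hl ⟨c.pos, hc⟩ σ 1
    have hca := O.circ_act hl (rfl : d + c.deg = _) ⟨c.pos, hc⟩ σ 1 ρ h1 h2 x c.el
    rw [O.act_one] at hca
    rw [ins_cons Θ _ c cs hl rfl ⟨c.pos, hc⟩ rfl, hca, ih _ _ _ (hv.shift hl) (by simpa using hn),
      List.map_cons, ins_cons Θ x (c.mapPos (permPos σ)) _ hl rfl (σ ⟨c.pos, hc⟩)
        (permPos_val σ ⟨c.pos, hc⟩).symm, List.map_map, List.map_map]
    refine congrArg _ (List.map_congr_left fun c' hc' => ?_)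
    have e := permPos_shiftPos hl ⟨c.pos, hc⟩ σ ρ h2 (hv.2 c' (List.mem_cons_of_mem _ hc'))
      (hv.ne c' hc')
    change (c'.mapPos _).mapPos _ = (c'.mapPos _).mapPos _
    rw [Cell.mapPos_mapPos, Cell.mapPos_mapPos]
    apply Cell.mapPos_congr
    rw [← permPos_val σ] at e
    exact e

theorem Valid.map_shift {N l : ℕ} {c : Cell O} {L₁ L₂ : List (Cell O)} {p a : ℕ} {e : ℤ}
    {y : O.obj a e} (h : Valid N (c :: (L₁ ++ ⟨p, a, e, y⟩ :: L₂))) (hl : l + 1 = N + c.ar) :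
    Valid l (L₁.map c.shift ++ ⟨shiftPos c.pos c.ar p, a, e, y⟩ :: L₂.map c.shift) := by
  have := h.shift hl
  rwa [List.map_append, List.map_cons] at this

/-- Acting by `τ` on an inserted element is acting on the composite by a permutation that fixes all
outer inputs. By `ins_act` this does not move the remaining cells. -/
theorem ins_cell_act
    (hΘ : ∀ N d (σ : Equiv.Perm (Fin N)) (x : O.obj N d), Θ N d (O.act σ x) = Θ N d x)
    {N : ℕ} {d : ℤ} (x : O.obj N d) (L₁ L₂ : List (Cell O)) {p a : ℕ} {e : ℤ}
    (τ : Equiv.Perm (Fin a)) (y : O.obj a e) (hv : Valid N (L₁ ++ ⟨p, a, e, y⟩ :: L₂)) :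
    ins Θ x (L₁ ++ ⟨p, a, e, O.act τ y⟩ :: L₂) = ins Θ x (L₁ ++ ⟨p, a, e, y⟩ :: L₂) := by
  induction hn : L₁.length generalizing N d p L₁ L₂ with
  | zero =>
    obtain rfl := List.length_eq_zero_iff.1 hn
    rw [List.nil_append] at hv
    have hc : p < N := hv.2 _ List.mem_cons_self
    have hl : (N + a - 1) + 1 = N + a := by omega
    -- With trivial outer permutation, `ρ` moves only the inputs of the inserted element, none of
    -- which carries a cell.
    obtain ⟨ρ, h1, h2⟩ := exists_perm_circ hl ⟨p, hc⟩ 1 τ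
    have hca := O.circ_act hl (rfl : d + e = _) ⟨p, hc⟩ 1 τ ρ h1 h2 x y
    rw [O.act_one] at hca
    have hv' : Valid (N + a - 1) (L₂.map (Cell.mapPos (shiftPos p a))) := hv.shift hl
    rw [List.nil_append, List.nil_append, ins_mk_cons Θ x _ L₂ hl rfl ⟨p, hc⟩ rfl,
      ins_mk_cons Θ x y L₂ hl rfl ⟨p, hc⟩ rfl, hca, ins_act Θ hΘ _ _ _ hv', List.map_map]
    refine congrArg _ (List.map_congr_left fun c' hc' => ?_)
    have e := permPos_shiftPos hl ⟨p, hc⟩ 1 ρ h2 (hv.2 c' (List.mem_cons_of_mem _ hc'))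
      (hv.ne c' hc')
    change (c'.mapPos _).mapPos _ = c'.mapPos _
    rw [Cell.mapPos_mapPos]
    apply Cell.mapPos_congr
    rw [permPos_one] at e
    exact e
  | succ n ih =>
    obtain ⟨c, L₁, rfl⟩ := List.exists_cons_of_length_eq_add_one hn
    rw [List.cons_append] at hv
    have hc : c.pos < N := hv.2 c List.mem_cons_self
    have hl : (N + c.ar - 1) + 1 = N + c.ar := by omega
    rw [List.cons_append, List.cons_append, ins_cons Θ x c _ hl rfl ⟨c.pos, hc⟩ rfl,
      ins_cons Θ x c _ hl rfl ⟨c.pos, hc⟩ rfl, List.map_append, List.map_append, List.map_cons,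
      List.map_cons]
    exact ih _ _ _ (hv.map_shift hl) (by simpa using hn)

theorem ins_cell_add {N : ℕ} {d : ℤ} (x : O.obj N d) (L₁ L₂ : List (Cell O)) {p a : ℕ} {e : ℤ}
    (y y' : O.obj a e) : ins Θ x (L₁ ++ ⟨p, a, e, y + y'⟩ :: L₂) =
      ins Θ x (L₁ ++ ⟨p, a, e, y⟩ :: L₂) + ins Θ x (L₁ ++ ⟨p, a, e, y'⟩ :: L₂) := by
  induction hn : L₁.length generalizing N d p L₁ L₂ with
  | zero =>
    obtain rfl := List.length_eq_zero_iff.1 hn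
    simp only [List.nil_append, ins]
    split_ifs
    · rw [map_add]; exact ins_add Θ _ _ _
    · simp
  | succ n ih =>
    obtain ⟨c, L₁, rfl⟩ := List.exists_cons_of_length_eq_add_one hn
    simp only [List.cons_append, ins, List.map_append, List.map_cons]
    split_ifs
    · exact ih _ _ _ (by simpa using hn)
    · simp

theorem ins_cell_smul {N : ℕ} {d : ℤ} (x : O.obj N d) (L₁ L₂ : List (Cell O)) {p a : ℕ} {e : ℤ}
    (b : k) (y : O.obj a e) : ins Θ x (L₁ ++ ⟨p, a, e, b • y⟩ :: L₂) =
      b • ins Θ x (L₁ ++ ⟨p, a, e, y⟩ :: L₂) := by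
  induction hn : L₁.length generalizing N d p L₁ L₂ with
  | zero =>
    obtain rfl := List.length_eq_zero_iff.1 hn
    simp only [List.nil_append, ins]
    split_ifs
    · rw [map_smul]; exact ins_smul Θ _ _ _
    · simp
  | succ n ih =>
    obtain ⟨c, L₁, rfl⟩ := List.exists_cons_of_length_eq_add_one hn
    simp only [List.cons_append, ins, List.map_append, List.map_cons]
    split_ifs
    · exact ih _ _ _ (by simpa using hn)
    · simp

/-- The differences of elements in the same orbit of the symmetric group span this subspace. -/
def GrOperad.orbitDiff (O : GrOperad.{u, v} k) (a : ℕ) (e : ℤ) : Submodule k (O.obj a e) :=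
  Submodule.span k {z | ∃ (σ : Equiv.Perm (Fin a)) (w : O.obj a e), z = O.act σ w - w}

theorem valid_congr {N : ℕ} {L₁ L₂ : List (Cell O)} {p a : ℕ} {e : ℤ} {y : O.obj a e}
    (hv : Valid N (L₁ ++ ⟨p, a, e, y⟩ :: L₂)) {a' : ℕ} {e' : ℤ} (y' : O.obj a' e') :
    Valid N (L₁ ++ ⟨p, a', e', y'⟩ :: L₂) := by
  obtain ⟨h1, h2⟩ := hv
  refine ⟨by simpa using h1, fun c hc => ?_⟩
  simp only [List.mem_append, List.mem_cons] at hc h2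
  rcases hc with hc | rfl | hc
  · exact h2 c (Or.inl hc)
  · exact h2 ⟨p, a, e, y⟩ (Or.inr (Or.inl rfl))
  · exact h2 c (Or.inr (Or.inr hc))

/-- This is what makes composition descend to coinvariants in an inner argument: insertion is linear
in the cell (`ins_cell_add`, `ins_cell_smul`) and kills the generators of `orbitDiff` by
`ins_cell_act`. -/
theorem ins_cell_congr
    (hΘ : ∀ N d (σ : Equiv.Perm (Fin N)) (x : O.obj N d), Θ N d (O.act σ x) = Θ N d x)
    {N : ℕ} {d : ℤ} (x : O.obj N d) (L₁ L₂ : List (Cell O)) {p a : ℕ} {e : ℤ}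
    (y y' : O.obj a e) (hv : Valid N (L₁ ++ ⟨p, a, e, y⟩ :: L₂)) (h : y - y' ∈ O.orbitDiff a e) :
    ins Θ x (L₁ ++ ⟨p, a, e, y⟩ :: L₂) = ins Θ x (L₁ ++ ⟨p, a, e, y'⟩ :: L₂) := by
  let F : O.obj a e →ₗ[k] T :=
    { toFun := fun y => ins Θ x (L₁ ++ ⟨p, a, e, y⟩ :: L₂)
      map_add' := fun y y' => ins_cell_add Θ x L₁ L₂ y y'
      map_smul' := fun b y => ins_cell_smul Θ x L₁ L₂ b y }
  have hle : O.orbitDiff a e ≤ LinearMap.ker F := by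
    refine Submodule.span_le.2 ?_
    rintro z ⟨σ, w, rfl⟩
    change F _ = 0
    rw [map_sub, sub_eq_zero]
    exact ins_cell_act Θ hΘ x L₁ L₂ σ w (valid_congr hv w)
  have := hle h
  rw [LinearMap.mem_ker, map_sub, sub_eq_zero] at this
  exact this

theorem sgn_mul_self (x : ZMod 2) : sgn k x * sgn k x = 1 := by
  rw [← sgn_add, CharTwo.add_self_eq_zero, sgn_zero]

/-- The axiom `circ_comm` for two different inputs, together with the fact that the order of the two
insertions does not affect the final numbering of the other cells. -/
theorem ins_swap {N : ℕ} {d : ℤ} (x : O.obj N d) (c c' : Cell O) (cs : List (Cell O))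
    (hv : Valid N (c :: c' :: cs)) :
    ins Θ x (c :: c' :: cs) = sgn k (c.deg * c'.deg) • ins Θ x (c' :: c :: cs) := by
  -- `circ_comm` orders its two inputs; the opposite order follows because the sign is its own
  -- inverse.
  have key : ∀ (c c' : Cell O), Valid N (c :: c' :: cs) → Valid N (c' :: c :: cs) →
      c.pos < c'.pos →
      ins Θ x (c :: c' :: cs) = sgn k (c.deg * c'.deg) • ins Θ x (c' :: c :: cs) := by
    intro c c' hv hv' hlt
    have hc : c.pos < N := hv.2 c (by simp)
    have hc' : c'.pos < N := hv.2 c' (by simp)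
    have h₁ : (N + c.ar - 1) + 1 = N + c.ar := by omega
    have h₂ : (N + c.ar + c'.ar - 2) + 1 = (N + c.ar - 1) + c'.ar := by omega
    have h₃ : (N + c'.ar - 1) + 1 = N + c'.ar := by omega
    have h₄ : (N + c.ar + c'.ar - 2) + 1 = (N + c'.ar - 1) + c.ar := by omega
    have hij : (⟨c.pos, hc⟩ : Fin N) < ⟨c'.pos, hc'⟩ := hlt
    have hG : d + c.deg + c'.deg = d + c'.deg + c.deg := by ring
    have hcc := O.circ_comm h₁ h₂ h₃ h₄ (rfl : d + c.deg = _)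
      (rfl : d + c.deg + c'.deg = _) (rfl : d + c'.deg = _) hG ⟨c.pos, hc⟩ ⟨c'.pos, hc'⟩ hij
      x c.el c'.el
    have o1 := outer_val h₁ ⟨c.pos, hc⟩ ⟨c'.pos, hc'⟩ hij.ne'
    have o2 := outer_val h₃ ⟨c'.pos, hc'⟩ ⟨c.pos, hc⟩ hij.ne
    rw [ins_cons Θ x c _ h₁ rfl ⟨c.pos, hc⟩ rfl, List.map_cons,
      ins_cons Θ _ (c.shift c') _ h₂ rfl _ o1]
    rw [ins_cons Θ x c' _ h₃ rfl ⟨c'.pos, hc'⟩ rfl, List.map_cons,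
      ins_cons Θ _ (c'.shift c) _ h₄ hG _ o2]
    rw [← ins_smul]
    have e1 : (cs.map c.shift).map (c.shift c').shift = (cs.map c'.shift).map (c'.shift c).shift := by
      rw [List.map_map, List.map_map]
      refine List.map_congr_left fun b hb => ?_
      have n1 := hv.ne b (List.mem_cons_of_mem _ hb)
      have n2 := hv'.ne b (List.mem_cons_of_mem _ hb)
      change (b.mapPos _).mapPos _ = (b.mapPos _).mapPos _
      rw [Cell.mapPos_mapPos, Cell.mapPos_mapPos]
      apply Cell.mapPos_congr
      change shiftPos (shiftPos c.pos c.ar c'.pos) c'.ar (shiftPos c.pos c.ar b.pos) =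
        shiftPos (shiftPos c'.pos c'.ar c.pos) c.ar (shiftPos c'.pos c'.ar b.pos)
      unfold shiftPos
      split_ifs <;> omega
    rw [e1]
    exact congrArg (fun y => ins Θ y _) hcc
  have hv' : Valid N (c' :: c :: cs) := by
    obtain ⟨h1, h2⟩ := hv
    refine ⟨?_, fun b hb => h2 b ?_⟩
    · simp only [List.map_cons] at h1 ⊢
      exact (List.Perm.swap _ _ _).nodup_iff.1 h1
    · simp only [List.mem_cons] at hb ⊢; tauto
  have hne : c'.pos ≠ c.pos := hv.ne c' List.mem_cons_self
  rcases lt_or_gt_of_ne hne with h | h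
  · rw [key c' c hv' hv h, smul_smul, mul_comm (c'.deg : ZMod 2), sgn_mul_self, one_smul]
  · exact key c c' hv hv' h

/-- An adjacent transposition has exactly one inversion. -/
theorem koszul_swap {r : ℕ} (j : Fin r) (p : Fin (r + 1) → ZMod 2) :
    koszul (Equiv.swap j.castSucc j.succ) p = p j.castSucc * p j.succ := by
  have h : ∀ i i' : Fin (r + 1), (i < i' ∧ Equiv.swap j.castSucc j.succ i' <
      Equiv.swap j.castSucc j.succ i) ↔ (i = j.castSucc ∧ i' = j.succ) := by
    intro i i'
    simp only [Equiv.swap_apply_def, Fin.ext_iff, Fin.lt_def]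
    split_ifs <;> simp only [Fin.val_castSucc, Fin.val_succ] at * <;> omega
  unfold koszul
  simp only [h]
  rw [Finset.sum_eq_single j.castSucc, Finset.sum_eq_single j.succ]
  · simp
  · intro b _ hb; simp [hb]
  · simp
  · intro b _ hb; simp [hb]
  · simp

theorem Valid.ofFn_comp {N r : ℕ} {G : Fin r → Cell O} (hv : Valid N (List.ofFn G))
    (σ : Equiv.Perm (Fin r)) : Valid N (List.ofFn (G ∘ σ)) := by
  obtain ⟨h1, h2⟩ := hv
  rw [List.map_ofFn, List.nodup_ofFn] at h1
  refine ⟨?_, fun c hc => h2 c ?_⟩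
  · rw [List.map_ofFn, List.nodup_ofFn]
    exact h1.comp σ.injective
  · rw [List.mem_ofFn] at hc ⊢
    obtain ⟨i, rfl⟩ := hc
    exact ⟨σ i, rfl⟩

/-- Adjacent transpositions are handled by `ins_swap`, and the Koszul signs multiply along a product
by `koszul_mul`. The cells keep their positions; only the order of insertion changes. -/
theorem ins_perm {N r : ℕ} {d : ℤ} (x : O.obj N d) (G : Fin r → Cell O)
    (hv : Valid N (List.ofFn G)) (σ : Equiv.Perm (Fin r)) :
    ins Θ x (List.ofFn (G ∘ σ)) =
      sgn k (koszul σ (fun i => ((G (σ i)).deg : ZMod 2))) • ins Θ x (List.ofFn G) := by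
  -- Generalized over `x` and `G`: a transposition further down the list is reached by performing
  -- the first insertion, which changes both but preserves the degrees of the cells.
  have hadj : ∀ (r : ℕ) (j : Fin r) {N : ℕ} {d : ℤ} (x : O.obj N d) (G : Fin (r + 1) → Cell O)
      (hv : Valid N (List.ofFn G)),
      ins Θ x (List.ofFn (G ∘ Equiv.swap j.castSucc j.succ)) =
        sgn k (((G j.castSucc).deg : ZMod 2) * (G j.succ).deg) • ins Θ x (List.ofFn G) := by
    intro r
    induction r with
    | zero => exact fun j => j.elim0
    | succ r ih =>
      intro j N d x G hv
      induction j using Fin.cases with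
      | zero =>
        have e : List.ofFn (G ∘ Equiv.swap (0 : Fin (r + 1)).castSucc (0 : Fin (r + 1)).succ) =
            G 1 :: G 0 :: List.ofFn (fun i : Fin r => G i.succ.succ) := by
          have h0 : Equiv.swap (0 : Fin (r + 1)).castSucc (0 : Fin (r + 1)).succ 0 = 1 :=
            Equiv.swap_apply_left _ _
          have h1 : Equiv.swap (0 : Fin (r + 1)).castSucc (0 : Fin (r + 1)).succ (Fin.succ 0) = 0 :=
            Equiv.swap_apply_right _ _
          have h2 : ∀ i : Fin r, Equiv.swap (0 : Fin (r + 1)).castSucc (0 : Fin (r + 1)).succ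
              i.succ.succ = i.succ.succ := fun i =>
            Equiv.swap_apply_of_ne_of_ne (by simp [Fin.ext_iff]) (by simp [Fin.ext_iff])
          rw [List.ofFn_succ, List.ofFn_succ]
          simp only [Function.comp_apply, h0, h1, h2]
        have e' : List.ofFn G = G 0 :: G 1 :: List.ofFn (fun i : Fin r => G i.succ.succ) := by
          rw [List.ofFn_succ, List.ofFn_succ]; rfl
        rw [e'] at hv
        rw [e, e', ins_swap Θ x (G 0) (G 1) _ hv, smul_smul]
        exact (by rw [show ((0 : Fin (r + 1)).castSucc) = 0 from rfl,
          show ((0 : Fin (r + 1)).succ) = 1 from rfl, sgn_mul_self, one_smul])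
      | succ j =>
        have hsw : ∀ i : Fin (r + 1), Equiv.swap j.succ.castSucc j.succ.succ i.succ =
            (Equiv.swap j.castSucc j.succ i).succ := fun i => by
          rw [Fin.castSucc_succ j]
          exact (Fin.succ_injective _).swap_apply _ _ _
        have hsw0 : Equiv.swap j.succ.castSucc j.succ.succ 0 = 0 :=
          Equiv.swap_apply_of_ne_of_ne (by simp [Fin.ext_iff]) (by simp [Fin.ext_iff])
        have e : List.ofFn (G ∘ Equiv.swap j.succ.castSucc j.succ.succ) =
            G 0 :: List.ofFn ((fun i : Fin (r + 1) => G i.succ) ∘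
              Equiv.swap j.castSucc j.succ) := by
          rw [List.ofFn_succ]
          simp only [Function.comp_apply, hsw0, hsw]
          rfl
        rw [List.ofFn_succ] at hv
        have hc : (G 0).pos < N := hv.2 _ List.mem_cons_self
        have hl : (N + (G 0).ar - 1) + 1 = N + (G 0).ar := by omega
        have hv' := hv.shift hl
        rw [List.map_ofFn] at hv'
        rw [e, List.ofFn_succ (f := G), ins_cons Θ x (G 0) _ hl rfl ⟨_, hc⟩ rfl,
          ins_cons Θ x (G 0) _ hl rfl ⟨_, hc⟩ rfl, List.map_ofFn, List.map_ofFn]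
        exact ih j _ ((G 0).shift ∘ fun i : Fin (r + 1) => G i.succ) hv'
  cases r with
  | zero =>
    obtain rfl : σ = 1 := Subsingleton.elim _ _
    rw [koszul_one, sgn_zero, one_smul]
    rfl
  | succ r =>
    have hσ : σ ∈ Submonoid.closure
        (Set.range fun i : Fin r ↦ Equiv.swap i.castSucc i.succ) := by
      -- The adjacent transpositions generate the symmetric group already as a monoid, so no
      -- inverses appear in the induction.
      rw [Equiv.Perm.mclosure_swap_castSucc_succ]; trivial
    induction hσ using Submonoid.closure_induction generalizing G with
    | mem σ h =>
      obtain ⟨j, rfl⟩ := h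
      rw [hadj r j x G hv, koszul_swap]
      simp only [Equiv.swap_apply_left, Equiv.swap_apply_right]
      rw [mul_comm]
    | one =>
      rw [koszul_one, sgn_zero, one_smul]
      rfl
    | mul σ τ _ _ hσ hτ =>
      have e : G ∘ (σ * τ : Equiv.Perm (Fin (r + 1))) = (G ∘ σ) ∘ τ := rfl
      rw [e, hτ (G ∘ σ) (hv.ofFn_comp σ), hσ G hv, smul_smul, ← sgn_add, koszul_mul]
      simp [Equiv.Perm.mul_apply]

/-- Iterated `circ_circ`: filling the last `r` inputs of `y` inside `x ∘ᵢ y` amounts to inserting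
into `x` the element `y` with those inputs filled. No sign arises, since nothing is moved past
anything. The offset `s` counts the inputs of `y` preceding those still to be filled. -/
theorem ins_block (r : ℕ) {m n l l' s b : ℕ} {d e g g' G : ℤ} (h : l + 1 = m + n) (hd : g = d + e)
    (i : Fin m) (x : O.obj m d) (y : O.obj n e) (hn : n = s + r) (a : Fin r → ℕ) (ε : Fin r → ℤ)
    (f : ∀ u, O.obj (a u) (ε u)) (hb : b = s + ∑ u, a u) (hg : g' = e + ∑ u, ε u)
    (h' : l' + 1 = m + b) (hd' : G = d + g') (L : List (Cell O)) (hL : ∀ c ∈ L, (i : ℕ) < c.pos) :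
    ins Θ (O.circ h hd i x y)
        (List.ofFn (fun u : Fin r => (⟨i + s + u, a u, ε u, f u⟩ : Cell O)) ++
          L.map (Cell.mapPos (shiftPos i n))) =
      ins Θ (O.circ h' hd' i x (O.gammaAux r y hn a ε f hb hg))
        (L.map (Cell.mapPos (shiftPos i b))) := by
  induction r generalizing n l s e g with
  | zero =>
    obtain rfl : b = n := by simp [hb, hn]
    obtain rfl : g' = e := by simp [hg]
    subst hd hd'
    obtain rfl : l = l' := by omega
    rfl
  | succ r ih =>
    have hm := i.isLt
    have hl : (l + a 0 - 1) + 1 = l + a 0 := by omega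
    have h₃ : (s + a 0 + r) + 1 = n + a 0 := by omega
    have h₄ : (l + a 0 - 1) + 1 = m + (s + a 0 + r) := by omega
    have hd₄ : g + ε 0 = d + (e + ε 0) := by subst hd; exact add_assoc _ _ _
    rw [List.ofFn_succ, List.cons_append,
      ins_mk_cons Θ _ _ _ hl (rfl : g + ε 0 = _) (inner h i ⟨s, by omega⟩) (by simp [inner]),
      O.circ_circ h hl h₃ h₄ hd rfl rfl hd₄ i ⟨s, by omega⟩,
      O.gammaAux_succ, ← ih h₄ hd₄, List.map_append, List.map_map, List.map_ofFn]
    refine congrArg _ (congrArg₂ _ ?_ ?_)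
    · refine congrArg _ (funext fun u => ?_)
      change Cell.mk _ _ _ _ = Cell.mk _ _ _ _
      congr 1
      simp only [Fin.val_succ, Fin.val_zero]
      rw [shiftPos_of_le _ (by omega)]
      omega
    · refine List.map_congr_left fun c hc => ?_
      have := hL c hc
      change (c.mapPos _).mapPos _ = _
      rw [Cell.mapPos_mapPos]
      apply Cell.mapPos_congr
      simp only [Fin.val_zero, shiftPos]
      split_ifs <;> omega

/-- Associativity with its sign. On the left `y` is inserted before the cells `L₁`, on the right
after them; carrying it past each one by `circ_comm` contributes the product of the degrees. Once
`L₁` is exhausted, `ins_block` applies. -/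
theorem ins_circ {m n l b : ℕ} {d e g g' : ℤ} (h : l + 1 = m + n) (hd : g = d + e)
    (i : Fin m) (x : O.obj m d) (y : O.obj n e) (a : Fin n → ℕ) (ε : Fin n → ℤ)
    (f : ∀ u, O.obj (a u) (ε u)) (hb : b = ∑ u, a u) (hg : g' = e + ∑ u, ε u)
    (L₁ L : List (Cell O)) (hL₁ : ∀ c ∈ L₁, c.pos < i) (hL₁' : (L₁.map Cell.pos).Nodup)
    (hL : ∀ c ∈ L, (i : ℕ) < c.pos) :
    ins Θ (O.circ h hd i x y)
        (L₁ ++ (List.ofFn (fun u : Fin n => (⟨i + u, a u, ε u, f u⟩ : Cell O)) ++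
          L.map (Cell.mapPos (shiftPos i n)))) =
      sgn k (e * (L₁.map fun c => (c.deg : ZMod 2)).sum) •
        ins Θ x (L₁ ++ ⟨i, b, g', O.gamma y f hb hg⟩ :: L) := by
  induction hr : L₁.length generalizing m l d g i L₁ L with
  | zero =>
    obtain rfl := List.length_eq_zero_iff.1 hr
    have hm := i.isLt
    simp only [List.nil_append, List.map_nil, List.sum_nil, mul_zero, sgn_zero, one_smul]
    have hl : (m + b - 1) + 1 = m + b := by omega
    rw [ins_mk_cons Θ x _ L hl rfl i rfl]
    exact ins_block Θ n (s := 0) (b := b) h hd i x y (by omega) a ε f (by omega) hg hl rfl L hL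
  | succ q ih =>
    obtain ⟨c, L₁, rfl⟩ := List.exists_cons_of_length_eq_add_one hr
    have hci : c.pos < i := hL₁ c List.mem_cons_self
    have hc : c.pos < m := hci.trans i.isLt
    rw [List.map_cons, List.nodup_cons] at hL₁'
    have hne : ∀ c' ∈ L₁, c'.pos ≠ c.pos := fun c' hc' e =>
      hL₁'.1 (e ▸ List.mem_map_of_mem hc')
    have hij : (⟨c.pos, hc⟩ : Fin m) < i := hci
    have h₁ : (m + c.ar - 1) + 1 = m + c.ar := by omega
    have h₂ : (l + c.ar - 1) + 1 = (m + c.ar - 1) + n := by omega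
    have h₄ : (l + c.ar - 1) + 1 = l + c.ar := by omega
    have hG : d + c.deg + e = g + c.deg := by rw [hd]; ring
    have hcc := O.circ_comm h₁ h₂ h h₄ (rfl : d + c.deg = _) (rfl : d + c.deg + e = _) hd
      hG ⟨c.pos, hc⟩ i hij x c.el y
    have o1 := outer_val h₁ ⟨c.pos, hc⟩ i hij.ne'
    have o2 := outer_val h i ⟨c.pos, hc⟩ hij.ne
    have o2' : (outer h i ⟨c.pos, hc⟩ hij.ne : ℕ) = c.pos := outer_val_lt h hij _
    -- `circ_comm` read in the opposite direction.
    have hcc' : O.circ h₄ hG (outer h i ⟨c.pos, hc⟩ hij.ne) (O.circ h hd i x y)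
        c.el = sgn k (c.deg * e) • O.circ h₂ (rfl : d + c.deg + e = _)
          (outer h₁ ⟨c.pos, hc⟩ i hij.ne') (O.circ h₁ rfl ⟨c.pos, hc⟩ x c.el) y := by
      rw [hcc, smul_smul, sgn_mul_self, one_smul]
    rw [List.cons_append, ins_cons Θ _ c _ h₄ hG _ o2', hcc', ins_smul,
      List.cons_append, ins_cons Θ x c _ h₁ rfl ⟨c.pos, hc⟩ rfl, List.map_append, List.map_append,
      List.map_append, List.map_map, List.map_ofFn, List.map_cons]
    have key := ih h₂ (rfl : d + c.deg + e = _) (outer h₁ ⟨c.pos, hc⟩ i hij.ne')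
      (O.circ h₁ rfl ⟨c.pos, hc⟩ x c.el) (L₁.map c.shift) (L.map c.shift) (by
        intro c' hc'
        obtain ⟨c₁, hc₁, rfl⟩ := List.mem_map.1 hc'
        have z1 := hne c₁ hc₁
        have z2 := hL₁ c₁ (List.mem_cons_of_mem _ hc₁)
        rw [o1]
        change shiftPos _ _ _ < shiftPos _ _ _
        simp only [shiftPos]
        split_ifs <;> omega) (by
        rw [List.map_map]
        have : Cell.pos ∘ c.shift = shiftPos c.pos c.ar ∘ (Cell.pos : Cell O → ℕ) := rfl
        rw [this, ← List.map_map]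
        refine List.Nodup.map_on ?_ hL₁'.2
        intro x hx y hy e
        obtain ⟨c1, hc1, rfl⟩ := List.mem_map.1 hx
        obtain ⟨c2, hc2, rfl⟩ := List.mem_map.1 hy
        exact shiftPos_inj (hne _ hc1) (hne _ hc2) e) (by
        intro c' hc'
        obtain ⟨c₁, hc₁, rfl⟩ := List.mem_map.1 hc'
        have z2 := hL c₁ hc₁
        rw [o1]
        change shiftPos _ _ _ < shiftPos _ _ _
        simp only [shiftPos]
        split_ifs <;> omega) (by simpa using hr)
    have e1 : (L₁.map c.shift ++ ((⟨(outer h₁ ⟨c.pos, hc⟩ i hij.ne' : Fin _), b, g',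
        O.gamma y f hb hg⟩ : Cell O) :: L.map c.shift)) = L₁.map c.shift ++
        (c.shift ⟨i, b, g', O.gamma y f hb hg⟩ :: L.map c.shift) := by
      rw [o1]; rfl
    rw [e1] at key
    have e2 : ((L₁.map c.shift).map fun c => (c.deg : ZMod 2)) = L₁.map fun c => (c.deg : ZMod 2) := by
      rw [List.map_map]; rfl
    rw [e2] at key
    rw [List.map_cons, List.sum_cons, mul_add, sgn_add, mul_smul, mul_comm (c.deg : ZMod 2),
      ← key]
    congr 4
    · refine congrArg _ (funext fun u => ?_)
      change Cell.mk _ _ _ _ = Cell.mk _ _ _ _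
      congr 1
      rw [o1]
      simp only [shiftPos]
      split_ifs <;> omega
    · rw [List.map_map]
      refine List.map_congr_left fun c' hc' => ?_
      have := hL c' hc'
      change (c'.mapPos _).mapPos _ = (c'.mapPos _).mapPos _
      rw [Cell.mapPos_mapPos, Cell.mapPos_mapPos]
      apply Cell.mapPos_congr
      rw [o1]
      simp only [shiftPos]
      split_ifs <;> omega

/-- In `gammaAux` the next input to fill is recorded by its current number, in `ins` by its original
number; the renumbering after each insertion reconciles the two. -/
theorem ins_gammaAux (r : ℕ) {N s l : ℕ} {d g : ℤ} (t : O.obj N d) (hN : N = s + r) (a : Fin r → ℕ)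
    (e : Fin r → ℤ) (f : ∀ i, O.obj (a i) (e i)) (hl : l = s + ∑ i, a i) (hg : g = d + ∑ i, e i) :
    Θ l g (O.gammaAux r t hN a e f hl hg) =
      ins Θ t (List.ofFn fun i : Fin r => (⟨s + i, a i, e i, f i⟩ : Cell O)) := by
  induction r generalizing N s d with
  | zero =>
    obtain rfl : l = N := by simp [hl, hN]
    obtain rfl : g = d := by simp [hg]
    rw [List.ofFn_zero, ins_nil]
    rfl
  | succ r ih =>
    have hl' : (s + a 0 + r) + 1 = N + a 0 := by omega
    rw [O.gammaAux_succ, ih, List.ofFn_succ, ins_mk_cons Θ t _ _ hl' rfl ⟨s, by omega⟩ (by simp),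
      List.map_ofFn]
    refine congrArg _ (congrArg _ (funext fun u => ?_))
    change Cell.mk _ _ _ _ = Cell.mk _ _ _ _
    congr 1
    simp only [Fin.val_succ, Fin.val_zero]
    rw [shiftPos_of_le _ (by omega)]
    omega

theorem ins_gamma {n l : ℕ} {d g : ℤ} (t : O.obj n d) (a : Fin n → ℕ)
    (e : Fin n → ℤ) (f : ∀ i, O.obj (a i) (e i)) (hl : l = ∑ i, a i) (hg : g = d + ∑ i, e i) :
    Θ l g (O.gamma t f hl hg) =
      ins Θ t (List.ofFn fun i : Fin n => (⟨i, a i, e i, f i⟩ : Cell O)) := by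
  have := ins_gammaAux Θ n t (s := 0) (l := l) (by omega) a e f (by omega) hg
  simp only [Nat.zero_add] at this
  exact this

end InsertionLaws

/-! ### The action of a graded operad on its orbit spaces. -/

section OrbitAction

variable {k : Type u} [Field k]

/-- A realization of the orbits of the symmetric groups on a graded operad `O` by spaces `V m`,
each embedded into a component of `O`. -/
structure OrbitSpaces (O : GrOperad.{u, v} k) (V : ℕ → Type w) [∀ m, AddCommGroup (V m)]
    [∀ m, Module k (V m)] where
  ar : ℕ → ℕ
  deg : ℕ → ℤ
  emb : ∀ m, V m →ₗ[k] O.obj (ar m) (deg m)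
  proj : ∀ N d, O.obj N d →ₗ[k] ⨁ m, V m
  proj_act : ∀ N d (σ : Equiv.Perm (Fin N)) (x : O.obj N d), proj N d (O.act σ x) = proj N d x
  proj_emb : ∀ m (v : V m), proj _ _ (emb m v) = DirectSum.lof k ℕ V m v
  exists_emb : ∀ m (y : O.obj (ar m) (deg m)), ∃ v : V m,
    proj _ _ y = DirectSum.lof k ℕ V m v ∧ y - emb m v ∈ O.orbitDiff (ar m) (deg m)
  cover : ∀ N d, (∀ y : O.obj N d, y = 0) ∨ ∃ m, ar m = N ∧ deg m = d

namespace OrbitSpaces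

variable {O : GrOperad.{u, v} k} {V : ℕ → Type w} [∀ m, AddCommGroup (V m)] [∀ m, Module k (V m)]
  (S : OrbitSpaces O V)

/-- The operation on `⨁ V` given by an element of the operad. -/
def op {n : ℕ} {d : ℤ} : O.obj n d →ₗ[k] MultilinearMap k (fun _ : Fin n => ⨁ m, V m) (⨁ m, V m) where
  toFun t := MultilinearMap.fromDirectSumEquiv fun p =>
    ((S.proj _ _).compMultilinearMap (O.gammaMul rfl rfl t)).compLinearMap fun i => S.emb (p i)
  map_add' t t' := by
    rw [← map_add]
    refine congrArg _ (funext fun p => MultilinearMap.ext fun v => ?_)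
    simp
  map_smul' c t := by
    rw [← map_smul]
    refine congrArg _ (funext fun p => MultilinearMap.ext fun v => ?_)
    simp

theorem op_lof {n : ℕ} {d : ℤ} (t : O.obj n d) (p : Fin n → ℕ) (v : ∀ i, V (p i)) {L : ℕ} {g : ℤ}
    (hL : L = ∑ i, S.ar (p i)) (hg : g = d + ∑ i, S.deg (p i)) :
    S.op t (fun i => DirectSum.lof k ℕ V (p i) (v i)) =
      S.proj L g (O.gamma t (fun i => S.emb (p i) (v i)) hL hg) := by
  subst hL hg
  exact MultilinearMap.fromDirectSumEquiv_lof (R := k) (M := fun (_ : Fin n) m => V m) _ p v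

variable (k) in
/-- A homogeneous element of `⨁ V`. -/
def hom (w : Σ m, V m) : ⨁ m, V m := DirectSum.lof k ℕ V w.1 w.2

/-- A homogeneous element, as a cell to be inserted into the `i`-th input. -/
def cell (i : ℕ) (w : Σ m, V m) : Cell O := ⟨i, S.ar w.1, S.deg w.1, S.emb w.1 w.2⟩

/-- The bridge to the insertion calculus. Arguments are bundled with their degrees so that they can
be permuted and replaced without dependent types. -/
theorem op_hom {n : ℕ} {d : ℤ} (t : O.obj n d) (w : Fin n → Σ m, V m) :
    S.op t (fun i => hom k (w i)) = ins S.proj t (List.ofFn fun i : Fin n => S.cell i (w i)) :=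
  (S.op_lof t (fun i => (w i).1) (fun i => (w i).2) rfl rfl).trans <|
    ins_gamma S.proj t (fun i => S.ar (w i).1) (fun i => S.deg (w i).1)
      (fun i => S.emb (w i).1 (w i).2) rfl rfl

theorem valid_cells {n : ℕ} (w : Fin n → Σ m, V m) :
    Valid n (List.ofFn fun i : Fin n => S.cell i (w i)) := by
  constructor
  · rw [List.map_ofFn, List.nodup_ofFn]
    exact Fin.val_injective
  · intro c hc
    rw [List.mem_ofFn] at hc
    obtain ⟨i, rfl⟩ := hc
    exact i.isLt

theorem op_one (w : Fin 1 → Σ m, V m) : S.op O.one (fun i => hom k (w i)) = hom k (w 0) := by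
  rw [op_hom, List.ofFn_succ, List.ofFn_zero]
  refine (ins_cons S.proj O.one (S.cell ((0 : Fin 1) : ℕ) (w 0)) [] (add_comm _ _)
    (zero_add _).symm 0 rfl).trans ?_
  rw [O.one_circ, List.map_nil, ins_nil]
  exact S.proj_emb _ _

/-- `ins_act` sends the `i`-th cell to position `σ i`; restoring the increasing order of insertion
by `ins_perm` produces the Koszul sign. -/
theorem op_act {n : ℕ} {d : ℤ} (σ : Equiv.Perm (Fin n)) (t : O.obj n d) (w : Fin n → Σ m, V m) :
    S.op (O.act σ t) (fun i => hom k (w i)) =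
      sgn k (koszul σ fun i => (S.deg (w i).1 : ZMod 2)) •
        S.op t (fun i => hom k (w (σ.symm i))) := by
  rw [op_hom, op_hom S t (fun i => w (σ.symm i)), ins_act S.proj S.proj_act _ _ _ (S.valid_cells w)]
  have e : (List.ofFn fun i : Fin n => S.cell i (w i)).map (Cell.mapPos (permPos σ)) =
      List.ofFn ((fun i : Fin n => S.cell i (w (σ.symm i))) ∘ σ) := by
    rw [List.map_ofFn]
    refine congrArg _ (funext fun i => ?_)
    simp only [Function.comp_apply, Equiv.symm_apply_apply]
    change Cell.mk _ _ _ _ = Cell.mk _ _ _ _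
    rw [← permPos_val σ i]
    rfl
  rw [e, ins_perm S.proj t _ (S.valid_cells fun i => w (σ.symm i))]
  simp only [cell, Equiv.symm_apply_apply]

theorem ofFn_split {α : Type*} {l a b : ℕ} (h : l = a + b) (f : Fin l → α) :
    List.ofFn f = List.ofFn (fun j : Fin a => f ⟨j, by omega⟩) ++
      List.ofFn (fun j : Fin b => f ⟨a + j, by omega⟩) := by
  subst h
  rw [List.ofFn_add]
  rfl

theorem pre_eq_sum {l a : ℕ} (ha : a ≤ l) (p : Fin l → ZMod 2) :
    pre a p = ∑ j : Fin a, p ⟨j, by omega⟩ := by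
  obtain ⟨q, rfl⟩ := Nat.exists_eq_add_of_le ha
  unfold pre
  rw [Fin.sum_univ_add]
  simp
  rfl

/-- Both sides insert into `x` the outer arguments and one inner element: on the left the composite
`Y` of `y` with its block of arguments, on the right the chosen representative of the orbit of `Y`.
These agree modulo `orbitDiff`, so `ins_cell_congr` concludes. The sign is that of `ins_circ`, from
the arguments to the left of the block. -/
theorem op_circ {m n l : ℕ} {d e g : ℤ} (h : l + 1 = m + n) (hd : g = d + e) (i : Fin m)
    (x : O.obj m d) (y : O.obj n e) (w : Fin l → Σ m, V m) :
    S.op (O.circ h hd i x y) (fun i => hom k (w i)) =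
      sgn k (e * pre i fun t => (S.deg (w t).1 : ZMod 2)) •
        S.op x (circArg h i (S.op y) (fun i => hom k (w i))) := by
  have hm := i.isLt
  -- Arity and degree of `Y` are made into variables, so that they can later be replaced by `S.ar q`
  -- and `S.deg q`.
  obtain ⟨b, hb⟩ : ∃ b, b = ∑ u : Fin n, S.ar (w (inner h i u)).1 := ⟨_, rfl⟩
  obtain ⟨g', hg'⟩ : ∃ g', g' = e + ∑ u : Fin n, S.deg (w (inner h i u)).1 := ⟨_, rfl⟩
  set Y : O.obj b g' := O.gamma y (fun u => S.emb _ (w (inner h i u)).2) hb hg' with hY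
  have hyY : S.op y (fun u => hom k (w (inner h i u))) = S.proj b g' Y :=
    S.op_lof y (fun u => (w (inner h i u)).1) (fun u => (w (inner h i u)).2) hb hg'
  let L₁ : List (Cell O) := List.ofFn fun j : Fin i => S.cell j (w ⟨j, by omega⟩)
  -- The input `i + 1 + j` of `x` receives the argument numbered `i + n + j`, since `y` occupies `i,
  -- …, i + n - 1` in the composite.
  let L : List (Cell O) := List.ofFn fun j : Fin (m - i - 1) =>
    S.cell (i + 1 + j) (w ⟨i + n + j, by omega⟩)
  have hleft : S.op (O.circ h hd i x y) (fun i => hom k (w i)) =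
      sgn k (e * pre i fun t => (S.deg (w t).1 : ZMod 2)) •
        ins S.proj x (L₁ ++ ⟨i, b, g', Y⟩ :: L) := by
    have hsum : (L₁.map fun c => (c.deg : ZMod 2)).sum =
        pre i fun t => (S.deg (w t).1 : ZMod 2) := by
      rw [List.map_ofFn, List.sum_ofFn, pre_eq_sum (by omega)]
      rfl
    rw [← hsum, hY, ← ins_circ S.proj h hd i x y (fun u => S.ar (w (inner h i u)).1)
      (fun u => S.deg (w (inner h i u)).1) (fun u => S.emb _ (w (inner h i u)).2) hb hg' L₁ L,
      op_hom, ofFn_split (a := i) (b := n + (m - i - 1)) (by omega),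
      ofFn_split (a := n) (b := m - i - 1) rfl, List.map_ofFn]
    · refine congrArg _ (congrArg _ (congrArg _ (congrArg _ (funext fun j => ?_))))
      have e1 : (⟨i + (n + j), by omega⟩ : Fin l) = ⟨i + n + j, by omega⟩ :=
        Fin.ext (by simp only; omega)
      have e2 : (i : ℕ) + (n + j) = shiftPos i n (i + 1 + j) := by
        rw [shiftPos_of_le _ (by omega)]; omega
      change S.cell (i + (n + j)) (w ⟨i + (n + j), _⟩) = S.cell (shiftPos i n (i + 1 + j)) _
      rw [← e2, e1]
    · intro c hc
      obtain ⟨j, rfl⟩ := List.mem_ofFn.1 hc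
      exact j.isLt
    · rw [List.map_ofFn, List.nodup_ofFn]
      exact Fin.val_injective
    · intro c hc
      obtain ⟨j, rfl⟩ := List.mem_ofFn.1 hc
      change (i : ℕ) < i + 1 + j
      omega
  rw [hleft]
  congr 1
  have hself : circArg h i (S.op y) (fun i => hom k (w i)) i = S.proj b g' Y := by
    rw [circArg_self, hyY]
  -- Either the component containing `Y` is zero and both sides vanish, or it is one of those
  -- realized by the spaces `V q`.
  rcases S.cover b g' with h0 | ⟨q, hq, hq'⟩
  · rw [MultilinearMap.map_coord_zero _ i (by rw [hself, h0 Y, map_zero]), h0 Y]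
    have := ins_cell_smul S.proj x L₁ L (p := i) (0 : k) (0 : O.obj b g')
    rwa [zero_smul, zero_smul] at this
  · clear_value Y
    subst hq hq'
    obtain ⟨v, hv, hv'⟩ := S.exists_emb q Y
    -- The arguments of `x` on the right-hand side, with the value of `y` represented by the element
    -- `v` of `V q`.
    let w' : Fin m → Σ m, V m := fun j => if hj : j = i then ⟨q, v⟩ else w (outer h i j hj)
    have hc : circArg h i (S.op y) (fun i => hom k (w i)) = fun j => hom k (w' j) := by
      funext j
      by_cases hj : j = i
      · subst hj
        rw [hself, hv]
        simp only [w', dif_pos rfl]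
        rfl
      · rw [circArg_ne h i j hj]
        simp only [w', dif_neg hj]
    have hlist : (List.ofFn fun j : Fin m => S.cell j (w' j)) =
        L₁ ++ ⟨i, S.ar q, S.deg q, S.emb q v⟩ :: L := by
      rw [ofFn_split (a := i) (b := (m - i - 1) + 1) (by omega), List.ofFn_succ]
      refine congrArg₂ _ (congrArg _ (funext fun j => ?_))
        (congrArg₂ _ ?_ (congrArg _ (funext fun j => ?_)))
      · have hj : (⟨j, by omega⟩ : Fin m) < i := j.isLt
        simp only [w', dif_neg hj.ne]
        have e1 : outer h i ⟨j, by omega⟩ hj.ne = ⟨j, by omega⟩ :=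
          Fin.ext (outer_val_lt h hj hj.ne)
        rw [e1]
      · have e1 : (⟨i + ((0 : Fin (m - i - 1 + 1)) : ℕ), by simp⟩ : Fin m) = i :=
          Fin.ext (by simp)
        rw [e1]
        simp only [w', dif_pos rfl]
        rfl
      · have hj : i < (⟨i + (j.succ : ℕ), by omega⟩ : Fin m) :=
          Fin.lt_def.2 (by simp only [Fin.val_succ]; omega)
        simp only [w', dif_neg hj.ne']
        have e1 : outer h i ⟨i + (j.succ : ℕ), by omega⟩ hj.ne' = ⟨i + n + j, by omega⟩ :=
          Fin.ext (by rw [outer_val_gt h hj hj.ne']; simp only [Fin.val_succ]; omega)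
        rw [e1]
        congr 1
        simp only [Fin.val_succ]; omega
    have hval := S.valid_cells w'
    rw [hlist] at hval
    rw [hc, op_hom, hlist]
    exact ins_cell_congr S.proj S.proj_act x L₁ L Y (S.emb q v) (valid_congr hval Y) hv'

end OrbitSpaces

end OrbitAction

/-! ### Ungraded operads viewed in degree zero. -/

section DegreeZero

variable {k : Type u} [Field k]

/-- The degree `d` part of `P(n)` placed in degree zero. -/
def Operad.zeroPiece (P : Operad.{u, v} k) (n : ℕ) (d : ℤ) : Submodule k (P.obj n) :=
  if d = 0 then ⊤ else ⊥

theorem Operad.mem_zeroPiece (P : Operad.{u, v} k) {n : ℕ} {d : ℤ} {x : P.obj n} :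
    x ∈ P.zeroPiece n d ↔ d = 0 ∨ x = 0 := by
  unfold Operad.zeroPiece
  split_ifs with h <;> simp [h]

/-- An operad in vector spaces as a graded operad concentrated in degree zero. -/
def Operad.toGr (P : Operad.{u, v} k) : GrOperad.{u, v} k where
  obj n d := P.zeroPiece n d
  act {n d} σ := (P.act σ).restrict (fun p hp => by
    rw [Operad.mem_zeroPiece] at hp ⊢
    rcases hp with hp | rfl
    · exact Or.inl hp
    · simp)
  one := ⟨P.one, P.mem_zeroPiece.2 (Or.inl rfl)⟩
  circ {m n l d e g} h hd i := LinearMap.mk₂ k (fun p q => ⟨P.circ h i p.1 q.1, by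
      rcases P.mem_zeroPiece.1 p.2 with hp | hp
      · rcases P.mem_zeroPiece.1 q.2 with hq | hq
        · exact P.mem_zeroPiece.2 (Or.inl (by omega))
        · rw [hq, map_zero]; exact zero_mem _
      · rw [hp, map_zero]; exact zero_mem _⟩)
    (fun _ _ _ => Subtype.ext (by simp)) (fun _ _ _ => Subtype.ext (by simp))
    (fun _ _ _ => Subtype.ext (by simp)) (fun _ _ _ => Subtype.ext (by simp))
  act_one p := Subtype.ext (by simp [P.act_one])
  act_mul σ τ p := Subtype.ext (by simp [P.act_mul])
  one_circ h hd q := Subtype.ext (by simp [P.one_circ])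
  circ_one h hd i p := Subtype.ext (by simp [P.circ_one])
  circ_circ h₁ h₂ h₃ h₄ d₁ d₂ d₃ d₄ i j p q s := Subtype.ext (P.circ_circ h₁ h₂ h₃ h₄ i j _ _ _)
  circ_comm {m n r l l' N d e f g g' G} h₁ h₂ h₃ h₄ d₁ d₂ d₃ d₄ i j hij p q s := by
    rcases P.mem_zeroPiece.1 q.2 with hq | hq
    · have hs : sgn k ((e : ZMod 2) * f) = 1 := by rw [hq, Int.cast_zero, zero_mul, sgn_zero]
      rw [hs, one_smul]
      exact Subtype.ext (P.circ_comm h₁ h₂ h₃ h₄ i j hij _ _ _)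
    · rw [show q = 0 from Subtype.ext hq]; simp
  circ_act h hd i σ τ ρ h₁ h₂ p q := Subtype.ext (P.circ_act h i σ τ ρ h₁ h₂ _ _)

end DegreeZero

/-! ### Full composites of pure tensors in `End_A ⊗ R`. -/

section GammaTensor

variable {A : Type v}

/-- The arguments `x₀, …, x_{s-1}, φ₀(…), …, φ_{r-1}(…)` of the outer map in a full composite. -/
def blockArg {r : ℕ} {a : Fin r → ℕ} {s L N : ℕ} (hL : L = s + ∑ i, a i) (hN : N = s + r)
    (φ : ∀ i, (Fin (a i) → A) → A) (x : Fin L → A) : Fin N → A := fun j =>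
  if h : (j : ℕ) < s then x ⟨j, by omega⟩
  else (fun i : Fin r => φ i fun v => x ⟨s + (finSigmaFinEquiv ⟨i, v⟩ : Fin (∑ i, a i)), by omega⟩)
    ⟨j - s, by omega⟩

theorem blockArg_lt {r : ℕ} {a : Fin r → ℕ} {s L N : ℕ} (hL : L = s + ∑ i, a i) (hN : N = s + r)
    (φ : ∀ i, (Fin (a i) → A) → A) (x : Fin L → A) {j : Fin N} (h : (j : ℕ) < s) :
    blockArg hL hN φ x j = x ⟨j, by omega⟩ := dif_pos h

theorem blockArg_ge {r : ℕ} {a : Fin r → ℕ} {s L N : ℕ} (hL : L = s + ∑ i, a i) (hN : N = s + r)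
    (φ : ∀ i, (Fin (a i) → A) → A) (x : Fin L → A) {j : Fin N} (i : Fin r) (h : (j : ℕ) = s + i) :
    blockArg hL hN φ x j =
      φ i fun v => x ⟨s + (finSigmaFinEquiv ⟨i, v⟩ : Fin (∑ i, a i)), by omega⟩ := by
  have hj : ¬ (j : ℕ) < s := by omega
  have e : (⟨j - s, by omega⟩ : Fin r) = i := Fin.ext (by simp only; omega)
  unfold blockArg
  rw [dif_neg hj, e]

theorem finSigmaFinEquiv_zero {r : ℕ} (a : Fin (r + 1) → ℕ) (v : Fin (a 0)) :
    (finSigmaFinEquiv (⟨0, v⟩ : (i : Fin (r + 1)) × Fin (a i)) : ℕ) = v := by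
  rw [finSigmaFinEquiv_apply]; simp

theorem finSigmaFinEquiv_succ {r : ℕ} (a : Fin (r + 1) → ℕ) (i : Fin r) (v : Fin (a i.succ)) :
    (finSigmaFinEquiv (⟨i.succ, v⟩ : (i : Fin (r + 1)) × Fin (a i)) : ℕ) =
      a 0 + (finSigmaFinEquiv (⟨i, v⟩ : (i : Fin r) × Fin (a i.succ)) : ℕ) := by
  rw [finSigmaFinEquiv_apply, finSigmaFinEquiv_apply]
  have : ∑ j : Fin (i.succ : ℕ), a (Fin.castLE i.succ.2.le j) =
      a 0 + ∑ j : Fin (i : ℕ), a (Fin.castLE i.2.le j).succ :=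
    Fin.sum_univ_succ (n := (i : ℕ)) (fun j => a (Fin.castLE i.succ.2.le j))
  simp only [this]
  omega

/-- The recursion step matching `gammaAux`: inserting `φ 0` at input `s` and then filling from `s +
a 0` on is filling from `s` on. -/
theorem circArg_blockArg {r : ℕ} {a : Fin (r + 1) → ℕ} {s L N : ℕ} (hL : L = s + ∑ i, a i)
    (hN : N = s + (r + 1)) (φ : ∀ i, (Fin (a i) → A) → A) (x : Fin L → A)
    (h : s + a 0 + r + 1 = N + a 0) (hL' : L = s + a 0 + ∑ i : Fin r, a i.succ) :
    circArg h ⟨s, by omega⟩ (φ 0)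
      (blockArg (s := s + a 0) hL' rfl (fun i : Fin r => φ i.succ) x) = blockArg hL hN φ x := by
  funext j
  rcases lt_trichotomy (j : ℕ) s with hj | hj | hj
  · have hj' : j < (⟨s, by omega⟩ : Fin N) := hj
    have o := outer_val_lt h hj' hj'.ne
    rw [circArg_ne h _ j hj'.ne, blockArg_lt hL hN φ x hj, blockArg_lt _ _ _ _ (by omega)]
    exact congrArg x (Fin.ext o)
  · have e : (⟨s, by omega⟩ : Fin N) = j := Fin.ext hj.symm
    rw [e, circArg_self, blockArg_ge hL hN φ x 0 (by simpa using hj)]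
    refine congrArg _ (funext fun v => ?_)
    have hv := v.isLt
    rw [blockArg_lt _ _ _ _ (by simp only [inner]; omega)]
    refine congrArg x (Fin.ext ?_)
    simp only [inner, finSigmaFinEquiv_zero, hj]
  · have hj' : (⟨s, by omega⟩ : Fin N) < j := hj
    have o := outer_val_gt h hj' hj'.ne'
    let i : Fin r := ⟨j - s - 1, by omega⟩
    have hi : (i : ℕ) = j - s - 1 := rfl
    rw [circArg_ne h _ j hj'.ne', blockArg_ge hL hN φ x i.succ (by rw [Fin.val_succ]; omega),
      blockArg_ge _ _ _ _ i (by omega)]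
    refine congrArg _ (funext fun v => ?_)
    refine congrArg x (Fin.ext ?_)
    simp only [finSigmaFinEquiv_succ]
    omega

variable {k : Type u} [Field k]

theorem GrOperad.circ_one_heq (O : GrOperad.{u, w} k) {m n l : ℕ} {d e g : ℤ} (hn : n = 1)
    (he : e = 0) {q : O.obj n e} (hq : HEq q O.one) (h : l + 1 = m + n) (hd : g = d + e) (i : Fin m)
    (p : O.obj m d) : HEq (O.circ h hd i p q) p := by
  subst hn he
  obtain rfl : l = m := by omega
  obtain rfl : g = d := by omega
  rw [eq_of_heq hq, O.circ_one]

/-- Stated with heterogeneous equality because the arity `∑ i, a i` equals `r` only propositionally.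
-/
theorem GrOperad.gammaAux_one (O : GrOperad.{u, w} k) (r : ℕ) {N s L : ℕ} {d g : ℤ} (t : O.obj N d)
    (hN : N = s + r) (a : Fin r → ℕ) (e : Fin r → ℤ) (f : ∀ i, O.obj (a i) (e i))
    (hL : L = s + ∑ i, a i) (hg : g = d + ∑ i, e i) (ha : ∀ i, a i = 1) (he : ∀ i, e i = 0)
    (hf : ∀ i, HEq (f i) O.one) : HEq (O.gammaAux r t hN a e f hL hg) t := by
  induction r generalizing N s d with
  | zero => exact O.gammaAux_zero t hN a e f hL hg
  | succ r ih =>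
    rw [O.gammaAux_succ]
    exact (ih _ _ _ _ _ _ _ (fun i => ha i.succ) (fun i => he i.succ) (fun i => hf i.succ)).trans
      (O.circ_one_heq (ha 0) (he 0) (hf 0) _ _ _ _)

variable [AddCommGroup A] [Module k A] {R : Operad.{u, w} k} {O : GrOperad.{u, max v w} k}

theorem tensor_circ_smul {m n l : ℕ} (h : l + 1 = m + n) (i : Fin m) (b : k)
    (ψ : MultilinearMap k (fun _ : Fin m => A) A) (φ : MultilinearMap k (fun _ : Fin n => A) A)
    (q : R.obj m) (q' : R.obj n) :
    TensorProduct.map₂ (mcirc h i) (R.circ h i) (b • (ψ ⊗ₜ[k] q)) (φ ⊗ₜ[k] q') =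
      b • (mcirc h i ψ φ ⊗ₜ[k] R.circ h i q q') := by
  rw [map_smul, LinearMap.smul_apply, TensorProduct.map₂_apply_tmul, TensorProduct.map_tmul]

/-- The coefficient accumulated by a full composite, when inserting an element of degree `e` into
the input `s` contributes `c s e`. -/
def blockCoeff (c : ℕ → ℤ → k) : ∀ (r : ℕ) (_ : ℕ) (_ : Fin r → ℕ) (_ : Fin r → ℤ), k
  | 0, _, _, _ => 1
  | r + 1, s, a, e => c s (e 0) * blockCoeff c r (s + a 0) (fun i => a i.succ) (fun i => e i.succ)

theorem blockCoeff_eq_one {c : ℕ → ℤ → k} {r : ℕ} {s : ℕ} {a : Fin r → ℕ} {e : Fin r → ℤ}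
    (h : ∀ i j, c j (e i) = 1) : blockCoeff c r s a e = 1 := by
  induction r generalizing s with
  | zero => rfl
  | succ r ih => rw [blockCoeff, h, one_mul, ih fun i j => h i.succ j]

/-- The maps `U` forget the grading, and `c` measures by which scalars composition in `O` differs
from the unsigned one. This covers both `Λ(End_A ⊗ P^!)`, where `c` is the suspension sign, and
`End_B ⊗ P` in degree zero, where `c = 1`. The `R`-factor is composed in `R.toGr`, hence without
signs. -/
theorem gammaAux_tmul (U : ∀ n d, O.obj n d →ₗ[k] ((endOp k A).tensor R).obj n) (c : ℕ → ℤ → k)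
    (hU : ∀ {m n l : ℕ} {d e g : ℤ} (h : l + 1 = m + n) (hd : g = d + e) (i : Fin m) (x : O.obj m d)
      (y : O.obj n e), U l g (O.circ h hd i x y) =
        c i e • ((endOp k A).tensor R).circ h i (U m d x) (U n e y))
    (r : ℕ) {s L : ℕ} (a : Fin r → ℕ) (e : Fin r → ℤ) (hL : L = s + ∑ i, a i) :
    ∀ {N : ℕ} {d g d' g' : ℤ} (e' : Fin r → ℤ)
      (hN : N = s + r) (hg : g = d + ∑ i, e i) (hg' : g' = d' + ∑ i, e' i) (t : O.obj N d)
      (f : ∀ i, O.obj (a i) (e i)) (b : k) (ψ : MultilinearMap k (fun _ : Fin N => A) A)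
      (φ : ∀ i, MultilinearMap k (fun _ : Fin (a i) => A) A) (q₀ : R.toGr.obj N d')
      (q : ∀ i, R.toGr.obj (a i) (e' i)) (_ : U N d t = b • (ψ ⊗ₜ[k] q₀.1))
      (_ : ∀ i, U (a i) (e i) (f i) = φ i ⊗ₜ[k] (q i).1),
      ∃ χ : MultilinearMap k (fun _ : Fin L => A) A,
        (∀ x, χ x = ψ (blockArg hL hN (fun i => φ i) x)) ∧
        U L g (O.gammaAux r t hN a e f hL hg) =
          (b * blockCoeff c r s a e) • (χ ⊗ₜ[k] (R.toGr.gammaAux r q₀ hN a e' q hL hg' : R.zeroPiece L g').1) := by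
  induction r generalizing s with
  | zero =>
    intro N d g d' g' e' hN hg hg' t f b ψ φ q₀ q ht hf
    obtain rfl : L = N := by simp [hL, hN]
    obtain rfl : g = d := by simp [hg]
    obtain rfl : g' = d' := by simp [hg']
    refine ⟨ψ, fun x => ?_, ?_⟩
    · refine congrArg _ (funext fun j => ?_)
      rw [blockArg_lt _ _ _ _ (by omega)]
    · rw [blockCoeff, mul_one]
      exact ht
  | succ r ih =>
    have hL' : L = s + a 0 + ∑ i : Fin r, a i.succ := by rw [hL, Fin.sum_univ_succ]; omega
    intro N d g d' g' e' hN hg hg' t f b ψ φ q₀ q ht hf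
    have h : s + a 0 + r + 1 = N + a 0 := by omega
    obtain ⟨χ, hχ, hχ'⟩ := ih (fun i => a i.succ) (fun i => e i.succ) hL' (N := s + a 0 + r) (g := g) (g' := g') (d := d + e 0) (d' := d' + e' 0)
      (fun i => e' i.succ) rfl (by rw [hg, Fin.sum_univ_succ]; ring)
      (by rw [hg', Fin.sum_univ_succ]; ring) (O.circ h rfl ⟨s, by omega⟩ t (f 0))
      (fun i => f i.succ) (b * c s (e 0)) (mcirc h ⟨s, by omega⟩ ψ (φ 0)) (fun i => φ i.succ)
      (R.toGr.circ h rfl ⟨s, by omega⟩ q₀ (q 0)) (fun i => q i.succ) (by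
        rw [hU, ht, hf 0, mul_comm b, mul_smul]
        exact congrArg (c s (e 0) • ·) (tensor_circ_smul h _ b ψ (φ 0) q₀.1 (q 0).1)) (fun i => hf i.succ)
    refine ⟨χ, fun x => ?_, ?_⟩
    · rw [hχ, mcirc_apply, circArg_blockArg hL hN (fun i => φ i) x h hL']
    · rw [blockCoeff, ← mul_assoc]
      exact hχ'

end GammaTensor

/-! ### Averaging over the symmetric group. -/

section Average

variable {k : Type u} [Field k] {X : Type v} [AddCommGroup X] [Module k X] {n : ℕ}

/-- The average over the symmetric group of linear endomorphisms `ρ σ`. -/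
def average (ρ : Equiv.Perm (Fin n) → X →ₗ[k] X) : X →ₗ[k] X :=
  (Fintype.card (Equiv.Perm (Fin n)) : k)⁻¹ • ∑ σ, ρ σ

theorem average_apply (ρ : Equiv.Perm (Fin n) → X →ₗ[k] X) (x : X) :
    average ρ x = (Fintype.card (Equiv.Perm (Fin n)) : k)⁻¹ • ∑ σ, ρ σ x := by
  simp [average]

/-- The action is on the right, so acting by `τ` before averaging reindexes the sum by left
multiplication, and acting afterwards by right multiplication. -/
theorem average_act {ρ : Equiv.Perm (Fin n) → X →ₗ[k] X}
    (hρ : ∀ σ τ x, ρ (σ * τ) x = ρ τ (ρ σ x)) (τ : Equiv.Perm (Fin n)) (x : X) :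
    average ρ (ρ τ x) = average ρ x := by
  rw [average_apply, average_apply, ← Equiv.sum_comp (Equiv.mulLeft τ) (fun σ => ρ σ x)]
  simp only [Equiv.coe_mulLeft, hρ]

theorem act_average {ρ : Equiv.Perm (Fin n) → X →ₗ[k] X}
    (hρ : ∀ σ τ x, ρ (σ * τ) x = ρ τ (ρ σ x)) (τ : Equiv.Perm (Fin n)) (x : X) :
    ρ τ (average ρ x) = average ρ x := by
  rw [average_apply, map_smul, map_sum, ← Equiv.sum_comp (Equiv.mulRight τ) (fun σ => ρ σ x)]
  simp only [Equiv.coe_mulRight, hρ]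

theorem map_average {Y : Type w} [AddCommGroup Y] [Module k Y]
    {ρ : Equiv.Perm (Fin n) → X →ₗ[k] X} {ρ' : Equiv.Perm (Fin n) → Y →ₗ[k] Y} (f : X →ₗ[k] Y)
    (h : ∀ σ x, f (ρ σ x) = ρ' σ (f x)) (x : X) : f (average ρ x) = average ρ' (f x) := by
  rw [average_apply, average_apply, map_smul, map_sum]
  simp only [h]

variable [CharZero k]

theorem card_perm_ne_zero : (Fintype.card (Equiv.Perm (Fin n)) : k) ≠ 0 :=
  Nat.cast_ne_zero.2 Fintype.card_ne_zero

theorem average_eq {ρ : Equiv.Perm (Fin n) → X →ₗ[k] X} {x : X} (hx : ∀ σ, ρ σ x = x) :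
    average ρ x = x := by
  rw [average_apply]
  simp only [hx, Finset.sum_const, Finset.card_univ]
  rw [← Nat.cast_smul_eq_nsmul k, smul_smul, inv_mul_cancel₀ card_perm_ne_zero, one_smul]

/-- In characteristic zero every coinvariant class is represented by its average: the difference is
`-1/n!` times the sum of all `σ x - x`. -/
theorem sub_average_mem (ρ : Equiv.Perm (Fin n) → X →ₗ[k] X) (x : X) :
    x - average ρ x ∈ Submodule.span k {z | ∃ σ w, z = ρ σ w - w} := by
  have e : x - average ρ x =
      -((Fintype.card (Equiv.Perm (Fin n)) : k)⁻¹ • ∑ σ, (ρ σ x - x)) := by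
    rw [average_apply, Finset.sum_sub_distrib, Finset.sum_const, Finset.card_univ,
      ← Nat.cast_smul_eq_nsmul k, smul_sub, smul_smul, inv_mul_cancel₀ card_perm_ne_zero, one_smul,
      neg_sub]
  rw [e]
  exact neg_mem (Submodule.smul_mem _ _ (Submodule.sum_mem _ fun σ _ =>
    Submodule.subset_span ⟨σ, x, rfl⟩))

end Average

/-! ### Invariants of an ungraded operad as orbit spaces. -/

section Invariants

variable {k : Type u} [Field k]

/-- The invariants of the symmetric group on `Q(m)`. -/
def Operad.inv (Q : Operad.{u, v} k) (m : ℕ) : Submodule k (Q.obj m) where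
  carrier := {x | ∀ σ, Q.act σ x = x}
  add_mem' hx hy σ := by rw [map_add, hx σ, hy σ]
  zero_mem' σ := map_zero _
  smul_mem' c x hx σ := by rw [map_smul, hx σ]

/-- The averaging map onto the invariants. -/
def Operad.averInv (Q : Operad.{u, v} k) (m : ℕ) : Q.obj m →ₗ[k] Q.inv m :=
  LinearMap.codRestrict (Q.inv m) (average fun σ => Q.act σ) fun x σ => act_average Q.act_mul σ x

theorem Operad.zeroPiece_zero (Q : Operad.{u, v} k) {n : ℕ} (x : Q.obj n) : x ∈ Q.zeroPiece n 0 :=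
  Q.mem_zeroPiece.2 (Or.inl rfl)

variable [CharZero k]

/-- The invariants of an operad concentrated in degree zero realize its orbits. -/
def Operad.invOrbits (Q : Operad.{u, v} k) : OrbitSpaces Q.toGr (fun m => Q.inv m) where
  ar m := m
  deg _ := 0
  emb m := LinearMap.codRestrict (Q.zeroPiece m 0) (Q.inv m).subtype fun v => Q.zeroPiece_zero v.1
  proj N d := DirectSum.lof k ℕ (fun m => Q.inv m) N ∘ₗ Q.averInv N ∘ₗ (Q.zeroPiece N d).subtype
  proj_act N d σ x := congrArg (DirectSum.lof k ℕ (fun m => Q.inv m) N)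
    (Subtype.ext (average_act Q.act_mul σ x.1))
  proj_emb m v := congrArg (DirectSum.lof k ℕ (fun m => Q.inv m) m)
    (Subtype.ext (average_eq v.2))
  exists_emb m y := ⟨Q.averInv m y.1, rfl, by
    have h := sub_average_mem (fun σ => (Q.toGr.act σ : Q.toGr.obj m 0 →ₗ[k] _)) y
    have e := map_average (ρ := fun σ => (Q.toGr.act σ : Q.toGr.obj m 0 →ₗ[k] _))
      (ρ' := fun σ => Q.act σ) ((Q.zeroPiece m 0).subtype : Q.toGr.obj m 0 →ₗ[k] Q.obj m)
      (fun _ _ => rfl) y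
    have e' : average (fun σ => (Q.toGr.act σ : Q.toGr.obj m 0 →ₗ[k] _)) y =
      LinearMap.codRestrict (Q.zeroPiece m 0) (Q.inv m).subtype
        (fun v => Q.zeroPiece_zero v.1) (Q.averInv m y.1) := Subtype.ext e
    rw [e'] at h
    exact h⟩
  cover N d := by
    by_cases hd : d = 0
    · exact Or.inr ⟨N, rfl, hd.symm⟩
    · exact Or.inl fun y => Subtype.ext ((Q.mem_zeroPiece.1 y.2).resolve_left hd)

end Invariants

section MultilinearExt

variable {k : Type u} [Field k] {V : ℕ → Type v} [∀ m, AddCommGroup (V m)] [∀ m, Module k (V m)]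

theorem ext_hom {n : ℕ} {F G : MultilinearMap k (fun _ : Fin n => ⨁ m, V m) (⨁ m, V m)}
    (h : ∀ w : Fin n → Σ m, V m, F (fun i => OrbitSpaces.hom k (w i)) =
      G (fun i => OrbitSpaces.hom k (w i))) : F = G := by
  refine MultilinearMap.directSum_ext fun p => ?_
  ext1 v
  exact h fun i => ⟨p i, v i⟩

end MultilinearExt

/-! ### A `P`-algebra that detects operations. -/

section FaithfulAlgebra

variable {k : Type u} [Field k]

/-- The product of `r` elements of a commutative algebra. -/
abbrev prodMul (k : Type u) [Field k] (B : Type v) [CommRing B] [Algebra k B] (r : ℕ) :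
    MultilinearMap k (fun _ : Fin r => B) B := MultilinearMap.mkPiAlgebra k (Fin r) B

/-- Associativity and commutativity of iterated products: it makes `r ↦ prodMul k B r` compatible
with partial composition, hence `p ↦ mult ⊗ p` a morphism from `P` to `End_B ⊗ P`. -/
theorem prod_circArg {B : Type v} [CommRing B] {m n l : ℕ} (h : l + 1 = m + n) (i : Fin m)
    (x : Fin l → B) : ∏ j, circArg h i (fun y => ∏ s, y s) x j = ∏ t, x t := by
  -- The splitting of a sum over the inputs of a composite, read multiplicatively.
  have e := sum_circ (M := Additive B) h i (fun t => Additive.ofMul (x t))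
  have e' : ∏ t, x t = (∏ s, x (inner h i s)) * ∏ j : {j // j ≠ i}, x (outer h i j.1 j.2) := e
  rw [Fintype.prod_eq_mul_prod_subtype_ne _ i, circArg_self, e']
  refine congrArg _ (Finset.prod_congr rfl fun j _ => ?_)
  rw [circArg_ne h i j.1 j.2]

/-- The operad `End_B ⊗ P`. -/
abbrev algOperad (P : Operad.{u, u} k) (B : Type u) [CommRing B] [Algebra k B] : Operad.{u, u} k :=
  (endOp k B).tensor P

/-- The element `mult ⊗ p` of `End_B ⊗ P`. -/
def multTensor (P : Operad.{u, u} k) (B : Type u) [CommRing B] [Algebra k B] (r : ℕ) :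
    P.obj r →ₗ[k] (algOperad P B).toGr.obj r 0 :=
  LinearMap.codRestrict ((algOperad P B).zeroPiece r 0)
    (TensorProduct.mk k _ (P.obj r) (prodMul k B r)) fun _ => (algOperad P B).zeroPiece_zero _

variable [CharZero k] (P : Operad.{u, u} k) (B : Type u) [CommRing B] [Algebra k B]

/-- The `P`-algebra of orbits of `End_B ⊗ P`, for a commutative algebra `B`. -/
def orbitAlg : P.Alg where
  carrier := ⨁ m, (algOperad P B).inv m
  α :=
    -- The orbit action of `End_B ⊗ P`, restricted along `p ↦ mult ⊗ p`. All degrees are zero, so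
    -- the signs in `op_act` and `op_circ` disappear.
    { app := fun r => (algOperad P B).invOrbits.op ∘ₗ multTensor P B r
      map_act := fun {n} σ p => ext_hom fun w => by
        have e : multTensor P B n (P.act σ p) = (algOperad P B).toGr.act σ (multTensor P B n p) := by
          refine Subtype.ext ?_
          change prodMul k B n ⊗ₜ[k] P.act σ p = ((endOp k B).act σ (prodMul k B n)) ⊗ₜ[k] P.act σ p
          congr 1
          refine MultilinearMap.ext fun x => ?_
          exact (Equiv.prod_comp σ.symm x).symm
        change (algOperad P B).invOrbits.op (multTensor P B n (P.act σ p)) _ = _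
        rw [e, OrbitSpaces.op_act]
        have hk : koszul σ (fun i => (((algOperad P B).invOrbits.deg (w i).1 : ℤ) : ZMod 2)) = 0 := by
          unfold koszul
          refine Finset.sum_eq_zero fun i _ => Finset.sum_eq_zero fun j _ => ?_
          simp [Operad.invOrbits]
        rw [hk, sgn_zero, one_smul]
        rfl
      map_one := ext_hom fun w => by
        have e : multTensor P B 1 P.one = (algOperad P B).toGr.one := by
          refine Subtype.ext ?_
          change prodMul k B 1 ⊗ₜ[k] P.one = (endOp k B).one ⊗ₜ[k] P.one
          congr 1
          refine MultilinearMap.ext fun x => ?_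
          exact Fin.prod_univ_one x
        change (algOperad P B).invOrbits.op (multTensor P B 1 P.one) _ = _
        rw [e, OrbitSpaces.op_one]
        rfl
      map_circ := fun {m n l} h i p q => ext_hom fun w => by
        have e : multTensor P B l (P.circ h i p q) =
            (algOperad P B).toGr.circ h (zero_add 0).symm i (multTensor P B m p)
              (multTensor P B n q) := by
          refine Subtype.ext ?_
          change prodMul k B l ⊗ₜ[k] P.circ h i p q =
            (mcirc h i (prodMul k B m) (prodMul k B n)) ⊗ₜ[k] P.circ h i p q
          congr 1
          refine MultilinearMap.ext fun x => ?_
          exact (prod_circArg h i x).symm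
        change (algOperad P B).invOrbits.op (multTensor P B l (P.circ h i p q)) _ = _
        rw [e, OrbitSpaces.op_circ, Int.cast_zero, zero_mul, sgn_zero, one_smul]
        rfl }

/-- The operator `b ↦ b i • 1` on `k^n`. -/
def coordOp (k : Type u) [Field k] (n : ℕ) (i : Fin n) :
    MultilinearMap k (fun _ : Fin 1 => Fin n → k) (Fin n → k) :=
  MultilinearMap.ofSubsingleton k _ _ (0 : Fin 1) ((LinearMap.proj i).smulRight 1)

/-- The element `coordOp i ⊗ 1` of the algebra of orbits. -/
def orbitVar (n : ℕ) (i : Fin n) : (algOperad P (Fin n → k)).inv 1 :=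
  ⟨coordOp k n i ⊗ₜ[k] P.one, fun σ => by
    obtain rfl : σ = 1 := Subsingleton.elim _ _
    exact Operad.act_one _ _⟩

/-- Evaluation of the `End`-factor on `y`, followed by taking the `0`-th coordinate. -/
def evalCoord {A : Type v} [AddCommGroup A] [Module k A] {W : Type w} [AddCommGroup W] [Module k W]
    {m : ℕ} (y : Fin m → A) (ℓ : A →ₗ[k] k) :
    MultilinearMap k (fun _ : Fin m => A) A ⊗[k] W →ₗ[k] W :=
  TensorProduct.lift
    ((LinearMap.lsmul k W : k →ₗ[k] W →ₗ[k] W) ∘ₗ ℓ ∘ₗ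
      { toFun := fun ψ => ψ y
        map_add' := fun _ _ => rfl
        map_smul' := fun _ _ => rfl })

/-- Applying `mult ⊗ p` to the elements `coordOp i ⊗ 1` multiplies the coordinate functions and
leaves `p` unchanged, before averaging. The form `χ` takes the `j`-th coordinate of the `j`-th
argument, so it distinguishes the order of its arguments. -/
theorem orbitAlg_op_var (r : ℕ) (p : P.obj (r + 1)) :
    ∃ χ : MultilinearMap k (fun _ : Fin (r + 1) => Fin (r + 1) → k) (Fin (r + 1) → k),
      (∀ x, χ x = ∏ j, x j j • (1 : Fin (r + 1) → k)) ∧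
      (algOperad P (Fin (r + 1) → k)).invOrbits.op (multTensor P (Fin (r + 1) → k) (r + 1) p)
        (fun i => DirectSum.lof k ℕ
        (fun m => (algOperad P (Fin (r + 1) → k)).inv m) 1 (orbitVar P (r + 1) i)) =
      DirectSum.lof k ℕ (fun m => (algOperad P (Fin (r + 1) → k)).inv m) (r + 1)
        ((algOperad P (Fin (r + 1) → k)).averInv (r + 1) (χ ⊗ₜ[k] p)) := by
  set Q := algOperad P (Fin (r + 1) → k) with hQ
  have hL : r + 1 = ∑ _i : Fin (r + 1), 1 := by simp
  have hL' : r + 1 = 0 + ∑ _i : Fin (r + 1), 1 := by simp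
  have hg : (0 : ℤ) = 0 + ∑ _i : Fin (r + 1), 0 := by simp
  let one0 : P.toGr.obj 1 0 := P.toGr.one
  let p0 : P.toGr.obj (r + 1) 0 := ⟨p, P.zeroPiece_zero p⟩
  obtain ⟨χ, hχ, hχ'⟩ := gammaAux_tmul (O := Q.toGr) (R := P) (A := Fin (r + 1) → k)
    (fun n d => (Q.zeroPiece n d).subtype) (fun _ _ => 1)
    (fun h hd i x y => (one_smul k _).symm) (r + 1) (fun _ => 1) (fun _ => 0) hL'
    (fun _ => 0) (by simp) hg hg (multTensor P (Fin (r + 1) → k) (r + 1) p)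
    (fun i => Q.invOrbits.emb 1 (orbitVar P (r + 1) i)) 1 (prodMul k (Fin (r + 1) → k) (r + 1))
    (fun i => coordOp k (r + 1) i) p0 (fun _ => one0) (one_smul k _).symm (fun i => rfl)
  refine ⟨χ, fun x => ?_, ?_⟩
  · rw [hχ, MultilinearMap.mkPiAlgebra_apply]
    refine Finset.prod_congr rfl fun j _ => ?_
    rw [blockArg_ge _ _ _ _ j (by simp)]
    change x _ j • (1 : Fin (r + 1) → k) = _
    congr 3
    simp [finSigmaFinEquiv_apply]
  · have e := eq_of_heq (P.toGr.gammaAux_one (r + 1) p0 (s := 0) (by simp) (fun _ => 1) (fun _ => 0)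
      (fun _ => one0) hL' hg (fun _ => rfl) (fun _ => rfl) (fun _ => HEq.rfl))
    rw [e, blockCoeff_eq_one fun _ _ => rfl, mul_one, one_smul] at hχ'
    refine (Q.invOrbits.op_lof (multTensor P (Fin (r + 1) → k) (r + 1) p) (fun _ => 1)
      (fun i => orbitVar P (r + 1) i) hL hg).trans ?_
    exact congrArg (fun z => DirectSum.lof k ℕ (fun m => Q.inv m) (r + 1)
      (Q.averInv (r + 1) z)) hχ'

/-- The component of degree `m` in the algebra of orbits, evaluated by `evalCoord`. -/
def orbitEval (n m : ℕ) (y : Fin m → Fin (n + 1) → k) :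
    (⨁ m, (algOperad P (Fin (n + 1) → k)).inv m) →ₗ[k] P.obj m :=
  evalCoord y (LinearMap.proj 0 : (Fin (n + 1) → k) →ₗ[k] k) ∘ₗ
    ((algOperad P (Fin (n + 1) → k)).inv m).subtype ∘ₗ
      DirectSum.component k ℕ (fun m => (algOperad P (Fin (n + 1) → k)).inv m) m

omit [CharZero k] in
theorem orbitEval_lof (n m : ℕ) (y : Fin m → Fin (n + 1) → k)
    (z : (algOperad P (Fin (n + 1) → k)).inv m) :
    orbitEval P n m y (DirectSum.lof k ℕ (fun m => (algOperad P (Fin (n + 1) → k)).inv m) m z) =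
      evalCoord y (LinearMap.proj 0 : (Fin (n + 1) → k) →ₗ[k] k) z.1 :=
  congrArg (fun z : (algOperad P (Fin (n + 1) → k)).inv m =>
    evalCoord y (LinearMap.proj 0 : (Fin (n + 1) → k) →ₗ[k] k) z.1)
      (DirectSum.component.lof_self k (M := fun m => (algOperad P (Fin (n + 1) → k)).inv m) m z)

-- Evaluation at the `i`-th basis vector is dual to the elements `orbitVar`; it yields the operators
-- `φ i` of `exists_faithful`. Taking coordinate 0 loses nothing, the values being multiples of the
-- constant vector 1.
omit [CharZero k] in
theorem orbitEval_var (n : ℕ) (i j : Fin (n + 1)) :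
    orbitEval P n 1 (fun _ => Pi.single i 1) (DirectSum.lof k ℕ
      (fun m => (algOperad P (Fin (n + 1) → k)).inv m) 1 (orbitVar P (n + 1) j)) =
      if i = j then P.one else 0 := by
  rw [orbitEval_lof]
  have e : evalCoord (fun _ : Fin 1 => (Pi.single i 1 : Fin (n + 1) → k))
      (LinearMap.proj 0 : (Fin (n + 1) → k) →ₗ[k] k) (coordOp k (n + 1) j ⊗ₜ[k] P.one) =
      ((Pi.single i 1 : Fin (n + 1) → k) j * 1) • P.one := rfl
  refine e.trans ?_
  by_cases hij : i = j
  · subst hij; simp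
  · simp [hij, Ne.symm hij]

omit [CharZero k] in
theorem evalCoord_averInv (n r : ℕ) (y : Fin r → Fin (n + 1) → k)
    (χ : MultilinearMap k (fun _ : Fin r => Fin (n + 1) → k) (Fin (n + 1) → k)) (p : P.obj r) :
    evalCoord y (LinearMap.proj 0 : (Fin (n + 1) → k) →ₗ[k] k)
      ((algOperad P (Fin (n + 1) → k)).averInv r (χ ⊗ₜ[k] p)).1 =
    (Fintype.card (Equiv.Perm (Fin r)) : k)⁻¹ •
      ∑ σ : Equiv.Perm (Fin r), χ (fun i => y (σ.symm i)) 0 • P.act σ p := by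
  let ev : (algOperad P (Fin (n + 1) → k)).obj r →ₗ[k] P.obj r :=
    evalCoord y (LinearMap.proj 0 : (Fin (n + 1) → k) →ₗ[k] k)
  have e := congrArg ev (average_apply
    (fun σ => (algOperad P (Fin (n + 1) → k)).act σ) (χ ⊗ₜ[k] p))
  refine e.trans ?_
  rw [map_smul, map_sum]
  rfl

/-- Every operation of positive arity is determined by its value on suitable independent elements
of some algebra. -/
theorem exists_faithful (r : ℕ) : ∃ (A : P.Alg) (x : Fin (r + 1) → A.carrier)
    (φ : Fin (r + 1) → A.carrier →ₗ[k] A.carrier) (ρ : A.carrier →ₗ[k] P.obj (r + 1)),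
    (∀ i j, φ i (x j) = if i = j then x i else 0) ∧ ∀ p, ρ (A.op p x) = p := by
  by_cases h1 : P.one = 0
  · refine ⟨orbitAlg P (Fin (r + 1) → k), fun _ => 0, fun _ => 0, 0, by simp, fun p => ?_⟩
    rw [← P.circ_one rfl 0 p, h1]
    simp
  · obtain ⟨ℓ, hℓ⟩ : ∃ ℓ : P.obj 1 →ₗ[k] k, ℓ P.one = 1 :=
      Module.Projective.exists_dual_eq_one k h1
    let x : Fin (r + 1) → ⨁ m, (algOperad P (Fin (r + 1) → k)).inv m := fun i =>
      DirectSum.lof k ℕ (fun m => (algOperad P (Fin (r + 1) → k)).inv m) 1 (orbitVar P (r + 1) i)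
    -- `φ i` reads off the coefficient of `x i` by means of `ℓ`. The factor `(r + 1)!` in `ρ`
    -- cancels the denominator of the average.
    refine ⟨orbitAlg P (Fin (r + 1) → k), x, fun i =>
      (ℓ ∘ₗ orbitEval P r 1 (fun _ => Pi.single i 1)).smulRight (x i),
      (Fintype.card (Equiv.Perm (Fin (r + 1))) : k) •
        orbitEval P r (r + 1) (fun i => Pi.single i 1), fun i j => ?_, fun p => ?_⟩
    · refine (congrArg (fun z => ℓ z • x i) (orbitEval_var P r i j)).trans ?_
      by_cases hij : i = j
      · refine Eq.trans ?_ (if_pos hij).symm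
        rw [if_pos hij, hℓ, one_smul]
      · refine Eq.trans ?_ (if_neg hij).symm
        rw [if_neg hij, map_zero, zero_smul]
        rfl
    · obtain ⟨χ, hχ, hop⟩ := orbitAlg_op_var P r p
      refine (congrArg ((Fintype.card (Equiv.Perm (Fin (r + 1))) : k) •
        orbitEval P r (r + 1) (fun i => Pi.single i 1)) hop).trans ?_
      refine (congrArg ((Fintype.card (Equiv.Perm (Fin (r + 1))) : k) • ·)
        ((orbitEval_lof P r (r + 1) _ _).trans (evalCoord_averInv P r (r + 1) _ χ p))).trans ?_
      rw [smul_smul, mul_inv_cancel₀ card_perm_ne_zero, one_smul, Finset.sum_eq_single 1]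
      · rw [P.act_one, hχ]
        have e1 : ∏ x : Fin (r + 1), (Pi.single ((1 : Equiv.Perm (Fin (r + 1))).symm x) 1 :
            Fin (r + 1) → k) x • (1 : Fin (r + 1) → k) = 1 := Finset.prod_eq_one fun x _ => by
          change (Pi.single x 1 : Fin (r + 1) → k) x • _ = _
          rw [Pi.single_eq_same, one_smul]
        rw [e1]
        exact one_smul k p
      · intro σ _ hσ
        -- At an index `j` moved by `σ`, the `j`-th coordinate of the basis vector numbered `σ⁻¹ j`
        -- is zero, so the product vanishes.
        obtain ⟨j, hj⟩ : ∃ j, σ.symm j ≠ j := by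
          by_contra hcon
          push Not at hcon
          exact hσ (Equiv.ext fun j => by simpa using (hcon (σ j)).symm)
        rw [hχ, Finset.prod_eq_zero (Finset.mem_univ j)]
        · simp
        · simp [Ne.symm hj]
      · intro h; exact absurd (Finset.mem_univ _) h

end FaithfulAlgebra

/-! ### Quadratic operads in arities zero and one. -/

section SmallArities

variable {k : Type u} [Field k]

theorem Mon.arity_pos {E : Type v} {n : ℕ} (x : Mon E n) : 0 < n := by
  induction x with
  | gen e => norm_num
  | one => norm_num
  | act σ x ih => exact ih
  | circ h i x y ihx ihy => omega

/-- All arities being positive, a composite of arity 1 has both factors of arity 1, and the unit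
axioms collapse it. The arity is a variable with `n = 1` so that induction on the indexed family
`Mon` is possible. -/
theorem freeOperad_single_heq {E : Type v} [AddCommGroup E] [Module k E] (s : E →ₗ[k] E) {n : ℕ}
    (x : Mon E n) (hn : n = 1) :
    HEq (Submodule.Quotient.mk (Finsupp.single x 1) : (freeOperad k s).obj n)
      (freeOperad k s).one := by
  induction x with
  | gen e => omega
  | one => exact HEq.rfl
  | act σ x ih =>
    subst hn
    obtain rfl : σ = 1 := Subsingleton.elim _ _
    have := (freeIdeal_mk_eq k (s := s) (MonRel.act_one x) 1)
    exact (heq_of_eq this).trans (ih rfl)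
  | @circ m n l h i x y ihx ihy =>
    have hx := x.arity_pos
    have hy := y.arity_pos
    obtain rfl : m = 1 := by omega
    obtain rfl : n = 1 := by omega
    subst hn
    have e : (Submodule.Quotient.mk (Finsupp.single (Mon.circ h i x y) 1) :
        (freeOperad k s).obj 1) = (freeOperad k s).circ h i
          (Submodule.Quotient.mk (Finsupp.single x 1)) (Submodule.Quotient.mk (Finsupp.single y 1)) := by
      change _ = Submodule.Quotient.mk (preCirc k h i (Finsupp.single x 1) (Finsupp.single y 1))
      rw [preCirc_single, one_mul]
    rw [e, eq_of_heq (ihx rfl), eq_of_heq (ihy rfl)]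
    exact heq_of_eq ((freeOperad k s).circ_one h i _)

theorem freeOperad_arity_zero {E : Type v} [AddCommGroup E] [Module k E] (s : E →ₗ[k] E)
    (x : (freeOperad k s).obj 0) : x = 0 := by
  obtain ⟨p, rfl⟩ := Submodule.Quotient.mk_surjective _ x
  have : p = 0 := Finsupp.ext fun y => absurd y.arity_pos (lt_irrefl 0)
  rw [this]
  rfl

theorem freeOperad_arity_one {E : Type v} [AddCommGroup E] [Module k E] (s : E →ₗ[k] E)
    (x : (freeOperad k s).obj 1) : ∃ c : k, x = c • (freeOperad k s).one := by
  obtain ⟨p, rfl⟩ := Submodule.Quotient.mk_surjective _ x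
  induction p using Finsupp.induction_linear with
  | zero => exact ⟨0, (zero_smul _ _).symm⟩
  | add p q hp hq =>
    obtain ⟨c, hc⟩ := hp
    obtain ⟨d, hd⟩ := hq
    exact ⟨c + d, (congrArg₂ (· + ·) hc hd).trans (add_smul _ _ _).symm⟩
  | single y c =>
    refine ⟨c, ?_⟩
    have h := eq_of_heq (freeOperad_single_heq s y rfl)
    rw [← h]
    have e : (Finsupp.single y c : PreFree k E 1) = c • Finsupp.single y 1 := by simp
    rw [e]
    rfl

namespace QuadraticData

variable (D : QuadraticData.{u} k)

theorem operad_arity_zero (x : D.operad.obj 0) : x = 0 := by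
  obtain ⟨p, rfl⟩ := Submodule.Quotient.mk_surjective _ x
  rw [freeOperad_arity_zero D.s p]
  rfl

theorem operad_arity_one (x : D.operad.obj 1) : ∃ c : k, x = c • D.operad.one := by
  obtain ⟨p, rfl⟩ := Submodule.Quotient.mk_surjective _ x
  obtain ⟨c, rfl⟩ := freeOperad_arity_one D.s p
  exact ⟨c, rfl⟩

theorem endTensor_arity_zero (A : D.operad.Alg) (x : (D.endTensor A).obj 0) : x = 0 := by
  change (_ ⊗[k] _) at x
  induction x using TensorProduct.induction_on with
  | zero => rfl
  | tmul φ q => rw [D.dual.operad_arity_zero q]; exact TensorProduct.tmul_zero _ _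
  | add x y hx hy => rw [hx, hy]; exact add_zero _

end QuadraticData

end SmallArities

/-! ### The cochains as orbit spaces of `Λ(End_A ⊗ P^!)`. -/

section CochainOrbits

variable {k : Type u} [Field k] (D : QuadraticData.{u} k)

namespace QuadraticData

/-- The inclusion of the cochains into `Λ(End_A ⊗ P^!)`. -/
def cochainEmb (A : D.operad.Alg) (m : ℕ) : D.C A m →ₗ[k] (D.endTensor A).susp.obj (m + 1) m where
  toFun f := D.tildeUp A (f : D.TildeC A m)
  map_add' _ _ := rfl
  map_smul' _ _ := rfl

/-- The forgetful map from `Λ(End_A ⊗ P^!)(m+1)` to `TildeC A m`. -/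
def suspVal (A : D.operad.Alg) (N : ℕ) (d : ℤ) :
    (D.endTensor A).susp.obj N d →ₗ[k] (D.endTensor A).obj N :=
  ((D.endTensor A).suspPiece N d).subtype

/-- The projection of `Λ(End_A ⊗ P^!)` onto the cochains. -/
def cochainProj (A : D.operad.Alg) : ∀ (N : ℕ) (d : ℤ),
    (D.endTensor A).susp.obj N d →ₗ[k] ⨁ m, D.C A m
  -- There is no cochain of degree `-1`, and nothing is lost: `End_A ⊗ P^!` vanishes in arity zero.
  | 0, _ => 0
  | N + 1, d => DirectSum.lof k ℕ (fun m => D.C A m) N ∘ₗ D.aver A ∘ₗ D.suspVal A (N + 1) d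

theorem aver_sact (A : D.operad.Alg) {m : ℕ} (σ : Equiv.Perm (Fin (m + 1))) (x : D.TildeC A m) :
    D.aver A (D.sact A σ x) = D.aver A x :=
  Subtype.ext (average_act (D.sact_mul A) σ x)

variable [CharZero k]

theorem aver_coe (A : D.operad.Alg) {m : ℕ} (f : D.C A m) : D.aver A (f : D.TildeC A m) = f :=
  Subtype.ext (average_eq f.2)

/-- The cochains realize the orbits of `Λ(End_A ⊗ P^!)`. -/
def cochainOrbits (A : D.operad.Alg) : OrbitSpaces (D.endTensor A).susp (fun m => D.C A m) where
  ar m := m + 1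
  deg m := m
  emb := D.cochainEmb A
  proj := D.cochainProj A
  proj_act
    | 0, _, _, _ => rfl
    | N + 1, d, σ, x => congrArg (DirectSum.lof k ℕ (fun m => D.C A m) N)
        (D.aver_sact A σ (D.suspVal A (N + 1) d x))
  proj_emb m v := congrArg (DirectSum.lof k ℕ (fun m => D.C A m) m) (D.aver_coe A v)
  exists_emb m y := ⟨D.aver A (D.suspVal A (m + 1) m y), rfl, by
    have h := sub_average_mem (fun σ =>
      ((D.endTensor A).susp.act σ : (D.endTensor A).susp.obj (m + 1) m →ₗ[k] _)) y
    have e := map_average (ρ := fun σ =>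
      ((D.endTensor A).susp.act σ : (D.endTensor A).susp.obj (m + 1) m →ₗ[k] _))
      (ρ' := fun σ => D.sact A σ) (D.suspVal A (m + 1) m) (fun _ _ => rfl) y
    have e' : average (fun σ =>
        ((D.endTensor A).susp.act σ : (D.endTensor A).susp.obj (m + 1) m →ₗ[k] _)) y =
      D.cochainEmb A m (D.aver A (D.suspVal A (m + 1) m y)) := Subtype.ext e
    rw [e'] at h
    exact h⟩
  cover
    -- The components not indexed by any `m` are those of arity 0 and those of degree different from
    -- arity minus one; both are zero.
    | 0, d => Or.inl fun y => Subtype.ext (D.endTensor_arity_zero A y.1)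
    | N + 1, d => by
      by_cases hd : (N : ℤ) = d
      · exact Or.inr ⟨N, rfl, hd⟩
      · exact Or.inl fun y => Subtype.ext (((D.endTensor A).mem_suspPiece.1 y.2).resolve_left
          fun h => hd (by push_cast at h; omega))

end QuadraticData

end CochainOrbits

/-! ### The operations of `Λ(P ⊗ P^!)` on cochains and their operadic laws. -/

section Cup

variable {k : Type u} [Field k] [CharZero k] (D : QuadraticData.{u} k)

namespace QuadraticData

/-- The homomorphism `Λ(α ⊗ id)`. -/
abbrev suspAlg (A : D.operad.Alg) : D.cupOperad.Hom (D.endTensor A).susp :=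
  (A.α.tensor (Operad.Hom.id D.dual.operad)).susp

/-- The operation on the cochains of `A` given by an element of `Λ(P ⊗ P^!)`. -/
def cupOn (A : D.operad.Alg) (n : ℕ) (d : ℤ) : D.cupOperad.obj n d →ₗ[k]
    MultilinearMap k (fun _ : Fin n => ⨁ m, D.C A m) (⨁ m, D.C A m) :=
  (D.cochainOrbits A).op ∘ₗ (D.suspAlg A).app n d

/-- The explicit formula for `cup`: on homogeneous arguments the orbit action is `γ` followed by the
projection, which here is the averaging. -/
theorem cupOn_lof (A : D.operad.Alg) {n : ℕ} {d : ℤ} (t : D.cupOperad.obj n d) (m : Fin n → ℕ)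
    (f : ∀ i, D.C A (m i)) {M : ℕ} (hM : M + 1 = ∑ i, (m i + 1)) :
    D.cupOn A n d t (fun i => DirectSum.lof k ℕ (fun m => D.C A m) (m i) (f i)) =
      DirectSum.lof k ℕ (fun m => D.C A m) M (D.aver A (D.cupTilde A t f hM)) :=
  (D.cochainOrbits A).op_lof ((D.suspAlg A).app n d t) m f hM rfl

omit [CharZero k] in
theorem cupOperad_eq_zero {n : ℕ} {d : ℤ} (h : n = 0 ∨ d + 1 ≠ n) (t : D.cupOperad.obj n d) :
    t = 0 := by
  rcases h with rfl | h
  · refine Subtype.ext ?_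
    change (t.1 : D.operad.obj 0 ⊗[k] D.dual.operad.obj 0) = 0
    generalize (t.1 : D.operad.obj 0 ⊗[k] D.dual.operad.obj 0) = x
    induction x using TensorProduct.induction_on with
    | zero => rfl
    | tmul p q => rw [D.operad_arity_zero p]; exact TensorProduct.zero_tmul _ _
    | add x y hx hy => rw [hx, hy]; exact add_zero _
  · exact Subtype.ext (((D.operad.tensor D.dual.operad).mem_suspPiece.1 t.2).resolve_left h)

theorem cupOn_homog (A : D.operad.Alg) {n : ℕ} {d : ℤ} (t : D.cupOperad.obj n d) :
    D.cupOn A n d t ∈ homog k (fun m => D.C A m) n d := by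
  by_cases h : n = 0 ∨ d + 1 ≠ n
  · rw [D.cupOperad_eq_zero h t, map_zero]
    exact zero_mem _
  · push Not at h
    obtain ⟨hn, hd⟩ := h
    intro p v M hM
    have e : ∑ i, (p i + 1) = ∑ i, p i + n := by simp [Finset.sum_add_distrib]
    -- The total arity is the sum of the `p i + 1`, and the degree is one less; the subtraction is
    -- not truncated because `n` is nonzero. As `d = n - 1`, this is the sum of the `p i` plus `d`.
    rw [D.cupOn_lof A t p v (M := ∑ i, p i + n - 1) (by omega), DirectSum.lof_eq_of,
      DirectSum.of_eq_of_ne]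
    intro h
    apply hM
    have : (∑ i, p i : ℤ) = ((∑ i, p i : ℕ) : ℤ) := by push_cast; rfl
    rw [this]
    omega

/-- The family of operations on cochains given by an element of `Λ(P ⊗ P^!)`. -/
def cupFamily (n : ℕ) (d : ℤ) : D.cupOperad.obj n d →ₗ[k] D.familyOperad.obj n d :=
  LinearMap.pi fun A => LinearMap.codRestrict (homog k (fun m => D.C A m) n d) (D.cupOn A n d)
    fun t => D.cupOn_homog A t

omit [CharZero k] in
theorem hasPar_hom {V : ℕ → Type v} [∀ m, AddCommGroup (V m)] [∀ m, Module k (V m)]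
    (w : Σ m, V m) : HasPar (w.1 : ZMod 2) (OrbitSpaces.hom k w) := hasPar_lof _ _

theorem cupOn_act (A : D.operad.Alg) {n : ℕ} {d : ℤ} (σ : Equiv.Perm (Fin n))
    (t : D.cupOperad.obj n d) :
    D.cupOn A n d (D.cupOperad.act σ t) = gact σ (D.cupOn A n d t) := ext_hom fun w => by
  rw [gact_apply σ _ (fun i => ((w i).1 : ZMod 2)) _ fun i => hasPar_hom (w i)]
  refine (congrArg (fun z => (D.cochainOrbits A).op z fun i => OrbitSpaces.hom k (w i))
    ((D.suspAlg A).map_act σ t)).trans ?_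
  refine ((D.cochainOrbits A).op_act σ _ w).trans ?_
  have e : (fun i => (((D.cochainOrbits A).deg (w i).1 : ℤ) : ZMod 2)) =
    fun i => ((w i).1 : ZMod 2) := funext fun i => Int.cast_natCast _
  rw [e]
  rfl

theorem cupOn_one (A : D.operad.Alg) (w : Fin 1 → Σ m, D.C A m) :
    D.cupOn A 1 0 D.cupOperad.one (fun i => OrbitSpaces.hom k (w i)) = OrbitSpaces.hom k (w 0) :=
  (congrArg (fun z => (D.cochainOrbits A).op z fun i => OrbitSpaces.hom k (w i))
    (D.suspAlg A).map_one).trans ((D.cochainOrbits A).op_one w)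

/-- The sign in `op_circ` is governed by the degrees in `Λ(End_A ⊗ P^!)`, the one in `gcirc` by the
degrees of cochains; both equal `m` on `C^m`. -/
theorem cupOn_circ (A : D.operad.Alg) {m n l : ℕ} {d e g : ℤ} (h : l + 1 = m + n) (hd : g = d + e)
    (i : Fin m) (x : D.cupOperad.obj m d) (y : D.cupOperad.obj n e) :
    D.cupOn A l g (D.cupOperad.circ h hd i x y) =
      gcirc e h i (D.cupOn A m d x) (D.cupOn A n e y) := ext_hom fun w => by
  rw [gcirc_apply (e : ZMod 2) h i _ _ (fun i => ((w i).1 : ZMod 2)) _ fun i => hasPar_hom (w i)]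
  refine (congrArg (fun z => (D.cochainOrbits A).op z fun i => OrbitSpaces.hom k (w i))
    ((D.suspAlg A).map_circ h hd i x y)).trans ?_
  refine ((D.cochainOrbits A).op_circ h hd i _ _ w).trans ?_
  have e : (fun i => (((D.cochainOrbits A).deg (w i).1 : ℤ) : ZMod 2)) =
    fun i => ((w i).1 : ZMod 2) := funext fun i => Int.cast_natCast _
  rw [e]
  rfl

omit [CharZero k] in
theorem naturalSpan_le (n : ℕ) (d : ℤ) :
    D.naturalSpan n d ≤ (D.familyOperad.subSpan D.naturalSpan).carrier n d :=
  le_iInf fun I => I.2 n d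

/-- The morphism `cup`, given that its values are natural operations. -/
def cupHom (H : ∀ n d (t : D.cupOperad.obj n d), D.cupFamily n d t ∈ D.naturalSpan n d) :
    D.cupOperad.Hom D.natOperad where
  app n d := LinearMap.codRestrict ((D.familyOperad.subSpan D.naturalSpan).carrier n d)
    (D.cupFamily n d) fun t => D.naturalSpan_le n d (H n d t)
  map_act σ t := Subtype.ext (funext fun A => Subtype.ext (D.cupOn_act A σ t))
  map_one := Subtype.ext (funext fun A => Subtype.ext (ext_hom fun w => D.cupOn_one A w))
  map_circ h hd i x y := Subtype.ext (funext fun A => Subtype.ext (D.cupOn_circ A h hd i x y))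

end QuadraticData

end Cup

/-! ### The values of `cup` are natural operations. -/

section Membership

variable {k : Type u} [Field k] (D : QuadraticData.{u} k)

namespace DTree

variable {P : Operad.{u, u} k} {n : ℕ} {a : Fin n → ℕ} {M : ℕ}

/-- The position of the `u`-th element of the `i`-th block. -/
def blockPos (hM : M + 1 = ∑ i, a i) (i : Fin n) (u : Fin (a i)) : Fin (M + 1) :=
  ⟨finSigmaFinEquiv ⟨i, u⟩, by omega⟩

/-- The corolla with root the `i`-th white vertex and the `i`-th block of legs. -/
def block (hM : M + 1 = ∑ i, a i) (i : Fin n) : DTree P a (Fin (M + 1)) :=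
  white i fun u => leg (blockPos hM i u)

/-- The positions `blockPos` enumerate the legs bijectively, through `finSigmaFinEquiv`. -/
theorem sum_legCount_block (hM : M + 1 = ∑ i, a i) (x : Fin (M + 1)) :
    ∑ i, (block (P := P) hM i).legCount x = 1 := by
  let g : ((i : Fin n) × Fin (a i)) ≃ Fin (M + 1) := finSigmaFinEquiv.trans (finCongr hM.symm)
  have e : ∑ i, (block (P := P) hM i).legCount x =
      ∑ z : (i : Fin n) × Fin (a i), if g z = x then 1 else 0 :=
    (Fintype.sum_sigma fun z : (i : Fin n) × Fin (a i) => if g z = x then 1 else 0).symm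
  rw [e, Equiv.sum_comp g (fun y => if y = x then 1 else 0)]
  simp

theorem sum_whiteCount_block (hM : M + 1 = ∑ i, a i) (j : Fin n) :
    ∑ i, (block (P := P) hM i).whiteCount j = 1 := by
  have e : ∀ i, (block (P := P) hM i).whiteCount j = if i = j then 1 else 0 := fun i => by
    simp [block, whiteCount]
  simp [e]

theorem proper_black (hn : 2 ≤ n) (p : P.obj n) (hM : M + 1 = ∑ i, a i) :
    (black hn p (block hM)).Proper :=
  ⟨fun x => sum_legCount_block hM x, fun j => sum_whiteCount_block hM j⟩

theorem proper_block {a : Fin 1 → ℕ} (hM : M + 1 = ∑ i, a i) :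
    (block (P := P) hM 0).Proper :=
  ⟨fun x => (Fin.sum_univ_one _).symm.trans (sum_legCount_block hM x),
    fun j => (Fin.sum_univ_one _).symm.trans (sum_whiteCount_block hM j)⟩

end DTree

namespace QuadraticData

/-- The element `p ⊗ q` of `Λ(P ⊗ P^!)`. -/
def cupMk {n : ℕ} {d : ℤ} (hd : d + 1 = n) :
    D.operad.obj n ⊗[k] D.dual.operad.obj n →ₗ[k] D.cupOperad.obj n d :=
  LinearMap.codRestrict ((D.operad.tensor D.dual.operad).suspPiece n d) LinearMap.id
    fun _ => (D.operad.tensor D.dual.operad).mem_suspPiece.2 (Or.inl hd)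

/-- Composition in `P^!`, as a multilinear map. -/
def dualGamma {n M : ℕ} {m : Fin n → ℕ} (hM : M + 1 = ∑ i, (m i + 1)) (q : D.dual.operad.obj n) :
    MultilinearMap k (fun i => D.dual.operad.obj (m i + 1)) (D.dual.operad.obj (M + 1)) :=
  ((D.dual.operad.zeroPiece (M + 1) 0).subtype.compMultilinearMap
    (D.dual.operad.toGr.gammaMul (d := 0) (a := fun i => m i + 1) (e := fun _ => 0) hM (by simp)
      ⟨q, D.dual.operad.zeroPiece_zero q⟩)).compLinearMap
        fun _ => LinearMap.codRestrict (D.dual.operad.zeroPiece _ 0) LinearMap.id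
          D.dual.operad.zeroPiece_zero

/-- The multilinear map on all of `TildeC` underlying `cupTilde`. -/
def cupMul (A : D.operad.Alg) {n M : ℕ} {d : ℤ} (m : Fin n → ℕ) (hM : M + 1 = ∑ i, (m i + 1))
    (t : D.cupOperad.obj n d) :
    MultilinearMap k (fun i => D.TildeC A (m i)) (D.TildeC A M) :=
  ((D.suspVal A (M + 1) _).compMultilinearMap
    ((D.endTensor A).susp.gammaMul (a := fun i => m i + 1) (e := fun i => ((m i : ℕ) : ℤ)) hM
      (rfl : _ = d + ∑ i, ((m i : ℕ) : ℤ))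
      ((A.α.tensor (Operad.Hom.id D.dual.operad)).susp.app n d t))).compLinearMap
    fun _ =>
      { toFun := fun x => D.tildeUp A x
        map_add' := fun _ _ => rfl
        map_smul' := fun _ _ => rfl }

/-- On pure tensors the composite separates into a two-level composite in `End_A`, a composite in
`P^!`, and a sign depending only on the multidegree. -/
theorem cupMul_tmk {n M : ℕ} {d : ℤ} (hd : d + 1 = n) (m : Fin n → ℕ)
    (hM : M + 1 = ∑ i, (m i + 1)) (p : D.operad.obj n) (q₀ : D.dual.operad.obj n)
    (A : D.operad.Alg) (φ : ∀ i, D.Lin A (m i + 1)) (q : ∀ i, D.dual.operad.obj (m i + 1)) :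
    ∃ χ : D.Lin A (M + 1),
      (∀ x, χ x = A.op p fun i => φ i fun u => x (DTree.blockPos hM i u)) ∧
      D.cupMul A m hM (D.cupMk hd (p ⊗ₜ q₀)) (fun i => D.tmk A (φ i) (q i)) =
        blockCoeff (fun i e => sgn k (i * e)) n 0 (fun i => m i + 1) (fun i => ((m i : ℕ) : ℤ)) •
          D.tmk A χ (D.dualGamma hM q₀ q) := by
  obtain ⟨χ, hχ, hχ'⟩ := gammaAux_tmul (O := (D.endTensor A).susp) (R := D.dual.operad)
    (A := A.carrier) (fun n d => D.suspVal A n d) (fun i e => sgn k (i * e))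
    (fun h hd i x y => rfl) n (fun i => m i + 1) (fun i => ((m i : ℕ) : ℤ)) (s := 0) (L := M + 1)
    (by omega) (N := n) (d := d) (g := d + ∑ i, ((m i : ℕ) : ℤ)) (d' := 0) (g' := 0) (fun _ => 0)
    (by omega) rfl (by simp)
    ((A.α.tensor (Operad.Hom.id D.dual.operad)).susp.app n d (D.cupMk hd (p ⊗ₜ q₀)))
    (fun i => D.tildeUp A (D.tmk A (φ i) (q i))) 1 (A.op p) φ
    ⟨q₀, D.dual.operad.zeroPiece_zero q₀⟩
    (fun i => ⟨q i, D.dual.operad.zeroPiece_zero (q i)⟩) (one_smul k _).symm (fun i => rfl)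
  refine ⟨χ, fun x => ?_, ?_⟩
  · rw [hχ]
    refine congrArg (A.op p) (funext fun i => ?_)
    rw [blockArg_ge _ _ _ _ i (by simp)]
    simp only [Nat.zero_add]
    rfl
  · rw [one_mul] at hχ'
    exact hχ'

/-- The sign is the same for all `A` and all cochains of the given multidegree, so it can be
absorbed into `Φ`. The tree enters only through its evaluation, which allows different trees in
arity 1 and in higher arities. -/
theorem isOp_of_eval [CharZero k] {n M : ℕ} {d : ℤ} (hd : d + 1 = n) (m : Fin n → ℕ)
    (hM : M + 1 = ∑ i, (m i + 1)) (p : D.operad.obj n) (q₀ : D.dual.operad.obj n)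
    (T : DTree D.operad (fun i => m i + 1) (Fin (M + 1))) (hT : T.Proper)
    (he : ∀ (A : D.operad.Alg) (φ : ∀ i, D.Lin A (m i + 1)) (x : Fin (M + 1) → A.carrier),
      T.eval A φ x = A.op p fun i => φ i fun u => x (DTree.blockPos hM i u)) :
    (fun A => (D.aver A).compMultilinearMap ((D.cupMul A m hM (D.cupMk hd (p ⊗ₜ q₀))).compLinearMap
      fun i => (D.C A (m i)).subtype) : D.OpFamily m M) ∈ D.opSpan m M := by
  refine Submodule.subset_span ⟨T, blockCoeff (fun i e => sgn k (i * e)) n 0 (fun i => m i + 1)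
    (fun i => ((m i : ℕ) : ℤ)) • D.dualGamma hM q₀, hT, fun A =>
    ⟨D.cupMul A m hM (D.cupMk hd (p ⊗ₜ q₀)), fun φ q => ?_, fun f => rfl⟩⟩
  obtain ⟨χ, hχ, hχ'⟩ := D.cupMul_tmk hd m hM p q₀ A φ q
  refine ⟨χ, fun x => (hχ x).trans (he A φ x).symm, hχ'.trans ?_⟩
  exact (TensorProduct.tmul_smul _ _ _).symm

variable [CharZero k]

theorem cupFamily_mem_of_eval {n : ℕ} {d : ℤ} (hd : d + 1 = n) (p : D.operad.obj n)
    (q : D.dual.operad.obj n)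
    (H : ∀ (m : Fin n → ℕ) (M : ℕ) (hM : M + 1 = ∑ i, (m i + 1)),
      ∃ T : DTree D.operad (fun i => m i + 1) (Fin (M + 1)), T.Proper ∧
      ∀ (A : D.operad.Alg) (φ : ∀ i, D.Lin A (m i + 1)) (x : Fin (M + 1) → A.carrier),
      T.eval A φ x = A.op p fun i => φ i fun u => x (DTree.blockPos hM i u)) :
    D.cupFamily n d (D.cupMk hd (p ⊗ₜ q)) ∈ D.naturalSpan n d := by
  intro m M hM
  have hM' : M + 1 = ∑ i, (m i + 1) := by
    have e : ∑ i, (m i + 1) = ∑ i, m i + n := by simp [Finset.sum_add_distrib]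
    have : (∑ i, m i : ℤ) = ((∑ i, m i : ℕ) : ℤ) := by push_cast; rfl
    rw [this] at hM
    omega
  obtain ⟨T, hT, he⟩ := H m M hM'
  exact ⟨_, D.isOp_of_eval hd m hM' p q T hT he, fun A f => D.cupOn_lof A _ m f hM'⟩

theorem cupFamily_mem (n : ℕ) (d : ℤ) (t : D.cupOperad.obj n d) :
    D.cupFamily n d t ∈ D.naturalSpan n d := by
  by_cases h : n = 0 ∨ d + 1 ≠ n
  · rw [D.cupOperad_eq_zero h t, map_zero]
    exact zero_mem _
  push Not at h
  obtain ⟨hn, hd⟩ := h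
  have key : ∀ x : D.operad.obj n ⊗[k] D.dual.operad.obj n,
      D.cupFamily n d (D.cupMk hd x) ∈ D.naturalSpan n d := by
    intro x
    induction x using TensorProduct.induction_on with
    | zero => rw [map_zero, map_zero]; exact zero_mem _
    | add x y hx hy => rw [map_add, map_add]; exact add_mem hx hy
    | tmul p q =>
      by_cases h2 : 2 ≤ n
      -- The evaluation of a black root with white corollas is the required composite by definition.
      · exact D.cupFamily_mem_of_eval hd p q fun m M hM =>
          ⟨_, DTree.proper_black h2 p hM, fun A φ x => rfl⟩
      · obtain rfl : n = 1 := by omega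
        obtain ⟨c, rfl⟩ := D.operad_arity_one p
        -- The scalar moves to the `P^!`-factor, where `Φ` absorbs it. The first factor is now the
        -- unit, which acts as the identity, so the tree without black vertices serves.
        rw [TensorProduct.smul_tmul]
        refine D.cupFamily_mem_of_eval hd _ _ fun m M hM =>
          ⟨_, DTree.proper_block hM, fun A φ x => ?_⟩
        have e : A.op D.operad.one = (endOp k A.carrier).one := A.α.map_one
        rw [e]
        rfl
  exact key t.1

/-- The morphism `cup`. -/
def cup : D.cupOperad.Hom D.natOperad := D.cupHom D.cupFamily_mem

end QuadraticData

end Membership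

/-! ### Injectivity of `cup`. -/

section Injectivity

variable {k : Type u} [Field k] (D : QuadraticData.{u} k)

namespace QuadraticData

theorem sact_one (A : D.operad.Alg) {m : ℕ} (x : D.TildeC A m) : D.sact A 1 x = x := by
  simp only [sact, (D.endTensor A).act_one, Equiv.Perm.sign_one,
    Units.val_one, Int.cast_one, one_smul]

/-- The linear endomorphism `φ` as a cochain of degree `0`. -/
def cochainOfEnd (A : D.operad.Alg) (φ : A.carrier →ₗ[k] A.carrier) : D.C A 0 :=
  ⟨D.tmk A (MultilinearMap.ofSubsingleton k A.carrier A.carrier (0 : Fin 1) φ)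
    D.dual.operad.one, fun σ => by
      obtain rfl : σ = 1 := Subsingleton.elim (α := Equiv.Perm (Fin 1)) _ _
      exact D.sact_one A _⟩

/-- Cochains of degree 0 contribute no sign, and their `P^!`-factors are units, so `q₀` survives
unchanged. -/
theorem cupMul_cochainOfEnd {r : ℕ} {d : ℤ} (hd : d + 1 = (r + 1 : ℕ))
    (hM : r + 1 = ∑ _i : Fin (r + 1), (0 + 1)) (p : D.operad.obj (r + 1))
    (q₀ : D.dual.operad.obj (r + 1)) (A : D.operad.Alg)
    (φ : Fin (r + 1) → A.carrier →ₗ[k] A.carrier) :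
    ∃ χ : D.Lin A (r + 1), (∀ x, χ x = A.op p fun i => φ i (x i)) ∧
      D.cupMul A (fun _ => 0) hM (D.cupMk hd (p ⊗ₜ q₀)) (fun i => (D.cochainOfEnd A (φ i)).1) =
        D.tmk A χ q₀ := by
  obtain ⟨χ, hχ, hχ'⟩ := D.cupMul_tmk hd (fun _ => 0) hM p q₀ A
    (fun i => MultilinearMap.ofSubsingleton k A.carrier A.carrier (0 : Fin 1) (φ i))
    (fun _ => D.dual.operad.one)
  refine ⟨χ, fun x => ?_, hχ'.trans ?_⟩
  · rw [hχ]
    refine congrArg (A.op p) (funext fun i => congrArg (fun j => φ i (x j)) (Fin.ext ?_))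
    change ((finSigmaFinEquiv (⟨i, 0⟩ : (_ : Fin (r + 1)) × Fin (0 + 1)) : Fin _) : ℕ) = i
    simp [finSigmaFinEquiv_apply]
  · rw [blockCoeff_eq_one (fun i j => by simp [sgn_zero]), one_smul]
    refine congrArg (D.tmk A χ) ?_
    have e := eq_of_heq (D.dual.operad.toGr.gammaAux_one (r + 1) (N := r + 1) (s := 0)
      (L := r + 1) (d := 0) (g := 0) ⟨q₀, D.dual.operad.zeroPiece_zero q₀⟩ (by omega)
      (fun _ => 0 + 1) (fun _ => 0) (fun _ => D.dual.operad.toGr.one) (by omega) (by simp)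
      (fun _ => rfl) (fun _ => rfl) (fun _ => HEq.rfl))
    exact congrArg (D.dual.operad.zeroPiece (r + 1) 0).subtype e

theorem cupMul_zero (A : D.operad.Alg) {n M : ℕ} {d : ℤ} (m : Fin n → ℕ)
    (hM : M + 1 = ∑ i, (m i + 1)) :
    D.cupMul A m hM (0 : D.cupOperad.obj n d) = 0 := by
  unfold cupMul
  rw [map_zero, map_zero]
  rfl

theorem cupMul_add (A : D.operad.Alg) {n M : ℕ} {d : ℤ} (m : Fin n → ℕ)
    (hM : M + 1 = ∑ i, (m i + 1)) (t t' : D.cupOperad.obj n d) :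
    D.cupMul A m hM (t + t') = D.cupMul A m hM t + D.cupMul A m hM t' := by
  unfold cupMul
  rw [map_add, map_add]
  rfl

/-- Evaluation of the `End_A`-factor on `x`, followed by `ρ`. -/
def evalMap (A : D.operad.Alg) {r : ℕ} (x : Fin (r + 1) → A.carrier)
    (ρ : A.carrier →ₗ[k] D.operad.obj (r + 1)) :
    D.TildeC A r →ₗ[k] D.operad.obj (r + 1) ⊗[k] D.dual.operad.obj (r + 1) :=
  TensorProduct.map
    (ρ ∘ₗ ({ toFun := fun ψ => ψ x
             map_add' := fun _ _ => rfl
             map_smul' := fun _ _ => rfl } : D.Lin A (r + 1) →ₗ[k] A.carrier)) LinearMap.id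

/-- Isolates the identity term of the average: the term of `σ` applies `φ i` to the vector numbered
`σ⁻¹ i`, which is zero for some `i` unless `σ = 1`. In the remaining term `ρ` recovers the
`P`-factor. -/
theorem evalMap_sact_cupMul {r : ℕ} {d : ℤ} (hd : d + 1 = (r + 1 : ℕ))
    (hM : r + 1 = ∑ _i : Fin (r + 1), (0 + 1)) (A : D.operad.Alg) (x : Fin (r + 1) → A.carrier)
    (φ : Fin (r + 1) → A.carrier →ₗ[k] A.carrier) (ρ : A.carrier →ₗ[k] D.operad.obj (r + 1))
    (hφ : ∀ i j, φ i (x j) = if i = j then x i else 0) (hρ : ∀ p, ρ (A.op p x) = p)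
    (σ : Equiv.Perm (Fin (r + 1))) (t : D.operad.obj (r + 1) ⊗[k] D.dual.operad.obj (r + 1)) :
    D.evalMap A x ρ (D.sact A σ (D.cupMul A (fun _ => 0) hM (D.cupMk hd t)
      (fun i => (D.cochainOfEnd A (φ i)).1))) = if σ = 1 then t else 0 := by
  induction t using TensorProduct.induction_on with
  | zero =>
    rw [map_zero, cupMul_zero, zero_apply, map_zero, map_zero, ite_self]
  | add t t' ht ht' =>
    rw [map_add, cupMul_add, add_apply, map_add, map_add, ht, ht']
    split_ifs
    · rfl
    · exact add_zero 0
  | tmul p q =>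
    obtain ⟨χ, hχ, hχ'⟩ := D.cupMul_cochainOfEnd hd hM p q A φ
    have e : D.evalMap A x ρ (D.sact A σ (D.tmk A χ q)) =
        (((Equiv.Perm.sign σ : ℤˣ) : ℤ) : k) •
          (ρ (χ fun i => x (σ.symm i)) ⊗ₜ[k] D.dual.operad.act σ q) :=
      LinearMap.map_smul (D.evalMap A x ρ) (((Equiv.Perm.sign σ : ℤˣ) : ℤ) : k)
        ((D.endTensor A).act σ (D.tmk A χ q))
    rw [hχ', e, hχ]
    by_cases hσ : σ = 1
    · subst hσ
      have e1 : (fun i => φ i (x ((1 : Equiv.Perm (Fin (r + 1))).symm i))) = x :=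
        funext fun i => (hφ i i).trans (if_pos rfl)
      rw [e1, hρ, D.dual.operad.act_one]
      simp
    · obtain ⟨j, hj⟩ : ∃ j, σ.symm j ≠ j := by
        by_contra hcon
        push Not at hcon
        exact hσ (Equiv.ext fun j => by simpa using (hcon (σ j)).symm)
      rw [if_neg hσ, MultilinearMap.map_coord_zero _ j ((hφ _ _).trans (if_neg hj.symm))]
      rw [map_zero, TensorProduct.zero_tmul, smul_zero]

variable [CharZero k]

/-- It suffices to test on one algebra and on cochains of degree 0: evaluating the average there
returns `t` divided by `(r + 1)!`. -/
theorem cup_injective (n : ℕ) (d : ℤ) : Function.Injective (D.cup.app n d) := by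
  refine (injective_iff_map_eq_zero (D.cup.app n d)).2 fun t ht => ?_
  by_cases h : n = 0 ∨ d + 1 ≠ n
  · exact D.cupOperad_eq_zero h t
  push Not at h
  obtain ⟨hn, hd⟩ := h
  obtain ⟨r, rfl⟩ := Nat.exists_eq_succ_of_ne_zero hn
  obtain ⟨A, x, φ, ρ, hφ, hρ⟩ := exists_faithful D.operad r
  have hM : r + 1 = ∑ _i : Fin (r + 1), (0 + 1) := by simp
  have h0 : D.cupOn A (r + 1) d t = 0 :=
    congrArg (fun F => (familyOperad.val (D.natIncl.app (r + 1) d F) A)) ht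
  have h1 := D.cupOn_lof A t (fun _ => 0) (fun i => D.cochainOfEnd A (φ i)) hM
  rw [h0] at h1
  have h2 : D.aver A (D.cupTilde A t (fun i => D.cochainOfEnd A (φ i)) hM) = 0 :=
    DirectSum.of_injective (β := fun m => D.C A m) r (h1.symm.trans (map_zero _).symm)
  -- The same vanishing, seen in `TildeC` before restriction to invariants, so that the average can
  -- be evaluated term by term.
  have h3 : average (fun σ => D.sact A σ) (D.cupMul A (fun _ => 0) hM (D.cupMk hd t.1)
      (fun i => (D.cochainOfEnd A (φ i)).1)) = 0 := congrArg Subtype.val h2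
  have h4 := congrArg (D.evalMap A x ρ) h3
  rw [average_apply, map_smul, map_sum, map_zero,
    Finset.sum_congr rfl fun σ _ => D.evalMap_sact_cupMul hd hM A x φ ρ hφ hρ σ t.1] at h4
  have h5 := (smul_eq_zero.1 h4).resolve_left (inv_ne_zero card_perm_ne_zero)
  exact Subtype.ext (((Finset.sum_ite_eq' Finset.univ 1 _).trans
    (if_pos (Finset.mem_univ _))).symm.trans h5)

end QuadraticData

end Injectivity

end NatOps

end

/-! ### The main theorem. -/

theorem mainTheorem3 {k : Type u} [Field k] [CharZero k] (D : NatOps.QuadraticData.{u} k) :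
    ∃ cup : D.cupOperad.Hom D.natOperad,
      (∀ (n : ℕ) (d : ℤ), Function.Injective (cup.app n d)) ∧
      (∀ (n : ℕ) (d : ℤ) (t : D.cupOperad.obj n d),
        D.natIncl.app n d (cup.app n d t) ∈ D.naturalSpan n d) ∧
      (∀ (A : D.operad.Alg) (n : ℕ) (d : ℤ) (t : D.cupOperad.obj n d) (m : Fin n → ℕ)
        (f : ∀ i, D.C A (m i)) (M : ℕ) (hM : M + 1 = ∑ i, (m i + 1)),
        ((D.natAction A).app n d (cup.app n d t) : NatOps.homog k (fun m => D.C A m) n d).1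
            (fun i => DirectSum.lof k ℕ (fun m => D.C A m) (m i) (f i)) =
          DirectSum.lof k ℕ (fun m => D.C A m) M (D.aver A (D.cupTilde A t f hM))) :=
  ⟨D.cup, D.cup_injective, D.cupFamily_mem, fun A _ _ t m f _ hM => D.cupOn_lof A t m f hM⟩
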